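/- Let $k\subset K$ be an extension of fields, let $m,n\ge 0$ be integers, and let $A\subset M_n(K)$ be a $k$-subalgebra acting on the row vectors $K^n$ from the right. For a commutative $K$-algebra $R$ let $G(m,n)(R)$ be the set of direct summands $M$ of $R^n$ that are (locally free) of constant rank $m$. A ring map $R\to T$ acts on it by sending $M$ to the image of $T\otimes_R M\to T^n$. A free rank $m$ summand $M\subset R^n$ is said to be generated by $A$-invariants if the image of $\bigwedge^m M$ under $\bigwedge^m M\to\bigwedge^m R^n\cong R\otimes_K\bigwedge^m K^n$ has, as an $R$-module, a generator of the form $$\sum_i r_i\otimes v_{i1}\wedge\cdots\wedge v_{im},$$ where for each $i$ the vectors $v_{i1},\dots,v_{im}$ are a basis of an $A$-invariant subspace of $K^n$. Let $G_A(m,n)(R)\subset G(m,n)(R)$ be the set of those $M$ such that every point of $\operatorname{Spec}R$ has a basic open neighbourhood $D(f)$ over which $M$ becomes free and generated by $A$-invariants; this is a subfunctor of $G(m,n)$. Put $$\textstyle\bigwedge^m_A=\operatorname{Span}_K\{v_1\wedge\cdots\wedge v_m \mid v_1,\dots,v_m \text{ is a basis of an } A\text{-invariant subspace of } K^n\}\subset\bigwedge^m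 K^n.$$ For a finite-dimensional $K$-vector space $V$ let $\mathbb P(V)$ be the $K$-scheme whose $R$-points are the equivalence classes of epimorphisms $R\otimes_K V\to L$ with $L$ an invertible $R$-module (two being equivalent if they differ by an isomorphism of the targets, i.e. have the same kernel). Then $G(m,n)$, $\mathbb P((\bigwedge^m K^n)^*)$ and $\mathbb P((\bigwedge^m_A)^*)$ are representable by $K$-schemes (the first one by the Grassmannian $\mathbb G(m,n)$). There is a unique morphism $\mathbb G(m,n)\to\mathbb P((\bigwedge^m K^n)^*)$ that sends an $R$-point $M$ to the class of the epimorphism $R\otimes_K(\bigwedge^m K^n)^*\cong(\bigwedge^m R^n)^*\to(\bigwedge^m M)^*$, and a unique morphism $\mathbb P((\bigwedge^m_A)^*)\to\mathbb P((\bigwedge^m K^n)^*)$ induced on $R$-points by composition with $R\otimes_K(\bigwedge^m K^n)^*\to R\otimes_K(\bigwedge^m_A)^*$; both are closed immersions. The functor $G_A(m,n)$ is represented, compatibly with the inclusion $G_A(m,n)\subset G(m,n)$, by the pullback $\mathbb G_A(m,n)$ of the diagram $$\mathbb G(m,n)\longrightarrow \mathbb P\big((\textstyle\bigwedge^m K^n)^*\big)\longleftarrow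 \mathbb P\big((\textstyle\bigwedge^m_A)^*\big).$$ In particular $\mathbb G_A(m,n)$ is a closed subscheme of $\mathbb G(m,n)$ and is projective over $K$. Moreover, a free rank $m$ summand $M$ of $R^n$ belongs to $G_A(m,n)(R)$ if and only if it is generated by $A$-invariants. -/

import Mathlib

open CategoryTheory AlgebraicGeometry TensorProduct

universe u v

noncomputable section

namespace InvariantGrassmannian

/-! ### Base change of submodules of `R^n` -/

/-- The image of `T ⊗_R M → T ⊗_R R^n ≅ T^n` for a submodule `M ⊆ R^n` and a ring map `R → T`,
i.e. the `T`-span of the vectors of `M` mapped coordinatewise to `T^n`. -/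
def push {R T : Type*} [CommRing R] [CommRing T] {n : ℕ} (δ : R →+* T)
    (M : Submodule R (Fin n → R)) : Submodule T (Fin n → T) :=
  Submodule.span T ((fun x i => δ (x i)) '' (M : Set (Fin n → R)))

section push

variable {n : ℕ}

lemma push_id {R : Type*} [CommRing R] (M : Submodule R (Fin n → R)) :
    push (RingHom.id R) M = M := by
  simp [push]

lemma push_push {R S T : Type*} [CommRing R] [CommRing S] [CommRing T] (δ : R →+* S)
    (ε : S →+* T) (M : Submodule R (Fin n → R)) :
    push ε (push δ M) = push (ε.comp δ) M := by
  apply le_antisymm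
  · refine Submodule.span_le.2 ?_
    rintro _ ⟨x, hx, rfl⟩
    change x ∈ Submodule.span S _ at hx
    change (fun i => ε (x i)) ∈ push (ε.comp δ) M
    induction hx using Submodule.span_induction with
    | mem x h =>
      obtain ⟨y, hy, rfl⟩ := h
      exact Submodule.subset_span ⟨y, hy, rfl⟩
    | zero => simp only [Pi.zero_apply, map_zero]; exact (push (ε.comp δ) M).zero_mem
    | add x y _ _ hx hy => simpa using! (push (ε.comp δ) M).add_mem hx hy
    | smul a x _ hx => simpa using! (push (ε.comp δ) M).smul_mem (ε a) hx
  · refine Submodule.span_le.2 ?_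
    rintro _ ⟨x, hx, rfl⟩
    exact Submodule.subset_span ⟨fun i => δ (x i), Submodule.subset_span ⟨x, hx, rfl⟩, rfl⟩

lemma push_eq_map {R T : Type*} [CommRing R] [CommRing T] [Algebra R T]
    (M : Submodule R (Fin n → R)) :
    push (algebraMap R T) M =
      LinearMap.range ((TensorProduct.piScalarRight R T T (Fin n)).toLinearMap ∘ₗ
        M.subtype.baseChange T) := by
  have key : ∀ (t : T) (x : M), ((TensorProduct.piScalarRight R T T (Fin n)).toLinearMap ∘ₗ
        M.subtype.baseChange T) (t ⊗ₜ x) = t • fun i => algebraMap R T (x.1 i) := by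
    intro t x
    ext i
    simp [Algebra.smul_def, mul_comm]
  apply le_antisymm
  · refine Submodule.span_le.2 ?_
    rintro _ ⟨x, hx, rfl⟩
    exact ⟨1 ⊗ₜ ⟨x, hx⟩, by rw [key, one_smul]⟩
  · rintro _ ⟨z, rfl⟩
    induction z using TensorProduct.induction_on with
    | zero => simp
    | add x y hx hy => rw [map_add]; exact Submodule.add_mem _ hx hy
    | tmul t x => rw [key]; exact Submodule.smul_mem _ _ (Submodule.subset_span ⟨x.1, x.2, rfl⟩)

lemma baseChange_subtype_injective {R T : Type*} [CommRing R] [CommRing T] [Algebra R T]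
    {M N : Submodule R (Fin n → R)} (h : IsCompl M N) :
    Function.Injective (M.subtype.baseChange T) := by
  have h2 : (M.projectionOnto N h) ∘ₗ M.subtype = LinearMap.id := by
    ext x; simp
  have h3 := congrArg (LinearMap.baseChange T) h2
  rw [LinearMap.baseChange_comp, LinearMap.baseChange_id] at h3
  exact Function.LeftInverse.injective (g := (M.projectionOnto N h).baseChange T)
    fun x => LinearMap.congr_fun h3 x

/-- For a direct summand `M`, the base change `T ⊗_R M` is its image in `T^n`. -/
def pushEquiv {R T : Type*} [CommRing R] [CommRing T] [Algebra R T]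
    {M N : Submodule R (Fin n → R)} (h : IsCompl M N) :
    (T ⊗[R] M) ≃ₗ[T] push (algebraMap R T) M :=
  (LinearEquiv.ofInjective ((TensorProduct.piScalarRight R T T (Fin n)).toLinearMap ∘ₗ
        M.subtype.baseChange T)
      ((TensorProduct.piScalarRight R T T (Fin n)).injective.comp
        (baseChange_subtype_injective h))).trans
    (LinearEquiv.ofEq _ _ (push_eq_map M).symm)

lemma finite_of_isCompl {R : Type*} [CommRing R] {M N : Submodule R (Fin n → R)}
    (h : IsCompl M N) : Module.Finite R M :=
  Module.Finite.of_surjective (M.projectionOnto N h)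
    (fun x => ⟨x.1, by simp⟩)

lemma projective_of_isCompl {R : Type*} [CommRing R] {M N : Submodule R (Fin n → R)}
    (h : IsCompl M N) : Module.Projective R M :=
  Module.Projective.of_split M.subtype (M.projectionOnto N h) (by ext x; simp)

lemma isCompl_push {R T : Type*} [CommRing R] [CommRing T] [Algebra R T]
    {M N : Submodule R (Fin n → R)} (h : IsCompl M N) :
    IsCompl (push (algebraMap R T) M) (push (algebraMap R T) N) := by
  constructor
  · rw [Submodule.disjoint_def]
    intro y hM hN
    rw [push_eq_map] at hM hN
    obtain ⟨a, rfl⟩ := hM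
    obtain ⟨b, hb⟩ := hN
    have hab : N.subtype.baseChange T b = M.subtype.baseChange T a :=
      (TensorProduct.piScalarRight R T T (Fin n)).injective hb
    have h1 : (M.projectionOnto N h) ∘ₗ M.subtype = LinearMap.id := by
      ext x; simp
    have h2 : (M.projectionOnto N h) ∘ₗ N.subtype = 0 := by
      ext x; simp
    have h3 : ((M.projectionOnto N h) ∘ₗ N.subtype).baseChange T b =
        ((M.projectionOnto N h) ∘ₗ M.subtype).baseChange T a := by
      rw [LinearMap.baseChange_comp, LinearMap.baseChange_comp, LinearMap.comp_apply, hab,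
        LinearMap.comp_apply]
    rw [h1, h2, LinearMap.baseChange_id, LinearMap.baseChange_zero] at h3
    rw [← show (0 : T ⊗[R] M) = a from h3, map_zero]
  · rw [codisjoint_iff, eq_top_iff, ← (Pi.basisFun T (Fin n)).span_eq, Submodule.span_le]
    rintro _ ⟨i, rfl⟩
    have hi : (Pi.basisFun R (Fin n)) i ∈ M ⊔ N := by rw [h.sup_eq_top]; trivial
    obtain ⟨a, ha, b, hb, hab⟩ := Submodule.mem_sup.1 hi
    refine Submodule.mem_sup.2 ⟨_, Submodule.subset_span ⟨a, ha, rfl⟩, _,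
      Submodule.subset_span ⟨b, hb, rfl⟩, ?_⟩
    ext j
    have := congrArg (algebraMap R T) (congrFun hab j)
    simp only [Pi.add_apply, map_add] at this ⊢
    rw [this]
    simp [Pi.single_apply, apply_ite (algebraMap R T)]

lemma rankAtStalk_push {R T : Type*} [CommRing R] [CommRing T] [Algebra R T] {m : ℕ}
    {M N : Submodule R (Fin n → R)} (h : IsCompl M N)
    (hm : ∀ p, Module.rankAtStalk (R := R) M p = m) (p : PrimeSpectrum T) :
    Module.rankAtStalk (R := T) (push (algebraMap R T) M) p = m := by
  have := finite_of_isCompl h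
  have := projective_of_isCompl h
  rw [← Module.rankAtStalk_eq_of_equiv (pushEquiv (T := T) h), Module.rankAtStalk_baseChange, hm]

lemma isComplemented_push {R T : Type*} [CommRing R] [CommRing T] (δ : R →+* T)
    {M : Submodule R (Fin n → R)} (h : IsComplemented M) : IsComplemented (push δ M) := by
  let : Algebra R T := δ.toAlgebra
  obtain ⟨N, h⟩ := h
  exact ⟨_, isCompl_push (T := T) h⟩

lemma free_push {R T : Type*} [CommRing R] [CommRing T] (δ : R →+* T)
    {M : Submodule R (Fin n → R)} (h : IsComplemented M) (hM : Module.Free R M) :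
    Module.Free T (push δ M) := by
  let : Algebra R T := δ.toAlgebra
  obtain ⟨N, h⟩ := h
  exact Module.Free.of_equiv (pushEquiv (T := T) h)

end push

/-! ### The Grassmannian functor -/

/-- A direct summand `M` of `R^n` (hence a finitely generated projective module) of constant
rank `m`. -/
@[ext]
structure Summand (m n : ℕ) (R : Type u) [CommRing R] where
  /-- the underlying submodule -/
  carrier : Submodule R (Fin n → R)
  isComplemented : IsComplemented carrier
  rank_eq : ∀ p : PrimeSpectrum R, Module.rankAtStalk (R := R) carrier p = m

/-- Pullback of a summand along a ring map. -/
def Summand.map {m n : ℕ} {R T : Type u} [CommRing R] [CommRing T] (δ : R →+* T)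
    (M : Summand m n R) : Summand m n T where
  carrier := push δ M.carrier
  isComplemented := isComplemented_push δ M.isComplemented
  rank_eq := by
    let : Algebra R T := δ.toAlgebra
    obtain ⟨N, h⟩ := M.isComplemented
    exact rankAtStalk_push (T := T) h M.rank_eq

/-- The Grassmannian functor `G(m,n)` on commutative `K`-algebras: rank `m` summands of `R^n`. -/
def grassmannian (K : Type u) [Field K] (m n : ℕ) : CommAlgCat.{u} K ⥤ Type u where
  obj R := Summand m n R
  map f := ↾(Summand.map f.hom.toRingHom)
  map_id R := by
    apply ConcreteCategory.hom_ext
    intro M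
    exact Summand.ext (push_id M.carrier)
  map_comp f g := by
    apply ConcreteCategory.hom_ext
    intro M
    exact Summand.ext (push_push f.hom.toRingHom g.hom.toRingHom M.carrier).symm

/-! ### Exterior powers and base change -/

section exterior

/-- An alternating map over `R`, seen as an alternating map over a base ring `K`. -/
def restrictAlternating (K : Type*) {R M N ι : Type*} [CommRing K] [CommRing R] [Algebra K R]
    [AddCommGroup M] [Module R M] [Module K M] [IsScalarTower K R M] [AddCommGroup N] [Module R N]
    [Module K N] [IsScalarTower K R N] (f : M [⋀^ι]→ₗ[R] N) : M [⋀^ι]→ₗ[K] N :=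
  { f.toMultilinearMap.restrictScalars K with
    map_eq_zero_of_eq' := f.map_eq_zero_of_eq' }

variable {K : Type*} [Field K] (m n : ℕ) (R : Type*) [CommRing R] [Algebra K R]

/-- The `K`-linear map `⋀^m K^n → ⋀^m R^n`, `v₁ ∧ ⋯ ∧ v_m ↦ v₁ ∧ ⋯ ∧ v_m`. -/
def extendWedge : (⋀[K]^m (Fin n → K)) →ₗ[K] (⋀[R]^m (Fin n → R)) :=
  exteriorPower.alternatingMapLinearEquiv
    ((restrictAlternating K (exteriorPower.ιMulti R m (M := Fin n → R))).compLinearMap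
      ((Algebra.linearMap K R).compLeft (Fin n)))

lemma extendWedge_ιMulti (v : Fin m → Fin n → K) :
    extendWedge m n R (exteriorPower.ιMulti K m v) =
      exteriorPower.ιMulti R m (fun j i => algebraMap K R (v j i)) := by
  rw [extendWedge, exteriorPower.alternatingMapLinearEquiv_apply_ιMulti]
  rfl

lemma extendWedge_bijective :
    Function.Bijective ((extendWedge (K := K) m n R).liftBaseChange R) := by
  let bK := (((Pi.basisFun K (Fin n)).exteriorPower m).baseChange R)
  let bR := ((Pi.basisFun R (Fin n)).exteriorPower m)
  have h : (extendWedge (K := K) m n R).liftBaseChange R = (bK.equiv bR (Equiv.refl _)).toLinearMap := by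
    refine bK.ext fun s => ?_
    rw [LinearEquiv.coe_coe, Module.Basis.equiv_apply, Module.Basis.baseChange_apply,
      LinearMap.liftBaseChange_tmul, one_smul, exteriorPower.basis_apply,
      exteriorPower.ιMulti_family, extendWedge_ιMulti, Equiv.refl_apply,
      exteriorPower.basis_apply, exteriorPower.ιMulti_family]
    congr 1
    ext j i
    simp [Pi.single_apply, apply_ite (algebraMap K R)]
  rw [h]
  exact (bK.equiv bR (Equiv.refl _)).bijective

/-- The canonical isomorphism `⋀^m R^n ≅ R ⊗_K ⋀^m K^n`. -/
def wedgeEquiv : (⋀[R]^m (Fin n → R)) ≃ₗ[R] R ⊗[K] (⋀[K]^m (Fin n → K)) :=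
  (LinearEquiv.ofBijective _ (extendWedge_bijective (K := K) m n R)).symm

lemma wedgeEquiv_ιMulti (v : Fin m → Fin n → K) :
    wedgeEquiv m n R (exteriorPower.ιMulti R m (fun j i => algebraMap K R (v j i))) =
      (1 : R) ⊗ₜ[K] exteriorPower.ιMulti K m v := by
  rw [wedgeEquiv, LinearEquiv.symm_apply_eq, LinearEquiv.ofBijective_apply,
    LinearMap.liftBaseChange_tmul, extendWedge_ιMulti, one_smul]

variable {n R}

/-- The composite `⋀^m M → ⋀^m R^n ≅ R ⊗_K ⋀^m K^n` for a submodule `M` of `R^n`. -/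
def wedgeMap (K : Type*) [Field K] [Algebra K R] (M : Submodule R (Fin n → R)) :
    (⋀[R]^m M) →ₗ[R] R ⊗[K] (⋀[K]^m (Fin n → K)) :=
  (wedgeEquiv m n R).toLinearMap ∘ₗ exteriorPower.map m M.subtype

/-- The map `R ⊗_K (⋀^m K^n)^* ≅ (⋀^m R^n)^* → (⋀^m M)^*`, sending `r ⊗ ξ` to the linear form
`ω ↦ r • ξ_R(ω)`, where `ω` is regarded as an element of `R ⊗_K ⋀^m K^n`. -/
def pluckerMap (K : Type*) [Field K] [Algebra K R] (M : Submodule R (Fin n → R)) :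
    R ⊗[K] Module.Dual K (⋀[K]^m (Fin n → K)) →ₗ[R] Module.Dual R (⋀[R]^m M) :=
  (wedgeMap m K M).dualMap ∘ₗ (Module.Dual.baseChange R).liftBaseChange R

end exterior

/-! ### Families generated by invariants -/

section invariants

variable {k K : Type*} [Field k] [Field K] [Algebra k K] {n : ℕ}
  (A : Subalgebra k (Matrix (Fin n) (Fin n) K))

/-- `W ⊆ K^n` is `A`-invariant; `A` acts on row vectors from the right. -/
def IsInvariant (W : Submodule K (Fin n → K)) : Prop :=
  ∀ a ∈ A, ∀ w ∈ W, Matrix.vecMul w a ∈ W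

/-- `v₁, …, v_m` is a basis of an `A`-invariant subspace of `K^n`. -/
def IsInvariantBasis {m : ℕ} (v : Fin m → Fin n → K) : Prop :=
  LinearIndependent K v ∧ IsInvariant A (Submodule.span K (Set.range v))

/-- `⋀_A^m`: the span of the `v₁ ∧ ⋯ ∧ v_m` for `v₁, …, v_m` a basis of an `A`-invariant
subspace of `K^n`. -/
def invariantWedge (m : ℕ) : Submodule K (⋀[K]^m (Fin n → K)) :=
  Submodule.span K
    {ω | ∃ v : Fin m → Fin n → K, IsInvariantBasis A v ∧ ω = exteriorPower.ιMulti K m v}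

/-- `M ⊆ R^n` is generated by `A`-invariants: the image of `⋀^m M` in `R ⊗_K ⋀^m K^n` has a
generator of the form `∑ r_i ⊗ v_{i1} ∧ ⋯ ∧ v_{im}` with each `v_{i1}, …, v_{im}` a basis of an
`A`-invariant subspace. (Used for free `M` of rank `m`.) -/
def IsGeneratedByInvariants (m : ℕ) {R : Type*} [CommRing R] [Algebra K R]
    (M : Submodule R (Fin n → R)) : Prop :=
  ∃ (N : ℕ) (r : Fin N → R) (v : Fin N → Fin m → Fin n → K),
    (∀ i, IsInvariantBasis A (v i)) ∧
    LinearMap.range (wedgeMap m K M) =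
      Submodule.span R {∑ i, r i ⊗ₜ[K] exteriorPower.ιMulti K m (v i)}

/-- Every point of `Spec R` has a basic open neighbourhood `D(f)` over which `M` is a free module
generated by `A`-invariants. -/
def IsLocallyGeneratedByInvariants (m : ℕ) {R : Type*} [CommRing R] [Algebra K R]
    (M : Submodule R (Fin n → R)) : Prop :=
  ∀ p : PrimeSpectrum R, ∃ f : R, f ∉ p.asIdeal ∧
    Module.Free (Localization.Away f) (push (algebraMap R (Localization.Away f)) M) ∧
    IsGeneratedByInvariants A m (push (algebraMap R (Localization.Away f)) M)

lemma wedgeEquiv_baseChange (m : ℕ) {R T : Type*} [CommRing R] [CommRing T] [Algebra K R]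
    [Algebra K T] (δ : R →ₐ[K] T) (x : Fin m → Fin n → R) :
    wedgeEquiv m n T (exteriorPower.ιMulti T m (fun j i => δ (x j i))) =
      TensorProduct.map δ.toLinearMap LinearMap.id
        (wedgeEquiv m n R (exteriorPower.ιMulti R m x)) := by
  let : Algebra R T := δ.toRingHom.toAlgebra
  have : IsScalarTower K R T := IsScalarTower.of_algebraMap_eq fun a => (δ.commutes a).symm
  let L : R ⊗[K] (⋀[K]^m (Fin n → K)) →ₗ[R] T ⊗[K] (⋀[K]^m (Fin n → K)) :=
    TensorProduct.AlgebraTensorModule.map (Algebra.linearMap R T) LinearMap.id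
  let F : (Fin n → R) [⋀^Fin m]→ₗ[R] T ⊗[K] (⋀[K]^m (Fin n → K)) :=
    ((wedgeEquiv m n T).toLinearMap.restrictScalars R).compAlternatingMap
      ((restrictAlternating R (exteriorPower.ιMulti T m (M := Fin n → T))).compLinearMap
        ((Algebra.linearMap R T).compLeft (Fin n)))
  let G : (Fin n → R) [⋀^Fin m]→ₗ[R] T ⊗[K] (⋀[K]^m (Fin n → K)) :=
    (L ∘ₗ (wedgeEquiv m n R).toLinearMap).compAlternatingMap (exteriorPower.ιMulti R m)
  have hFG : F = G := by
    refine Module.Basis.ext_alternating (Pi.basisFun R (Fin n)) fun s _ => ?_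
    have h1 : F (fun j => Pi.basisFun R (Fin n) (s j)) =
        wedgeEquiv m n T (exteriorPower.ιMulti T m
          (fun j i => algebraMap K T (Pi.basisFun K (Fin n) (s j) i))) := by
      change wedgeEquiv m n T (exteriorPower.ιMulti T m _) = _
      congr 2
      ext j i
      simp [Pi.single_apply, apply_ite (algebraMap K T), apply_ite (algebraMap R T)]
    have h2 : G (fun j => Pi.basisFun R (Fin n) (s j)) =
        L (wedgeEquiv m n R (exteriorPower.ιMulti R m
          (fun j i => algebraMap K R (Pi.basisFun K (Fin n) (s j) i)))) := by
      change L (wedgeEquiv m n R (exteriorPower.ιMulti R m _)) = _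
      congr 3
      ext j i
      simp [Pi.single_apply, apply_ite (algebraMap K R)]
    rw [h1, h2, wedgeEquiv_ιMulti, wedgeEquiv_ιMulti]
    simp [L]
  exact congrArg (fun f : (Fin n → R) [⋀^Fin m]→ₗ[R] T ⊗[K] (⋀[K]^m (Fin n → K)) => f x) hFG

lemma range_wedgeMap (K : Type*) [Field K] (m : ℕ) {R : Type*} [CommRing R] [Algebra K R]
    (s : Set (Fin n → R)) :
    LinearMap.range (wedgeMap m K (Submodule.span R s)) =
      Submodule.span R ((fun x : Fin m → Fin n → R => wedgeEquiv m n R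
        (exteriorPower.ιMulti R m x)) '' {x | ∀ j, x j ∈ s}) := by
  have htop : Submodule.span R
      ((Submodule.span R s).subtype ⁻¹' s : Set (Submodule.span R s)) = ⊤ :=
    Submodule.span_span_coe_preimage
  rw [LinearMap.range_eq_map, ← exteriorPower.ιMulti_span_of_span R m _ htop, Submodule.map_span,
    Set.image_image]
  congr 1
  ext z
  constructor
  · rintro ⟨a, ha, rfl⟩
    refine ⟨fun j => (a j).1, fun j => ha ⟨j, rfl⟩, ?_⟩
    simp only [wedgeMap, LinearMap.comp_apply, exteriorPower.map_apply_ιMulti]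
    rfl
  · rintro ⟨x, hx, rfl⟩
    refine ⟨fun j => ⟨x j, Submodule.subset_span (hx j)⟩, ?_, ?_⟩
    · rintro _ ⟨j, rfl⟩; exact hx j
    · simp only [wedgeMap, LinearMap.comp_apply, exteriorPower.map_apply_ιMulti]
      rfl

lemma IsGeneratedByInvariants.push {m : ℕ} {R T : Type*} [CommRing R] [CommRing T] [Algebra K R]
    [Algebra K T] (δ : R →ₐ[K] T) {M : Submodule R (Fin n → R)}
    (h : IsGeneratedByInvariants A m M) :
    IsGeneratedByInvariants A m (push (δ : R →+* T) M) := by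
  obtain ⟨N, r, v, hv, hr⟩ := h
  refine ⟨N, fun i => δ (r i), v, hv, ?_⟩
  have hw : (∑ i, δ (r i) ⊗ₜ[K] exteriorPower.ιMulti K m (v i)) =
      TensorProduct.map δ.toLinearMap LinearMap.id
        (∑ i, r i ⊗ₜ[K] exteriorPower.ιMulti K m (v i)) := by simp
  rw [hw]
  have hM : LinearMap.range (wedgeMap m K M) =
      Submodule.span R ((fun x : Fin m → Fin n → R => wedgeEquiv m n R
        (exteriorPower.ιMulti R m x)) '' {x | ∀ j, x j ∈ (M : Set (Fin n → R))}) := by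
    have := range_wedgeMap K m (M : Set (Fin n → R))
    rwa [Submodule.span_eq] at this
  have hlin : ∀ (a : R) (z : R ⊗[K] (⋀[K]^m (Fin n → K))),
      TensorProduct.map δ.toLinearMap LinearMap.id (a • z) =
        δ a • TensorProduct.map δ.toLinearMap LinearMap.id z := by
    intro a z
    induction z using TensorProduct.induction_on with
    | zero => simp
    | add x y hx hy => rw [smul_add, map_add, hx, hy, map_add, smul_add]
    | tmul t x => simp [TensorProduct.smul_tmul']
  rw [InvariantGrassmannian.push, range_wedgeMap]
  apply le_antisymm
  · refine Submodule.span_le.2 ?_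
    rintro _ ⟨x, hx, rfl⟩
    choose y hy hyx using hx
    have hx' : x = fun j i => δ (y j i) := by
      funext j; exact (hyx j).symm
    have hmem : wedgeEquiv (K := K) m n R (exteriorPower.ιMulti R m y) ∈
        LinearMap.range (wedgeMap m K M) := by
      rw [hM]; exact Submodule.subset_span ⟨y, hy, rfl⟩
    rw [hr, Submodule.mem_span_singleton] at hmem
    obtain ⟨a, ha⟩ := hmem
    refine Submodule.mem_span_singleton.2 ⟨δ a, ?_⟩
    rw [← hlin, ha, hx']
    exact (wedgeEquiv_baseChange m δ y).symm
  · rw [Submodule.span_singleton_le_iff_mem]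
    have hmem : (∑ i, r i ⊗ₜ[K] exteriorPower.ιMulti K m (v i)) ∈
        LinearMap.range (wedgeMap m K M) := by
      rw [hr]; exact Submodule.mem_span_singleton_self _
    rw [hM] at hmem
    generalize (∑ i, r i ⊗ₜ[K] exteriorPower.ιMulti K m (v i)) = w at hmem
    induction hmem using Submodule.span_induction with
    | mem z hz =>
      obtain ⟨y, hy, rfl⟩ := hz
      refine Submodule.subset_span ⟨fun j i => δ (y j i), fun j => ⟨y j, hy j, rfl⟩, ?_⟩
      exact wedgeEquiv_baseChange m δ y
    | zero => rw [map_zero]; exact Submodule.zero_mem _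
    | add x y _ _ hx hy => rw [map_add]; exact Submodule.add_mem _ hx hy
    | smul a x _ hx => rw [hlin]; exact Submodule.smul_mem _ _ hx

lemma exists_awayMap {R T : Type*} [CommRing R] [CommRing T]
    [Algebra K R] [Algebra K T] (δ : R →ₐ[K] T) (f : R) :
    ∃ ε : Localization.Away f →ₐ[K] Localization.Away (δ f),
      (ε : Localization.Away f →+* Localization.Away (δ f)).comp
        (algebraMap R (Localization.Away f)) =
      (algebraMap T (Localization.Away (δ f))).comp (δ : R →+* T) := by
  refine ⟨Localization.awayMapₐ δ f, RingHom.ext fun r => ?_⟩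
  simp [IsLocalization.Away.mapₐ, IsLocalization.Away.map]

lemma IsLocallyGeneratedByInvariants.push {m : ℕ} {R T : Type*} [CommRing R] [CommRing T]
    [Algebra K R] [Algebra K T] (δ : R →ₐ[K] T) {M : Submodule R (Fin n → R)}
    (hM : IsComplemented M) (h : IsLocallyGeneratedByInvariants A m M) :
    IsLocallyGeneratedByInvariants A m (push (δ : R →+* T) M) := by
  intro q
  obtain ⟨f, hf, hfree, hgen⟩ := h (q.comap (δ : R →+* T))
  obtain ⟨ε, hε⟩ := exists_awayMap (K := K) δ f
  have hpush : InvariantGrassmannian.push (algebraMap T (Localization.Away (δ f)))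
      (InvariantGrassmannian.push (δ : R →+* T) M) =
      InvariantGrassmannian.push (ε : Localization.Away f →+* Localization.Away (δ f))
        (InvariantGrassmannian.push (algebraMap R (Localization.Away f)) M) := by
    rw [push_push, push_push, hε]
  refine ⟨δ f, hf, ?_, ?_⟩
  · rw [hpush]
    exact free_push _ (isComplemented_push _ hM) hfree
  · rw [hpush]
    exact IsGeneratedByInvariants.push A ε hgen

end invariants

/-- The functor `G_A(m,n)`: the subfunctor of `G(m,n)` of the summands `M` of `R^n` which are
locally on `Spec R` free and generated by `A`-invariants. -/
def grassmannianOfInvariants {k : Type v} {K : Type u} [Field k] [Field K] [Algebra k K] (m : ℕ)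
    {n : ℕ} (A : Subalgebra k (Matrix (Fin n) (Fin n) K)) : Subfunctor (grassmannian K m n) where
  obj R := {M : Summand m n R | IsLocallyGeneratedByInvariants A m M.carrier}
  map f M hM := IsLocallyGeneratedByInvariants.push A f.hom (Summand.isComplemented M) hM

/-! ### Schemes over `K` and their functors of points -/

section schemes

attribute [local instance] MvPolynomial.gradedAlgebra

variable (K : Type u) [Field K]

/-- The category of schemes over `Spec K`. -/
abbrev Sch : Type (u + 1) := Over (Spec (CommRingCat.of K))

variable {K}

/-- The functor of points `h_Y = Hom_{Spec K}(Spec -, Y)` on commutative `K`-algebras. -/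
def points (Y : Sch K) : CommAlgCat.{u} K ⥤ Type u :=
  (algSpec (CommRingCat.of K)).rightOp ⋙ yoneda.obj Y

/-- The map on points induced by a morphism of `K`-schemes. -/
def pointsMap {X Y : Sch K} (f : X ⟶ Y) : points X ⟶ points Y :=
  Functor.whiskerLeft (algSpec (CommRingCat.of K)).rightOp (yoneda.map f)

/-- The functor of points of the projectivization `ℙ(V)`: equivalence classes of epimorphisms from
`R ⊗_K V` to an invertible `R`-module. A class is recorded by the common kernel of its members,
i.e. by a submodule of `R ⊗_K V` whose quotient is finite projective of constant rank one. -/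
abbrev projectivization (V : Type u) [AddCommGroup V] [Module K V] : CommAlgCat.{u} K ⥤ Type u :=
  Module.Grassmannian.functor.{u, u, u} (R := K) (M := V) 1

/-- The structure morphism of `ℙ^N_K = Proj K[x_0, …, x_N]` over `Spec K`. -/
def projectiveSpaceHom (K : Type u) [Field K] (N : ℕ) :
    Proj (MvPolynomial.homogeneousSubmodule (Fin (N + 1)) K) ⟶ Spec (CommRingCat.of K) :=
  Proj.toSpecZero (MvPolynomial.homogeneousSubmodule (Fin (N + 1)) K) ≫
    Spec.map (CommRingCat.ofHom
      (algebraMap K (MvPolynomial.homogeneousSubmodule (Fin (N + 1)) K 0)))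

/-- A `K`-scheme is projective if it is a closed subscheme of some `ℙ^N_K`. -/
def IsProjectiveScheme (X : Sch K) : Prop :=
  ∃ (N : ℕ) (i : X.left ⟶ Proj (MvPolynomial.homogeneousSubmodule (Fin (N + 1)) K)),
    IsClosedImmersion i ∧ i ≫ projectiveSpaceHom K N = X.hom

variable {m n : ℕ}

/-- `ι : 𝔾(m,n) → ℙ((⋀^m K^n)^*)` is the canonical (Plücker) morphism: on `R`-points it sends `M`
to the class of the epimorphism `R ⊗_K (⋀^m K^n)^* ≅ (⋀^m R^n)^* → (⋀^m M)^*`. -/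
def IsPlucker {G P : Sch K} (α : points G ≅ grassmannian K m n)
    (β : points P ≅ projectivization (Module.Dual K (⋀[K]^m (Fin n → K)))) (ι : G ⟶ P) : Prop :=
  ∀ (R : CommAlgCat.{u} K) (x : (points G).obj R),
    Function.Surjective (pluckerMap m K (Summand.carrier (α.hom.app R x))) ∧
    Module.Grassmannian.toSubmodule (β.hom.app R ((pointsMap ι).app R x)) =
      LinearMap.ker (pluckerMap m K (Summand.carrier (α.hom.app R x)))

/-- `j : ℙ(U^*) → ℙ(V^*)` is induced by the inclusion `U ⊆ V`: on `R`-points it sends the class of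
an epimorphism `τ : R ⊗_K U^* → L` to the class of `R ⊗_K V^* → R ⊗_K U^* → L`. -/
def IsInducedByInclusion {V : Type u} [AddCommGroup V] [Module K V] {U : Submodule K V}
    {Q P : Sch K} (γ : points Q ≅ projectivization (Module.Dual K U))
    (β : points P ≅ projectivization (Module.Dual K V)) (j : Q ⟶ P) : Prop :=
  ∀ (R : CommAlgCat.{u} K) (y : (points Q).obj R),
    Module.Grassmannian.toSubmodule (β.hom.app R ((pointsMap j).app R y)) =
      (Module.Grassmannian.toSubmodule (γ.hom.app R y)).comap (U.subtype.dualMap.baseChange R)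

end schemes

end InvariantGrassmannian

end

open InvariantGrassmannian

noncomputable section

namespace InvariantGrassmannian

/-! ### Zariski sheaves on commutative algebras -/

section zariski

variable {K : Type u} [Field K]

/-! The heart of the matter is linear algebra. A summand `M` has a Plücker module, the image of `⋀^m
M` in `R ⊗ ⋀^m K^n`. If `M` is free, this module is cyclic, generated by the exterior product of a
basis. This generator is a sum of the prescribed form exactly when it lies in `R ⊗ ⋀_A^m`, so for
free `M` being generated by `A`-invariants means that the Plücker module is contained in `R ⊗ ⋀_A^m`
(`isGeneratedByInvariants_iff`). Such a containment says that the linear forms vanishing on `⋀_A^m`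
also vanish on the Plücker module (`mem_baseChange_iff_pairing`). Vanishing of elements of `R` is a
local condition, so the local definition of `G_A(m,n)` amounts to the same containment
(`mem_grassmannianOfInvariants_iff`), which yields the last assertion. It also says that the Plücker
point of `M` comes from `ℙ((⋀_A^m)^*)` (`pluckerHom_mem_range_inclHom_iff`), and this is the
description by a pullback.

The geometry is done with functors on `K`-algebras. The functor of points is fully faithful on
`K`-schemes (`hom_ext_of_points`, `exists_pointsMap_eq`), and both schemes and the functors at hand
are Zariski sheaves. A closed subfunctor of a scheme is cut out by an ideal sheaf
(`exists_closed_subscheme`), so a morphism injective on points with closed image is a closed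
immersion (`isClosedImmersion_of_isClosedSubfunctor`).

Representability of `ℙ(V)` follows by comparing it with `Proj` of a polynomial ring: both are
sheaves with the same standard charts and the same gluing relation (`exists_iso_of_atlas`,
`nonempty_iso_projSpace`). The Grassmannian is then obtained as a closed subfunctor. On the chart of
projective space where one Plücker coordinate is `1`, the only candidate for a preimage is the row
span of the matrix whose entries are the adjacent coordinates. Being in the image means that the
remaining coordinates are the minors of this matrix, which is a system of polynomial equations
(`kerPoint_mem_range_pluckerHom`). The map induced by a subspace is closed because its image is
given by linear equations (`mem_range_quotientHom`). -/

/-- The localization `R_f` as a commutative `K`-algebra. -/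
abbrev away (R : CommAlgCat.{u} K) (f : R) : CommAlgCat.{u} K :=
  CommAlgCat.of K (Localization.Away f)

/-- The localization map `R ⟶ R_f`. -/
def toAway (R : CommAlgCat.{u} K) (f : R) : R ⟶ away R f :=
  CommAlgCat.ofHom (IsScalarTower.toAlgHom K R (Localization.Away f))

lemma toAway_apply (R : CommAlgCat.{u} K) (f r : R) :
    (toAway R f).hom r = algebraMap R (Localization.Away f) r := rfl

lemma isUnit_toAway (R : CommAlgCat.{u} K) (f : R) : IsUnit ((toAway R f).hom f) :=
  IsLocalization.Away.algebraMap_isUnit f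

/-- A map inverting `f` factors through `R_f`. -/
def awayDesc {R T : CommAlgCat.{u} K} (δ : R ⟶ T) (f : R) (h : IsUnit (δ.hom f)) : away R f ⟶ T :=
  CommAlgCat.ofHom
    { IsLocalization.Away.lift (S := Localization.Away f) f (g := δ.hom.toRingHom) h with
      commutes' := fun a => by
        change IsLocalization.Away.lift (S := Localization.Away f) f (g := δ.hom.toRingHom) h
          (algebraMap K (Localization.Away f) a) = _
        rw [IsScalarTower.algebraMap_apply K R (Localization.Away f), IsLocalization.Away.lift_eq]
        exact δ.hom.commutes a }

lemma toAway_awayDesc {R T : CommAlgCat.{u} K} (δ : R ⟶ T) (f : R) (h : IsUnit (δ.hom f)) :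
    toAway R f ≫ awayDesc δ f h = δ := by
  apply CommAlgCat.hom_ext
  ext r
  exact IsLocalization.Away.lift_eq f h r

/-- Quasi-compactness of `Spec R`: the admissible elements lie in no common maximal ideal, so
finitely many of them generate the unit ideal. -/
lemma exists_finite_cover {R : Type u} [CommRing R] {P : R → Prop}
    (h : ∀ p : PrimeSpectrum R, ∃ f, f ∉ p.asIdeal ∧ P f) :
    ∃ (ι : Type u) (_ : Finite ι) (f : ι → R), Ideal.span (Set.range f) = ⊤ ∧ ∀ i, P (f i) := by
  have htop : Ideal.span {f | P f} = ⊤ := by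
    by_contra hne
    obtain ⟨m, hm, hle⟩ := Ideal.exists_le_maximal _ hne
    obtain ⟨f, hf, hP⟩ := h ⟨m, hm.isPrime⟩
    exact hf (hle (Ideal.subset_span hP))
  obtain ⟨s, hs, hs'⟩ := (Ideal.span_eq_top_iff_finite _).1 htop
  exact ⟨s, inferInstance, Subtype.val, by simpa using hs', fun i => hs i.2⟩

lemma exists_notMem_of_span_eq_top {R ι : Type*} [CommRing R] {f : ι → R}
    (hf : Ideal.span (Set.range f) = ⊤) (p : PrimeSpectrum R) : ∃ i, f i ∉ p.asIdeal := by
  by_contra! h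
  refine p.isPrime.ne_top (top_le_iff.1 (hf ▸ Ideal.span_le.2 ?_))
  rintro _ ⟨i, rfl⟩
  exact h i

/-- A functor on `K`-algebras is a Zariski sheaf if compatible sections over a finite cover by
basic opens glue uniquely. -/
def IsZariskiSheaf (F : CommAlgCat.{u} K ⥤ Type u) : Prop :=
  ∀ (R : CommAlgCat.{u} K) (ι : Type u) (_ : Finite ι) (f : ι → R),
    Ideal.span (Set.range f) = ⊤ → ∀ y : (∀ i, F.obj (away R (f i))),
    (∀ (T : CommAlgCat.{u} K) (i j : ι) (a : away R (f i) ⟶ T) (b : away R (f j) ⟶ T),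
      toAway R (f i) ≫ a = toAway R (f j) ≫ b → F.map a (y i) = F.map b (y j)) →
    ∃! z : F.obj R, ∀ i, F.map (toAway R (f i)) z = y i

/-- A natural transformation is locally surjective for the Zariski topology. -/
def IsLocallySurj {C F : CommAlgCat.{u} K ⥤ Type u} (φ : C ⟶ F) : Prop :=
  ∀ (R : CommAlgCat.{u} K) (y : F.obj R) (p : PrimeSpectrum R), ∃ f : R, f ∉ p.asIdeal ∧
    ∃ c : C.obj (away R f), φ.app _ c = F.map (toAway R f) y

lemma map_map_apply (F : CommAlgCat.{u} K ⥤ Type u) {R S T : CommAlgCat.{u} K} (δ : R ⟶ S)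
    (ε : S ⟶ T) (y : F.obj R) : F.map ε (F.map δ y) = F.map (δ ≫ ε) y := by
  rw [Functor.map_comp]; rfl

lemma app_map_apply {C F : CommAlgCat.{u} K ⥤ Type u} (φ : C ⟶ F) {R S : CommAlgCat.{u} K}
    (δ : R ⟶ S) (c : C.obj R) : φ.app S (C.map δ c) = F.map δ (φ.app R c) :=
  ConcreteCategory.congr_hom (φ.naturality δ) c

lemma IsZariskiSheaf.eq_of_locally {F : CommAlgCat.{u} K ⥤ Type u} (hF : IsZariskiSheaf F)
    {R : CommAlgCat.{u} K} {z z' : F.obj R}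
    (h : ∀ p : PrimeSpectrum R, ∃ f : R, f ∉ p.asIdeal ∧
      F.map (toAway R f) z = F.map (toAway R f) z') : z = z' := by
  obtain ⟨ι, _, f, hf, hP⟩ := exists_finite_cover h
  refine (hF R ι ‹_› f hf (fun i => F.map (toAway R (f i)) z) ?_).unique (fun i => rfl)
    (fun i => (hP i).symm)
  intro T i j a b hab
  rw [map_map_apply, map_map_apply, hab]

/-- The map `R_f ⟶ T_{δ f}` induced by `δ : R ⟶ T`. -/
def awayMap {R T : CommAlgCat.{u} K} (δ : R ⟶ T) (f : R) : away R f ⟶ away T (δ.hom f) :=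
  awayDesc (δ ≫ toAway T (δ.hom f)) f (isUnit_toAway T _)

lemma toAway_awayMap {R T : CommAlgCat.{u} K} (δ : R ⟶ T) (f : R) :
    toAway R f ≫ awayMap δ f = δ ≫ toAway T (δ.hom f) := toAway_awayDesc _ _ _

/-- The prime of `R` below a prime of `T`. -/
abbrev comapPrime {R T : CommAlgCat.{u} K} (δ : R ⟶ T) (p : PrimeSpectrum T) : PrimeSpectrum R :=
  p.comap δ.hom.toRingHom

lemma hom_ext_of_isLocallySurj {C F F' : CommAlgCat.{u} K ⥤ Type u} (φ : C ⟶ F)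
    (hφ : IsLocallySurj φ) (hF' : IsZariskiSheaf F') {a b : F ⟶ F'} (h : φ ≫ a = φ ≫ b) :
    a = b := by
  ext R y
  refine hF'.eq_of_locally fun p => ?_
  obtain ⟨f, hf, c, hc⟩ := hφ R y p
  refine ⟨f, hf, ?_⟩
  change F'.map _ (a.app R y) = F'.map _ (b.app R y)
  rw [← app_map_apply, ← app_map_apply, ← hc]
  exact ConcreteCategory.congr_hom (NatTrans.congr_app h _) c

/-- A section of `F` lifts locally to `C`. The images of these lifts under `ψ` agree on overlaps,
since `ψ` identifies whatever `φ` identifies, and they glue in the sheaf `F'`. -/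
lemma exists_desc_of_isLocallySurj {C F F' : CommAlgCat.{u} K ⥤ Type u} (φ : C ⟶ F) (ψ : C ⟶ F')
    (hφ : IsLocallySurj φ) (hF' : IsZariskiSheaf F')
    (h : ∀ (R : CommAlgCat.{u} K) (c c' : C.obj R),
      φ.app R c = φ.app R c' → ψ.app R c = ψ.app R c') :
    ∃ η : F ⟶ F', φ ≫ η = ψ := by
  -- The glued section is characterised by all lifts after all base changes, not only by those on
  -- the chosen cover. It is thus unique, and naturality follows.
  have key : ∀ (R : CommAlgCat.{u} K) (y : F.obj R), ∃ z : F'.obj R,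
      ∀ (T : CommAlgCat.{u} K) (δ : R ⟶ T) (c : C.obj T), φ.app T c = F.map δ y →
        ψ.app T c = F'.map δ z := by
    intro R y
    obtain ⟨ι, _, f, hf, hP⟩ := exists_finite_cover (hφ R y)
    choose c hc using hP
    obtain ⟨z, hz, -⟩ := hF' R ι ‹_› f hf (fun i => ψ.app _ (c i)) (by
      intro T i j a b hab
      rw [← app_map_apply, ← app_map_apply]
      apply h
      rw [app_map_apply, app_map_apply, hc, hc, map_map_apply, map_map_apply, hab])
    refine ⟨z, fun T δ d hd => hF'.eq_of_locally fun p => ?_⟩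
    obtain ⟨i, hi⟩ := exists_notMem_of_span_eq_top hf (comapPrime δ p)
    refine ⟨δ.hom (f i), hi, ?_⟩
    rw [map_map_apply, ← toAway_awayMap, ← map_map_apply, hz i, ← app_map_apply, ← app_map_apply]
    apply h
    rw [app_map_apply, app_map_apply, hd, hc, map_map_apply, map_map_apply, toAway_awayMap]
  choose z hz using key
  have huniq : ∀ (R : CommAlgCat.{u} K) (y : F.obj R) (w : F'.obj R),
      (∀ (T : CommAlgCat.{u} K) (δ : R ⟶ T) (c : C.obj T), φ.app T c = F.map δ y →
        ψ.app T c = F'.map δ w) → w = z R y := by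
    intro R y w hw
    refine hF'.eq_of_locally fun p => ?_
    obtain ⟨f, hf, c, hc⟩ := hφ R y p
    exact ⟨f, hf, by rw [← hw _ _ c hc, ← hz _ _ _ _ c hc]⟩
  refine ⟨{ app := fun R => ↾(z R), naturality := fun R S δ => ?_ }, ?_⟩
  · ext y
    refine (huniq S (F.map δ y) (F'.map δ (z R y)) fun T ε c hc => ?_).symm
    rw [map_map_apply] at hc ⊢
    exact hz R y T _ c hc
  · ext R c
    have := hz R (φ.app R c) R (𝟙 R) c (by simp)
    rw [F'.map_id] at this
    exact this.symm

/-- Two Zariski sheaves covered by the same charts with the same gluing relation are isomorphic. -/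
theorem exists_iso_of_atlas {C F F' : CommAlgCat.{u} K ⥤ Type u} (φ : C ⟶ F) (ψ : C ⟶ F')
    (hF : IsZariskiSheaf F) (hF' : IsZariskiSheaf F') (hφ : IsLocallySurj φ)
    (hψ : IsLocallySurj ψ)
    (h : ∀ (R : CommAlgCat.{u} K) (c c' : C.obj R),
      φ.app R c = φ.app R c' ↔ ψ.app R c = ψ.app R c') :
    Nonempty (F ≅ F') := by
  obtain ⟨η, hη⟩ := exists_desc_of_isLocallySurj φ ψ hφ hF' fun R c c' => (h R c c').1
  obtain ⟨θ, hθ⟩ := exists_desc_of_isLocallySurj ψ φ hψ hF fun R c c' => (h R c c').2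
  refine ⟨⟨η, θ, ?_, ?_⟩⟩
  · refine hom_ext_of_isLocallySurj φ hφ hF ?_
    rw [← Category.assoc, hη, hθ, Category.comp_id]
  · refine hom_ext_of_isLocallySurj ψ hψ hF' ?_
    rw [← Category.assoc, hθ, hη, Category.comp_id]

/-- Injectivity makes the local preimages unique, hence compatible, so they glue. -/
lemma mem_range_of_locally {F F' : CommAlgCat.{u} K ⥤ Type u} (φ : F ⟶ F')
    (hF : IsZariskiSheaf F) (hF' : IsZariskiSheaf F')
    (hinj : ∀ R : CommAlgCat.{u} K, Function.Injective (φ.app R)) {R : CommAlgCat.{u} K}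
    (y : F'.obj R)
    (h : ∀ p : PrimeSpectrum R, ∃ f : R, f ∉ p.asIdeal ∧
      F'.map (toAway R f) y ∈ Set.range (φ.app (away R f))) :
    y ∈ Set.range (φ.app R) := by
  obtain ⟨ι, _, f, hf, hP⟩ := exists_finite_cover h
  choose c hc using hP
  obtain ⟨z, hz, -⟩ := hF R ι ‹_› f hf c (by
    intro T i j a b hab
    apply hinj
    rw [app_map_apply, app_map_apply, hc, hc, map_map_apply, map_map_apply, hab])
  refine ⟨z, hF'.eq_of_locally fun p => ?_⟩
  obtain ⟨i, hi⟩ := exists_notMem_of_span_eq_top hf p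
  exact ⟨f i, hi, by rw [← app_map_apply, hz, hc]⟩

/-! ### Closed subfunctors and their local nature. -/

/-- A subfunctor is closed if its preimage under every section over `R` is `Spec (R ⧸ I)` for
an ideal `I`. -/
def IsClosedSubfunctor {F : CommAlgCat.{u} K ⥤ Type u} (G : Subfunctor F) : Prop :=
  ∀ (R : CommAlgCat.{u} K) (x : F.obj R), ∃ I : Ideal R, ∀ (T : CommAlgCat.{u} K) (δ : R ⟶ T),
    F.map δ x ∈ G.obj T ↔ I ≤ RingHom.ker δ.hom.toRingHom

/-- The annihilator of `r` is contained in no maximal ideal. -/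
lemma eq_zero_of_locally {R : Type*} [CommRing R] {r : R}
    (h : ∀ p : PrimeSpectrum R, ∃ f, f ∉ p.asIdeal ∧
      algebraMap R (Localization.Away f) r = 0) : r = 0 := by
  have htop : (⊥ : Ideal R).colon {r} = ⊤ := by
    by_contra hne
    obtain ⟨m, hm, hle⟩ := Ideal.exists_le_maximal _ hne
    obtain ⟨f, hf, h0⟩ := h ⟨m, hm.isPrime⟩
    rw [IsLocalization.map_eq_zero_iff (Submonoid.powers f)] at h0
    obtain ⟨⟨_, k, rfl⟩, hk⟩ := h0
    refine hf (hm.isPrime.mem_of_pow_mem k (hle ?_))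
    rw [Submodule.mem_colon_singleton]
    exact hk
  have : (1 : R) ∈ (⊥ : Ideal R).colon {r} := by rw [htop]; trivial
  rw [Submodule.mem_colon_singleton] at this
  simpa using this

/-- A condition on `R`-algebras which is local and locally given by an ideal is given by an
ideal. -/
lemma exists_ideal_of_locally (R : CommAlgCat.{u} K)
    (P : ∀ T : CommAlgCat.{u} K, (R ⟶ T) → Prop)
    (hcomp : ∀ (S T : CommAlgCat.{u} K) (δ : R ⟶ S) (ε : S ⟶ T), P S δ → P T (δ ≫ ε))
    (hloc : ∀ (T : CommAlgCat.{u} K) (δ : R ⟶ T), (∀ p : PrimeSpectrum T, ∃ g : T,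
      g ∉ p.asIdeal ∧ P _ (δ ≫ toAway T g)) → P T δ)
    (hideal : ∀ p : PrimeSpectrum R, ∃ f : R, f ∉ p.asIdeal ∧ ∃ I : Ideal (away R f),
      ∀ (T : CommAlgCat.{u} K) (ε : away R f ⟶ T),
        P T (toAway R f ≫ ε) ↔ I ≤ RingHom.ker ε.hom.toRingHom) :
    ∃ I : Ideal R, ∀ (T : CommAlgCat.{u} K) (δ : R ⟶ T),
      P T δ ↔ I ≤ RingHom.ker δ.hom.toRingHom := by
  obtain ⟨ι, _, f, hf, hP⟩ := exists_finite_cover hideal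
  choose I hI using hP
  -- The ideals agree on overlaps. Over `R_{f_j} ⧸ I_j` the condition holds, hence also after
  -- inverting `f_i`. That algebra receives a map from `R_{f_i}`, so the image of `r` vanishes in
  -- it, and a power of `f_i` kills `r` before localising.
  have hk : ∀ (r : R) (i j : ι), (toAway R (f i)).hom r ∈ I i →
      ∃ k : ℕ, (toAway R (f j)).hom (f i ^ k * r) ∈ I j := by
    intro r i j hr
    let B : CommAlgCat.{u} K := CommAlgCat.of K (away R (f j) ⧸ I j)
    let π : away R (f j) ⟶ B := CommAlgCat.ofHom (Ideal.Quotient.mkₐ K (I j))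
    have hπ : P B (toAway R (f j) ≫ π) := (hI j B π).2 fun x hx =>
      Ideal.Quotient.eq_zero_iff_mem.2 hx
    let δ := toAway R (f j) ≫ π
    have h2 := hcomp _ _ _ (toAway B (δ.hom (f i))) hπ
    change P _ (δ ≫ _) at h2
    rw [← toAway_awayMap, hI] at h2
    have h3 : (toAway R (f i) ≫ awayMap δ (f i)).hom r = 0 := h2 hr
    rw [toAway_awayMap] at h3
    have h4 : algebraMap B (Localization.Away (δ.hom (f i))) (δ.hom r) = 0 := h3
    rw [IsLocalization.map_eq_zero_iff (Submonoid.powers (δ.hom (f i)))] at h4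
    obtain ⟨⟨_, k, rfl⟩, hk⟩ := h4
    refine ⟨k, Ideal.Quotient.eq_zero_iff_mem.1 ?_⟩
    change δ.hom (f i ^ k * r) = 0
    rw [map_mul, map_pow]
    exact hk
  refine ⟨⨅ i, (I i).comap (toAway R (f i)).hom.toRingHom, fun T δ => ⟨fun hδ r hr => ?_,
    fun hδ => ?_⟩⟩
  · refine eq_zero_of_locally fun p => ?_
    obtain ⟨i, hi⟩ := exists_notMem_of_span_eq_top hf (comapPrime δ p)
    refine ⟨δ.hom (f i), hi, ?_⟩
    have h2 := hcomp _ _ _ (toAway T (δ.hom (f i))) hδ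
    rw [← toAway_awayMap, hI] at h2
    have hr' := (Ideal.mem_iInf.1 hr) i
    have h3 : (toAway R (f i) ≫ awayMap δ (f i)).hom r = 0 := h2 hr'
    rw [toAway_awayMap] at h3
    exact h3
  · refine hloc T δ fun p => ?_
    obtain ⟨i, hi⟩ := exists_notMem_of_span_eq_top hf (comapPrime δ p)
    refine ⟨δ.hom (f i), hi, ?_⟩
    rw [← toAway_awayMap, hI]
    intro x hx
    obtain ⟨⟨r, ⟨_, l, rfl⟩⟩, hr⟩ := IsLocalization.surj (Submonoid.powers (f i)) x
    have hr' : (toAway R (f i)).hom r ∈ I i := by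
      rw [toAway_apply, ← hr]
      exact Ideal.mul_mem_right _ _ hx
    -- As the cover is finite, one exponent serves all `j`, and `f_i ^ N * r` lies in the
    -- intersection of the preimages. It differs from `x` only by a unit of `R_{f_i}`.
    choose k hk using fun j => hk r i j hr'
    obtain ⟨N, hN⟩ := (Set.finite_range k).bddAbove
    have h1 : f i ^ N * r ∈ ⨅ i, (I i).comap (toAway R (f i)).hom.toRingHom := by
      refine Ideal.mem_iInf.2 fun j => ?_
      obtain ⟨d, hd⟩ := Nat.exists_eq_add_of_le (hN ⟨j, rfl⟩)
      change (toAway R (f j)).hom (f i ^ N * r) ∈ I j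
      rw [hd, add_comm, pow_add, mul_assoc, map_mul]
      exact Ideal.mul_mem_left _ _ (hk j)
    have h2 : δ.hom (f i ^ N * r) = 0 := hδ h1
    have h3 : (awayMap δ (f i)).hom ((toAway R (f i)).hom (f i ^ N * r)) = 0 := by
      have : (toAway R (f i) ≫ awayMap δ (f i)).hom (f i ^ N * r) = 0 := by
        rw [toAway_awayMap]
        change (toAway T _).hom (δ.hom _) = 0
        rw [h2, map_zero]
      exact this
    have hu := (isUnit_toAway R (f i)).pow (N + l)
    have h4 : (awayMap δ (f i)).hom ((toAway R (f i)).hom (f i) ^ (N + l) * x) = 0 := by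
      rw [← h3]
      congr 1
      rw [map_mul, map_pow, pow_add, mul_assoc]
      congr 1
      rw [toAway_apply R (f i) r, ← hr, mul_comm]
      congr 1
      exact (map_pow (algebraMap R (Localization.Away (f i))) (f i) l).symm
    rw [map_mul, (hu.map (awayMap δ (f i)).hom).mul_right_eq_zero] at h4
    exact h4

/-- For an injective map of sheaves, lying in the image is a local condition, so it suffices to find
the ideal on small basic opens. -/
lemma isClosedSubfunctor_range {F F' : CommAlgCat.{u} K ⥤ Type u} (φ : F ⟶ F')
    (hF : IsZariskiSheaf F) (hF' : IsZariskiSheaf F')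
    (hinj : ∀ R : CommAlgCat.{u} K, Function.Injective (φ.app R))
    (h : ∀ (R : CommAlgCat.{u} K) (x : F'.obj R) (p : PrimeSpectrum R), ∃ f : R,
      f ∉ p.asIdeal ∧ ∃ I : Ideal (away R f), ∀ (T : CommAlgCat.{u} K) (ε : away R f ⟶ T),
        F'.map ε (F'.map (toAway R f) x) ∈ Set.range (φ.app T) ↔
          I ≤ RingHom.ker ε.hom.toRingHom) :
    IsClosedSubfunctor (Subfunctor.range φ) := by
  intro R x
  refine exists_ideal_of_locally R (fun T δ => F'.map δ x ∈ Set.range (φ.app T)) ?_ ?_ ?_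
  · rintro S T δ ε ⟨z, hz⟩
    exact ⟨F.map ε z, by rw [app_map_apply, hz, map_map_apply]⟩
  · intro T δ hT
    refine mem_range_of_locally φ hF hF' hinj _ fun p => ?_
    obtain ⟨g, hg, h⟩ := hT p
    exact ⟨g, hg, by rw [map_map_apply]; exact h⟩
  · intro p
    obtain ⟨f, hf, I, hI⟩ := h R x p
    exact ⟨f, hf, I, fun T ε => by rw [← hI, map_map_apply]⟩

end zariski

/-! ### Gluing of submodules -/

section glue

variable {R : Type*} [CommRing R] {ι : Type*} {f : ι → R}

lemma exists_pow_smul_mem_of_mem_span {E E' : Type*} [AddCommGroup E] [Module R E]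
    [AddCommGroup E'] [Module R E'] (r : R) [Module (Localization.Away r) E']
    [IsScalarTower R (Localization.Away r) E'] (g : E →ₗ[R] E')
    [IsLocalizedModule (Submonoid.powers r) g] (N : Submodule R E) {x : E}
    (hx : g x ∈ Submodule.span (Localization.Away r) (g '' (N : Set E))) :
    ∃ k : ℕ, r ^ k • x ∈ N := by
  rw [← Submodule.localized'_eq_span (Localization.Away r) (Submonoid.powers r) g,
    Submodule.mem_localized'] at hx
  obtain ⟨m, hm, ⟨_, k, rfl⟩, h⟩ := hx
  rw [IsLocalizedModule.mk'_eq_iff, eq_comm] at h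
  have h' : g (r ^ k • x) = g m := by rw [map_smul]; exact h
  rw [IsLocalizedModule.eq_iff_exists (Submonoid.powers r) g] at h'
  obtain ⟨⟨_, l, rfl⟩, hl⟩ := h'
  refine ⟨l + k, ?_⟩
  rw [pow_add, mul_smul]
  exact (show r ^ l • r ^ k • x = r ^ l • m from hl) ▸ N.smul_mem _ hm

variable (hf : Ideal.span (Set.range f) = ⊤) {E : Type*} [AddCommGroup E] [Module R E]
  {E' : ι → Type*} [∀ i, AddCommGroup (E' i)] [∀ i, Module R (E' i)]
  [∀ i, Module (Localization.Away (f i)) (E' i)]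
  [∀ i, IsScalarTower R (Localization.Away (f i)) (E' i)] (g : ∀ i, E →ₗ[R] E' i)
  [∀ i, IsLocalizedModule (Submonoid.powers (f i)) (g i)]

/-- The glued submodule consists of the vectors that land in every `N i`. The hypothesis is
agreement on overlaps with denominators cleared; finiteness of the cover allows one power of `f i`
for all `j`. -/
lemma exists_glued_submodule [Finite ι] (N : ∀ i, Submodule (Localization.Away (f i)) (E' i))
    (h : ∀ i j x, g i x ∈ N i → ∃ k : ℕ, g j (f i ^ k • x) ∈ N j) :
    ∃ M : Submodule R E, ∀ i, Submodule.span (Localization.Away (f i)) (g i '' (M : Set E)) =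
      N i := by
  refine ⟨⨅ i, ((N i).restrictScalars R).comap (g i), fun i => le_antisymm ?_ fun y hy => ?_⟩
  · refine Submodule.span_le.2 ?_
    rintro _ ⟨x, hx, rfl⟩
    exact (Submodule.mem_iInf _).1 hx i
  · obtain ⟨⟨x, ⟨_, l, rfl⟩⟩, hx⟩ := IsLocalizedModule.surj (Submonoid.powers (f i)) (g i) y
    have hx : f i ^ l • y = g i x := hx
    have hxN : g i x ∈ N i := by
      rw [← hx, ← algebraMap_smul (Localization.Away (f i))]
      exact (N i).smul_mem _ hy
    choose k hk using fun j => h i j x hxN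
    obtain ⟨d, hd⟩ := (Set.finite_range k).bddAbove
    have hmem : f i ^ d • x ∈ ⨅ i, ((N i).restrictScalars R).comap (g i) := by
      refine (Submodule.mem_iInf _).2 fun j => ?_
      obtain ⟨e, he⟩ := Nat.exists_eq_add_of_le (hd ⟨j, rfl⟩)
      change g j (f i ^ d • x) ∈ N j
      rw [he, add_comm, pow_add, mul_smul, map_smul, ← algebraMap_smul (Localization.Away (f j))]
      exact (N j).smul_mem _ (hk j)
    have hu : IsUnit (algebraMap R (Localization.Away (f i)) (f i ^ (d + l))) := by
      rw [map_pow]; exact (IsLocalization.Away.algebraMap_isUnit (f i)).pow _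
    obtain ⟨w, hw⟩ := hu
    have hy' : y = (↑w⁻¹ : Localization.Away (f i)) • g i (f i ^ d • x) := by
      rw [map_smul, ← hx, smul_smul, ← pow_add,
        ← algebraMap_smul (Localization.Away (f i)) (f i ^ (d + l)) y, ← hw,
        smul_smul, Units.inv_mul, one_smul]
    rw [hy']
    exact Submodule.smul_mem _ _ (Submodule.subset_span ⟨_, hmem, rfl⟩)

-- Projective means flat and finitely presented, and both properties descend from the cover. For
-- finite presentation, `M` is locally the kernel of a surjection from a finite module onto a
-- finitely presented one, so it is finitely generated.
include hf in
lemma projective_quotient_of_locally [Module.Finite R E] [Module.Projective R E]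
    (M : Submodule R E)
    (h : ∀ i, Module.Projective (Localization.Away (f i))
      (E' i ⧸ Submodule.span (Localization.Away (f i)) (g i '' (M : Set E)))) :
    Module.Projective R (E ⧸ M) := by
  have hE := Module.finitePresentation_of_projective R E
  have hE' : ∀ i, Module.Finite (Localization.Away (f i)) (E' i) := fun i =>
    Module.Finite.of_isLocalizedModule (Submonoid.powers (f i)) (g i)
  replace h : ∀ i, Module.Projective (Localization.Away (f i)) (E' i ⧸ M.localized'
      (Localization.Away (f i)) (Submonoid.powers (f i)) (g i)) := fun i => by
    rw [Submodule.localized'_eq_span]; exact h i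
  -- The local-to-global statements are indexed by the elements of the set `Set.range f`, so an
  -- index is chosen for every element.
  have hidx : ∀ r : Set.range f, f r.2.choose = r := fun r => r.2.choose_spec
  have hfg : M.FG := by
    have h1 : ∀ r : Set.range f, IsLocalization.Away r.1 (Localization.Away (f r.2.choose)) := by
      have : ∀ (r : R) i, f i = r → IsLocalization.Away r (Localization.Away (f i)) := by
        rintro _ i rfl; infer_instance
      exact fun r => this _ _ (hidx r)
    have h2 : ∀ r : Set.range f, IsLocalizedModule (Submonoid.powers r.1) (g r.2.choose) := by
      have : ∀ (r : R) i, f i = r → IsLocalizedModule (Submonoid.powers r) (g i) := by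
        rintro _ i rfl; infer_instance
      exact fun r => this _ _ (hidx r)
    refine Submodule.of_localizationSpan' (Set.range f) hf
      (Rₚ := fun r => Localization.Away (f r.2.choose))
      (fun r : Set.range f => g r.2.choose) fun r => ?_
    have h3 : ∀ i, (M.localized' (Localization.Away (f i)) (Submonoid.powers (f i)) (g i)).FG := by
      intro i
      have := Module.finitePresentation_of_projective (Localization.Away (f i))
        (E' i ⧸ M.localized' (Localization.Away (f i)) (Submonoid.powers (f i)) (g i))
      have := Module.FinitePresentation.fg_ker (Submodule.mkQ
        (M.localized' (Localization.Away (f i)) (Submonoid.powers (f i)) (g i)))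
        (Submodule.mkQ_surjective _)
      rwa [Submodule.ker_mkQ] at this
    convert h3 r.2.choose using 2
    exact congrArg _ (hidx r).symm
  have hfp : Module.FinitePresentation R (E ⧸ M) :=
    Module.finitePresentation_of_surjective M.mkQ M.mkQ_surjective (by rwa [Submodule.ker_mkQ])
  have hflat : Module.Flat R (E ⧸ M) := by
    refine Module.flat_of_localized_span _ _ _ hf ?_
    rintro ⟨_, i, rfl⟩
    have : Module.Flat R (E' i ⧸ M.localized' (Localization.Away (f i))
      (Submonoid.powers (f i)) (g i)) := Module.Flat.trans R (Localization.Away (f i)) _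
    exact Module.Flat.of_linearEquiv (IsLocalizedModule.iso (Submonoid.powers (f i))
      (M.toLocalizedQuotient' (Localization.Away (f i)) (Submonoid.powers (f i)) (g i)))
  exact Module.Flat.projective_of_finitePresentation

end glue

lemma exists_comap_eq {R : Type*} [CommRing R] {f : R} (p : PrimeSpectrum R)
    (hf : f ∉ p.asIdeal) :
    ∃ q : PrimeSpectrum (Localization.Away f), q.comap (algebraMap R _) = p := by
  have : p ∈ Set.range (PrimeSpectrum.comap (algebraMap R (Localization.Away f))) := by
    rw [PrimeSpectrum.localization_away_comap_range _ f]
    exact hf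
  exact this


/-! ### The functors `ℙ(V)` and `G(m,n)` are Zariski sheaves -/

section grassmannian

variable {K : Type u} [Field K]

/-- The induced map of quotients is a surjection between projective modules of equal rank, hence
bijective. Points can therefore be compared by a single inclusion. -/
lemma Grassmannian.eq_of_le {R M : Type*} [CommRing R] [AddCommGroup M] [Module R M] {d : ℕ}
    {H H' : Module.Grassmannian R M d} (h : H.toSubmodule ≤ H'.toSubmodule) : H = H' := by
  have hb := Module.bijective_of_surjective_of_rankAtStalk_eq
    (φ := Submodule.factor h) (Submodule.factor_surjective h) fun m hm => by
      rw [H.rankAtStalk_eq, H'.rankAtStalk_eq]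
  refine Module.Grassmannian.ext (le_antisymm h fun x hx => ?_)
  have : Submodule.factor h (Submodule.Quotient.mk x) = Submodule.factor h 0 := by
    rw [map_zero]
    exact (Submodule.Quotient.mk_eq_zero _).2 hx
  exact (Submodule.Quotient.mk_eq_zero _).1 (hb.1 this)

variable (V : Type u) [AddCommGroup V] [Module K V]

/-- The map `S ⊗ V → T ⊗ V` induced by a map of `K`-algebras `S ⟶ T`. -/
abbrev tmap {S T : CommAlgCat.{u} K} (ε : S ⟶ T) : S ⊗[K] V →ₗ[K] T ⊗[K] V :=
  LinearMap.rTensor V ε.hom.toLinearMap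

lemma tmap_smul {S T : CommAlgCat.{u} K} (ε : S ⟶ T) (s : S) (x : S ⊗[K] V) :
    tmap V ε (s • x) = ε.hom s • tmap V ε x := by
  induction x using TensorProduct.induction_on with
  | zero => simp
  | add x y hx hy => rw [smul_add, map_add, hx, hy, map_add, smul_add]
  | tmul t x => simp [TensorProduct.smul_tmul']

lemma tmap_comp {S T U : CommAlgCat.{u} K} (ε : S ⟶ T) (δ : T ⟶ U) (x : S ⊗[K] V) :
    tmap V (ε ≫ δ) x = tmap V δ (tmap V ε x) := by
  rw [tmap, tmap, ← LinearMap.comp_apply, ← LinearMap.rTensor_comp]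
  rfl

lemma exists_lTensor_subtype_eq {S M : Type*} (T : Type*) [CommRing S] [AddCommGroup M] [Module S M]
    [AddCommGroup T] [Module S T] (N : Submodule S M) (x : T ⊗[S] M)
    (hx : LinearMap.lTensor T N.mkQ x = 0) : ∃ z, LinearMap.lTensor T N.subtype z = x :=
  (lTensor_exact T (LinearMap.exact_subtype_mkQ N) N.mkQ_surjective x).1 hx

/-- The base change of a point is defined as the kernel of a map to the base changed quotient. Right
exactness of the tensor product shows that this kernel is generated by the image of the original
submodule. -/
lemma Grassmannian.map_toSubmodule_eq {S T : CommAlgCat.{u} K} (ε : S ⟶ T) {d : ℕ}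
    (H : Module.Grassmannian S (S ⊗[K] V) d) :
    (Module.Grassmannian.map ε.hom H).toSubmodule =
      Submodule.span T (tmap V ε '' (H.toSubmodule : Set (S ⊗[K] V))) := by
  rw [Module.Grassmannian.map_toSubmodule]
  let : Algebra S T := ε.hom.toRingHom.toAlgebra
  have : IsScalarTower K S T := IsScalarTower.of_algebraMap_eq fun a => (ε.hom.commutes a).symm
  have hex := exists_lTensor_subtype_eq T H.toSubmodule
  have hc : ∀ x : S ⊗[K] V, (AlgebraTensorModule.cancelBaseChange K S T T V) (1 ⊗ₜ x) =
      tmap V ε x := by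
    intro x
    induction x using TensorProduct.induction_on with
    | zero => simp
    | add x y hx hy => rw [TensorProduct.tmul_add, map_add, hx, hy, map_add]
    | tmul s v =>
      rw [AlgebraTensorModule.cancelBaseChange_tmul, LinearMap.rTensor_tmul, Algebra.smul_def,
        mul_one]
      rfl
  apply le_antisymm
  · intro x hx
    obtain ⟨z, hz⟩ := hex ((AlgebraTensorModule.cancelBaseChange K S T T V).symm x) hx
    have hx' : x = (AlgebraTensorModule.cancelBaseChange K S T T V)
        (LinearMap.lTensor T H.toSubmodule.subtype z) := by
      rw [hz, LinearEquiv.apply_symm_apply]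
    rw [hx']
    clear hx' hz hx
    induction z using TensorProduct.induction_on with
    | zero => simp
    | add x y hx hy => rw [map_add, map_add]; exact Submodule.add_mem _ hx hy
    | tmul t y =>
      have : LinearMap.lTensor T H.toSubmodule.subtype (t ⊗ₜ y) = t • ((1 : T) ⊗ₜ[S] y.1) := by
        rw [LinearMap.lTensor_tmul, TensorProduct.smul_tmul', smul_eq_mul, mul_one]
        rfl
      rw [this, map_smul, hc]
      exact Submodule.smul_mem _ _ (Submodule.subset_span ⟨_, y.2, rfl⟩)
  · refine Submodule.span_le.2 ?_
    rintro _ ⟨x, hx, rfl⟩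
    change LinearMap.baseChange T H.toSubmodule.mkQ
      ((AlgebraTensorModule.cancelBaseChange K S T T V).symm (tmap V ε x)) = 0
    have h0 : H.toSubmodule.mkQ x = 0 := (Submodule.Quotient.mk_eq_zero _).2 hx
    rw [← hc, LinearEquiv.symm_apply_apply, LinearMap.baseChange_tmul, h0, TensorProduct.tmul_zero]

/-- `R ⊗ V → R_f ⊗ V` as an `R`-linear map. -/
def toAwayTensor (R : CommAlgCat.{u} K) (f : R) :
    R ⊗[K] V →ₗ[R] (away R f) ⊗[K] V :=
  { tmap V (toAway R f) with
    map_smul' := fun r x => by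
      change tmap V (toAway R f) (r • x) = r • tmap V (toAway R f) x
      rw [tmap_smul]
      exact algebraMap_smul (Localization.Away f) r _ }

instance (R : CommAlgCat.{u} K) (f : R) :
    IsLocalizedModule (Submonoid.powers f) (toAwayTensor V R f) := by
  rw [isLocalizedModule_iff_isBaseChange (Submonoid.powers f) (Localization.Away f)]
  refine IsBaseChange.of_equiv (AlgebraTensorModule.cancelBaseChange K R (Localization.Away f)
    (Localization.Away f) V) fun x => ?_
  induction x using TensorProduct.induction_on with
  | zero => simp
  | add x y hx hy => rw [TensorProduct.tmul_add, map_add, hx, hy, map_add]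
  | tmul s v =>
    rw [AlgebraTensorModule.cancelBaseChange_tmul, Algebra.smul_def, mul_one]
    rfl

lemma exists_pow_smul_mem_of_tmap_mem {R : CommAlgCat.{u} K} {f : R} (N : Submodule R (R ⊗[K] V))
    {x : R ⊗[K] V} (hx : tmap V (toAway R f) x ∈
      Submodule.span (away R f) (tmap V (toAway R f) '' (N : Set (R ⊗[K] V)))) :
    ∃ k : ℕ, f ^ k • x ∈ N :=
  exists_pow_smul_mem_of_mem_span f (toAwayTensor V R f) N hx

lemma projectivization_map {S T : CommAlgCat.{u} K} (ε : S ⟶ T)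
    (y : (projectivization (K := K) V).obj S) :
    Module.Grassmannian.toSubmodule ((projectivization (K := K) V).map ε y) =
      Submodule.span T (tmap V ε '' (Module.Grassmannian.toSubmodule y : Set (S ⊗[K] V))) :=
  Grassmannian.map_toSubmodule_eq V ε y

lemma tmap_mem_projectivization_map {S T : CommAlgCat.{u} K} (ε : S ⟶ T)
    (y : (projectivization (K := K) V).obj S) {x : S ⊗[K] V}
    (hx : x ∈ Module.Grassmannian.toSubmodule y) :
    tmap V ε x ∈ Module.Grassmannian.toSubmodule ((projectivization (K := K) V).map ε y) := by
  rw [projectivization_map]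
  exact Submodule.subset_span ⟨x, hx, rfl⟩

/-- The submodules glue by `exists_glued_submodule`; projectivity and rank of the quotient are
inherited from the cover. -/
theorem isZariskiSheaf_projectivization [Module.Finite K V] :
    IsZariskiSheaf (projectivization (K := K) V) := by
  intro R ι _ f hf y hy
  -- Compatibility is tested over the localization of `R_{f_j}` at the image of `f_i`; clearing
  -- denominators there produces the power of `f_i`.
  have compat : ∀ (i j : ι) (x : R ⊗[K] V),
      tmap V (toAway R (f i)) x ∈ Module.Grassmannian.toSubmodule (y i) →
      ∃ k : ℕ, tmap V (toAway R (f j)) (f i ^ k • x) ∈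
        Module.Grassmannian.toSubmodule (y j) := by
    intro i j x hx
    have h1 := tmap_mem_projectivization_map V (awayMap (toAway R (f j)) (f i)) (y i) hx
    rw [hy _ i j (awayMap (toAway R (f j)) (f i)) (toAway _ _) (toAway_awayMap _ _),
      projectivization_map, ← tmap_comp, toAway_awayMap, tmap_comp] at h1
    obtain ⟨k, hk⟩ := exists_pow_smul_mem_of_tmap_mem V _ h1
    refine ⟨k, ?_⟩
    rw [tmap_smul, map_pow]
    exact hk
  obtain ⟨M, hM⟩ := exists_glued_submodule (fun i => toAwayTensor (K := K) V R (f i))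
    (fun i => (Module.Grassmannian.toSubmodule (y i))) compat
  have hproj : Module.Projective R ((R ⊗[K] V) ⧸ M) :=
    projective_quotient_of_locally hf (fun i => toAwayTensor V R (f i)) M fun i => by
      rw [hM i]; exact (y i).projective_quotient
  let z : (projectivization (K := K) V).obj R :=
    { toSubmodule := M
      finite_quotient := inferInstance
      projective_quotient := hproj
      rankAtStalk_eq := fun p => by
        obtain ⟨i, hi⟩ := exists_notMem_of_span_eq_top hf p
        obtain ⟨q, rfl⟩ := exists_comap_eq p hi
        rw [← Module.rankAtStalk_isBaseChange (S := Localization.Away (f i))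
          (f := M.toLocalizedQuotient' (Localization.Away (f i)) (Submonoid.powers (f i))
            (toAwayTensor V R (f i)))
          (IsLocalizedModule.isBaseChange (Submonoid.powers (f i)) _ _) q]
        have h : M.localized' (Localization.Away (f i)) (Submonoid.powers (f i))
            (toAwayTensor V R (f i)) = (y i).toSubmodule := by
          rw [Submodule.localized'_eq_span]; exact hM i
        rw [h]
        exact (y i).rankAtStalk_eq q }
  refine ⟨z, fun i => ?_, fun z' hz' => ?_⟩
  · refine Module.Grassmannian.ext ?_
    exact (projectivization_map V _ z).trans (hM i)
  · refine Grassmannian.eq_of_le fun x hx => ?_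
    refine Submodule.mem_of_span_eq_top_of_smul_pow_mem M (Set.range f) hf x ?_
    rintro ⟨_, i, rfl⟩
    refine exists_pow_smul_mem_of_tmap_mem V M ?_
    have h1 := tmap_mem_projectivization_map V (toAway R (f i)) z' hx
    rw [hz' i] at h1
    exact (hM i).ge h1

end grassmannian

/-! ### The sheaf property of the Grassmannian functor. -/

section grassmannian

variable {K : Type u} [Field K]

lemma isComplemented_of_projective_quotient {R E : Type*} [CommRing R] [AddCommGroup E] [Module R E]
    (M : Submodule R E) [Module.Projective R (E ⧸ M)] : IsComplemented M := by
  obtain ⟨s, hs⟩ := Module.projective_lifting_property M.mkQ LinearMap.id M.mkQ_surjective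
  have hs' : ∀ x, M.mkQ (s x) = x := LinearMap.congr_fun hs
  have hmem : ∀ x, (LinearMap.id - s ∘ₗ M.mkQ : E →ₗ[R] E) x ∈ M := by
    intro x
    refine (Submodule.Quotient.mk_eq_zero M).1 (?_ : M.mkQ _ = 0)
    simp only [LinearMap.sub_apply, LinearMap.comp_apply, LinearMap.id_apply, map_sub, hs', sub_self]
  refine ⟨_, LinearMap.isCompl_of_proj (f := (LinearMap.id - s ∘ₗ M.mkQ).codRestrict M hmem) ?_⟩
  intro x
  ext
  have : M.mkQ x.1 = 0 := (Submodule.Quotient.mk_eq_zero _).2 x.2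
  simp [LinearMap.codRestrict_apply, -Submodule.mkQ_apply, this]

lemma projective_quotient_of_isComplemented {R E : Type*} [CommRing R] [AddCommGroup E] [Module R E]
    [Module.Projective R E] {M : Submodule R E} (h : IsComplemented M) :
    Module.Projective R (E ⧸ M) := by
  obtain ⟨N, h⟩ := h
  have : Module.Projective R N :=
    Module.Projective.of_split N.subtype (N.projectionOnto M h.symm) (by ext x; simp)
  exact Module.Projective.of_equiv (Submodule.quotientEquivOfIsCompl M N h).symm

/-- Apply a ring map to all coordinates of a vector. -/
abbrev vmap {n : ℕ} {S T : CommAlgCat.{u} K} (ε : S ⟶ T) (x : Fin n → S) : Fin n → T :=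
  fun i => ε.hom (x i)

variable {m n : ℕ}

lemma grassmannian_map_carrier {S T : CommAlgCat.{u} K} (ε : S ⟶ T)
    (M : (grassmannian K m n).obj S) :
    Summand.carrier ((grassmannian K m n).map ε M) =
      Submodule.span T (vmap ε '' (Summand.carrier M : Set (Fin n → S))) := rfl

lemma vmap_mem_grassmannian_map {S T : CommAlgCat.{u} K} (ε : S ⟶ T)
    (M : (grassmannian K m n).obj S) {x : Fin n → S} (hx : x ∈ Summand.carrier M) :
    vmap ε x ∈ Summand.carrier ((grassmannian K m n).map ε M) :=
  Submodule.subset_span ⟨x, hx, rfl⟩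

/-- The localization map `R^n → R_f^n`. -/
def toAwayPi (n : ℕ) (R : CommAlgCat.{u} K) (f : R) : (Fin n → R) →ₗ[R] (Fin n → away R f) :=
  LinearMap.pi fun i => Algebra.linearMap R (Localization.Away f) ∘ₗ LinearMap.proj i

instance (R : CommAlgCat.{u} K) (f : R) :
    IsLocalizedModule (Submonoid.powers f) (toAwayPi n R f) :=
  IsLocalizedModule.pi (Submonoid.powers f) fun _ => Algebra.linearMap R (Localization.Away f)

lemma exists_pow_smul_mem_of_vmap_mem {R : CommAlgCat.{u} K} {f : R} (N : Submodule R (Fin n → R))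
    {x : Fin n → R} (hx : vmap (toAway R f) x ∈
      Submodule.span (away R f) (vmap (toAway R f) '' (N : Set (Fin n → R)))) :
    ∃ k : ℕ, f ^ k • x ∈ N :=
  exists_pow_smul_mem_of_mem_span f (toAwayPi n R f) N hx

lemma vmap_smul {S T : CommAlgCat.{u} K} (ε : S ⟶ T) (s : S) (x : Fin n → S) :
    vmap ε (s • x) = ε.hom s • vmap ε x := by
  ext i; simp [vmap]

/-- Submodules of `R^n` glue as they do for projectivizations. A summand is a submodule with
projective quotient, which is a local property, and the rank at a prime is read off on a basic open
containing it. -/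
theorem isZariskiSheaf_grassmannian : IsZariskiSheaf (grassmannian K m n) := by
  intro R ι _ f hf y hy
  have compat : ∀ (i j : ι) (x : Fin n → R),
      vmap (toAway R (f i)) x ∈ Summand.carrier (y i) →
      ∃ k : ℕ, vmap (toAway R (f j)) (f i ^ k • x) ∈ Summand.carrier (y j) := by
    intro i j x hx
    have h1 := vmap_mem_grassmannian_map (awayMap (toAway R (f j)) (f i)) (y i) hx
    have h2 : vmap (awayMap (toAway R (f j)) (f i)) (vmap (toAway R (f i)) x) =
        vmap (toAway (away R (f j)) ((toAway R (f j)).hom (f i))) (vmap (toAway R (f j)) x) := by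
      change vmap (toAway R (f i) ≫ awayMap (toAway R (f j)) (f i)) x = _
      rw [toAway_awayMap]
      rfl
    rw [hy _ i j (awayMap (toAway R (f j)) (f i)) (toAway _ _) (toAway_awayMap _ _),
      grassmannian_map_carrier, h2] at h1
    obtain ⟨k, hk⟩ := exists_pow_smul_mem_of_vmap_mem _ h1
    refine ⟨k, ?_⟩
    rw [vmap_smul, map_pow]
    exact hk
  obtain ⟨M, hM⟩ := exists_glued_submodule (fun i => toAwayPi (K := K) n R (f i))
    (fun i => Summand.carrier (y i)) compat
  have hproj : Module.Projective R ((Fin n → R) ⧸ M) :=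
    projective_quotient_of_locally hf (fun i => toAwayPi n R (f i)) M fun i => by
      rw [hM i]
      exact projective_quotient_of_isComplemented (Summand.isComplemented (y i))
  have hcompl := isComplemented_of_projective_quotient M
  let z : (grassmannian K m n).obj R :=
    { carrier := M
      isComplemented := hcompl
      rank_eq := fun p => by
        obtain ⟨i, hi⟩ := exists_notMem_of_span_eq_top hf p
        obtain ⟨q, rfl⟩ := exists_comap_eq p hi
        obtain ⟨N, hN⟩ := hcompl
        have := finite_of_isCompl hN
        have := projective_of_isCompl hN
        rw [← Module.rankAtStalk_baseChange (S := Localization.Away (f i)),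
          Module.rankAtStalk_eq_of_equiv (pushEquiv (T := Localization.Away (f i)) hN)]
        have h : push (algebraMap R (Localization.Away (f i))) M = Summand.carrier (y i) := hM i
        rw [h]
        exact Summand.rank_eq (y i) q }
  have hz : ∀ i, (grassmannian K m n).map (toAway R (f i)) z = y i := fun i => Summand.ext (hM i)
  refine ⟨z, hz, fun z' hz' => ?_⟩
  have key : ∀ w w' : (grassmannian K m n).obj R,
      (∀ i, (grassmannian K m n).map (toAway R (f i)) w =
        (grassmannian K m n).map (toAway R (f i)) w') →
      Summand.carrier w ≤ Summand.carrier w' := by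
    intro w w' hw x hx
    refine Submodule.mem_of_span_eq_top_of_smul_pow_mem _ (Set.range f) hf x ?_
    rintro ⟨_, i, rfl⟩
    refine exists_pow_smul_mem_of_vmap_mem _ ?_
    have h1 := vmap_mem_grassmannian_map (toAway R (f i)) w hx
    rw [hw i] at h1
    exact h1
  exact Summand.ext (le_antisymm (key _ _ fun i => (hz' i).trans (hz i).symm)
    (key _ _ fun i => (hz i).trans (hz' i).symm))

end grassmannian

section schemes

variable {K : Type u} [Field K]

/-! ### Affine points of schemes -/

/-- The `K`-algebra structure on `S` given by a map `Spec S ⟶ Spec K`. -/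
def algOf {S : CommRingCat.{u}} (p : Spec S ⟶ Spec (CommRingCat.of K)) : CommAlgCat.{u} K :=
  @CommAlgCat.of K _ S _ (Spec.preimage p).hom.toAlgebra

lemma algSpec_algOf_hom {S : CommRingCat.{u}} (p : Spec S ⟶ Spec (CommRingCat.of K)) :
    ((algSpec (CommRingCat.of K)).obj (.op (algOf p))).hom = p :=
  Spec.map_preimage p

lemma points_map_left {X : Sch K} {S T : CommAlgCat.{u} K} (δ : S ⟶ T) (x : (points X).obj S) :
    ((points X).map δ x).left = Spec.map (CommRingCat.ofHom δ.hom.toRingHom) ≫ x.left := rfl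

/-- The point of `X` given by a map `Spec S ⟶ X`. -/
def ptOf {X : Sch K} {S : CommRingCat.{u}} (g : Spec S ⟶ X.left) :
    (points X).obj (algOf (g ≫ X.hom)) :=
  Over.homMk g (algSpec_algOf_hom (g ≫ X.hom)).symm

lemma exists_algHom {A B : CommAlgCat.{u} K} (φ : CommRingCat.of A ⟶ CommRingCat.of B)
    (h : Spec.map φ ≫ Spec.map (CommRingCat.ofHom (algebraMap K A)) =
      Spec.map (CommRingCat.ofHom (algebraMap K B))) :
    ∃ δ : A ⟶ B, δ.hom.toRingHom = φ.hom := by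
  have h2 : CommRingCat.ofHom (algebraMap K A) ≫ φ = CommRingCat.ofHom (algebraMap K B) := by
    apply Spec.map_injective
    rw [Spec.map_comp, h]
  exact ⟨CommAlgCat.ofHom { φ.hom with
    commutes' := fun a => congrArg (fun f : CommRingCat.of K ⟶ CommRingCat.of B => f.hom a) h2 },
    rfl⟩

/-- A `T`-point that factors through `g : Spec S ⟶ X` is a base change of the tautological
`S`-point. The structure map of `X` makes the ring map `K`-linear. -/
lemma exists_map_ptOf {X : Sch K} {S : CommRingCat.{u}} (g : Spec S ⟶ X.left)
    {T : CommAlgCat.{u} K} (x : (points X).obj T) (φ : S ⟶ CommRingCat.of T)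
    (h : Spec.map φ ≫ g = x.left) :
    ∃ δ : algOf (g ≫ X.hom) ⟶ T, (δ.hom.toRingHom : S →+* T) = φ.hom ∧
      (points X).map δ (ptOf g) = x := by
  obtain ⟨δ, hδ⟩ := exists_algHom (A := algOf (g ≫ X.hom)) (B := T) φ (by
    refine (congrArg (Spec.map φ ≫ ·) (algSpec_algOf_hom (g ≫ X.hom))).trans ?_
    exact ((Category.assoc _ _ _).symm.trans (congrArg (· ≫ X.hom) h)).trans (Over.w x))
  refine ⟨δ, hδ, Over.OverMorphism.ext ?_⟩
  rw [points_map_left, hδ]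
  exact h

/-- A ring map out of a `K`-algebra, as a map of `K`-algebras. -/
def algVia {T : CommAlgCat.{u} K} {S : CommRingCat.{u}} (φ : CommRingCat.of T ⟶ S) :
    CommAlgCat.{u} K :=
  @CommAlgCat.of K _ S _ (φ.hom.comp (algebraMap K T)).toAlgebra

lemma exists_toAlgVia {T : CommAlgCat.{u} K} {S : CommRingCat.{u}} (φ : CommRingCat.of T ⟶ S) :
    ∃ δ : T ⟶ algVia φ, (δ.hom.toRingHom : T →+* S) = φ.hom :=
  exists_algHom (A := T) (B := algVia φ) φ (Spec.map_comp _ _).symm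

/-- Each member of an affine cover of `X` is itself a point of `X`, so the values on points
determine the morphism. -/
lemma hom_ext_of_points {X Y : Sch K} {f g : X ⟶ Y} (h : pointsMap f = pointsMap g) : f = g := by
  refine Over.OverMorphism.ext (X.left.affineCover.hom_ext _ _ fun i => ?_)
  have := ConcreteCategory.congr_hom (NatTrans.congr_app h _) (ptOf (X.left.affineCover.f i))
  exact congrArg (fun f => f.left) this

/-- The values of `η` at the tautological points of an affine cover glue: by naturality they agree
on affine pieces of the overlaps. -/
lemma exists_pointsMap_eq {X Y : Sch K} (η : points X ⟶ points Y) :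
    ∃ f : X ⟶ Y, pointsMap f = η := by
  let 𝒰 := X.left.affineCover
  let g : ∀ i, 𝒰.X i ⟶ Y.left := fun i => (η.app _ (ptOf (𝒰.f i))).left
  have key : ∀ (i : 𝒰.I₀) (T : CommAlgCat.{u} K) (x : (points X).obj T)
      (a : Spec (CommRingCat.of T) ⟶ 𝒰.X i) (_ : a ≫ 𝒰.f i = x.left),
      a ≫ g i = (η.app T x).left := by
    intro i T x a ha
    obtain ⟨φ, rfl⟩ : ∃ φ, Spec.map φ = a := ⟨Spec.preimage a, Spec.map_preimage a⟩
    obtain ⟨δ, hδ, hx⟩ := exists_map_ptOf (𝒰.f i) x φ ha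
    have h2 : φ = CommRingCat.ofHom δ.hom.toRingHom := CommRingCat.hom_ext hδ.symm
    rw [← hx, app_map_apply, points_map_left, h2]
    rfl
  have hgw : ∀ i, g i ≫ Y.hom = 𝒰.f i ≫ X.hom := by
    intro i
    exact (Over.w (η.app _ (ptOf (𝒰.f i)))).trans (algSpec_algOf_hom _)
  have hcompat : ∀ i j, Limits.pullback.fst (𝒰.f i) (𝒰.f j) ≫ g i =
      Limits.pullback.snd (𝒰.f i) (𝒰.f j) ≫ g j := by
    intro i j
    refine (Limits.pullback (𝒰.f i) (𝒰.f j)).affineCover.hom_ext _ _ fun l => ?_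
    let c := (Limits.pullback (𝒰.f i) (𝒰.f j)).affineCover.f l
    let x := ptOf (X := X) (c ≫ Limits.pullback.fst (𝒰.f i) (𝒰.f j) ≫ 𝒰.f i)
    have h1 := key i _ x (c ≫ Limits.pullback.fst (𝒰.f i) (𝒰.f j)) (Category.assoc _ _ _)
    have h2 := key j _ x (c ≫ Limits.pullback.snd (𝒰.f i) (𝒰.f j))
      ((Category.assoc _ _ _).trans (congrArg (c ≫ ·) Limits.pullback.condition.symm))
    exact ((Category.assoc _ _ _).symm.trans (h1.trans h2.symm)).trans (Category.assoc _ _ _)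
  let f : X ⟶ Y := Over.homMk (𝒰.glueMorphisms g hcompat) (𝒰.hom_ext _ _ fun i => by
    rw [← Category.assoc, Scheme.Cover.ι_glueMorphisms, hgw])
  refine ⟨f, ?_⟩
  ext T x
  refine Over.OverMorphism.ext ?_
  change x.left ≫ f.left = (η.app T x).left
  -- A point of `X` need not factor through one chart. `Spec T` is therefore covered by affine
  -- schemes that map into charts, and equality is checked on those.
  refine Scheme.Cover.hom_ext (𝒰.pullback₁ x.left) _ _ fun i => ?_
  refine Scheme.Cover.hom_ext ((𝒰.pullback₁ x.left).X i).affineCover _ _ fun l => ?_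
  obtain ⟨φ, hφ⟩ : ∃ φ : CommRingCat.of T ⟶ _, Spec.map φ =
    ((𝒰.pullback₁ x.left).X i).affineCover.f l ≫
    (𝒰.pullback₁ x.left).f i := ⟨Spec.preimage _, Spec.map_preimage _⟩
  obtain ⟨δ, hδ⟩ := exists_toAlgVia φ
  have hφδ : ∀ {Z : Sch K} (z : (points Z).obj T), ((points Z).map δ z).left =
      (((𝒰.pullback₁ x.left).X i).affineCover.f l ≫ (𝒰.pullback₁ x.left).f i) ≫ z.left :=
    fun z => congrArg (· ≫ z.left)
      ((congrArg (fun f => Spec.map (CommRingCat.ofHom f)) hδ).trans hφ)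
  have h1 := key i _ ((points X).map δ x)
    (((𝒰.pullback₁ x.left).X i).affineCover.f l ≫ Limits.pullback.snd _ _) (by
      refine (Category.assoc _ _ _).trans ?_
      refine (congrArg (_ ≫ ·) Limits.pullback.condition.symm).trans ?_
      refine (Category.assoc _ _ _).symm.trans ?_
      exact (hφδ x).symm)
  have h2 : (η.app (algVia φ) ((points X).map δ x)).left = _ :=
    (congrArg (fun y => y.left) (app_map_apply η δ x)).trans (hφδ (η.app T x))
  refine Eq.trans ?_ ((h1.trans h2).trans (Category.assoc _ _ _))
  have h2 : 𝒰.f i ≫ f.left = g i := Scheme.Cover.ι_glueMorphisms 𝒰 g hcompat i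
  rw [← h2]
  refine (Category.assoc _ _ _).symm.trans ?_
  refine (Category.assoc _ _ _).symm.trans ?_
  refine Eq.trans ?_ (Category.assoc _ _ _)
  refine congrArg (· ≫ f.left) ?_
  refine Eq.trans ?_ (Category.assoc _ _ _).symm
  refine (Category.assoc _ _ _).trans ?_
  exact congrArg (_ ≫ ·) Limits.pullback.condition

lemma pointsMap_comp {X Y Z : Sch K} (f : X ⟶ Y) (g : Y ⟶ Z) :
    pointsMap (f ≫ g) = pointsMap f ≫ pointsMap g := by
  ext T x
  exact (Category.assoc _ _ _).symm

lemma pointsMap_id (X : Sch K) : pointsMap (𝟙 X) = 𝟙 _ := by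
  ext T x
  exact Category.comp_id _

lemma exists_iso_of_points {X Y : Sch K} (η : points X ≅ points Y) :
    ∃ e : X ≅ Y, pointsMap e.hom = η.hom := by
  obtain ⟨f, hf⟩ := exists_pointsMap_eq η.hom
  obtain ⟨g, hg⟩ := exists_pointsMap_eq η.inv
  refine ⟨⟨f, g, hom_ext_of_points ?_, hom_ext_of_points ?_⟩, hf⟩
  · rw [pointsMap_comp, hf, hg, pointsMap_id, η.hom_inv_id]
  · rw [pointsMap_comp, hf, hg, pointsMap_id, η.inv_hom_id]

/-! ### Schemes are Zariski sheaves -/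

/-- Morphisms of schemes glue along open covers. Agreement on the fibre products of the basic opens
is checked on affine pieces, which are spectra of `K`-algebras to which the hypothesis applies. -/
lemma isZariskiSheaf_points (X : Sch K) : IsZariskiSheaf (points X) := by
  intro R ι _ f hf y hy
  let 𝒰 := (Scheme.affineOpenCoverOfSpanRangeEqTop (R := CommRingCat.of R) f hf).openCover
  let g : ∀ i, 𝒰.X i ⟶ X.left := fun i => (y i).left
  have hcompat : ∀ i j, Limits.pullback.fst (𝒰.f i) (𝒰.f j) ≫ g i =
      Limits.pullback.snd (𝒰.f i) (𝒰.f j) ≫ g j := by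
    intro i j
    refine (Limits.pullback (𝒰.f i) (𝒰.f j)).affineCover.hom_ext _ _ fun l => ?_
    let c := (Limits.pullback (𝒰.f i) (𝒰.f j)).affineCover.f l
    obtain ⟨φ, hφ⟩ : ∃ φ : CommRingCat.of (away R (f i)) ⟶ _,
      Spec.map φ = c ≫ Limits.pullback.fst (𝒰.f i) (𝒰.f j) :=
      ⟨Spec.preimage _, Spec.map_preimage _⟩
    obtain ⟨ψ, hψ⟩ : ∃ ψ : CommRingCat.of (away R (f j)) ⟶ _,
      Spec.map ψ = c ≫ Limits.pullback.snd (𝒰.f i) (𝒰.f j) :=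
      ⟨Spec.preimage _, Spec.map_preimage _⟩
    have hφψ : Spec.map φ ≫ Spec.map (CommRingCat.ofHom (toAway R (f i)).hom.toRingHom) =
        Spec.map ψ ≫ Spec.map (CommRingCat.ofHom (toAway R (f j)).hom.toRingHom) := by
      rw [hφ, hψ]
      refine (Category.assoc _ _ _).trans (Eq.trans ?_ (Category.assoc _ _ _).symm)
      exact congrArg (c ≫ ·) Limits.pullback.condition
    have hK : ∀ i, Spec.map (CommRingCat.ofHom (toAway R (f i)).hom.toRingHom) ≫
        Spec.map (CommRingCat.ofHom (algebraMap K R)) =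
        Spec.map (CommRingCat.ofHom (algebraMap K (away R (f i)))) := by
      intro i
      rw [← Spec.map_comp]
      refine congrArg Spec.map (CommRingCat.hom_ext ?_)
      exact (toAway R (f i)).hom.comp_algebraMap
    -- The `K`-structure on the affine piece is taken from the `i`-side; the map from the `j`-side
    -- is `K`-linear for it because both restrict to the same map from `R`.
    obtain ⟨a, ha⟩ := exists_toAlgVia φ
    obtain ⟨b, hb⟩ := exists_algHom (A := away R (f j)) (B := algVia φ) ψ (by
      refine ((congrArg (Spec.map ψ ≫ ·) (hK j).symm).trans ?_).trans (Spec.map_comp _ φ).symm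
      refine (Category.assoc _ _ _).symm.trans ?_
      rw [← hφψ, Category.assoc]
      exact congrArg (Spec.map φ ≫ ·) (hK i))
    have hab := hy _ i j a b (by
      apply CommAlgCat.hom_ext
      apply AlgHom.coe_ringHom_injective
      have := congrArg CommRingCat.Hom.hom (Spec.map_injective
        ((Spec.map_comp _ _).trans (hφψ.trans (Spec.map_comp _ _).symm)))
      refine Eq.trans (Eq.trans ?_ this) ?_
      · exact congrArg (fun h => RingHom.comp h _) ha
      · exact congrArg (fun h => RingHom.comp h _) hb.symm)
    have h1 : Spec.map φ ≫ g i = Spec.map ψ ≫ g j := by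
      refine Eq.trans (Eq.trans ?_ (congrArg (fun z => z.left) hab)) ?_
      · exact congrArg (fun h => Spec.map (CommRingCat.ofHom h) ≫ g i) ha.symm
      · exact congrArg (fun h => Spec.map (CommRingCat.ofHom h) ≫ g j) hb
    rw [hφ, hψ] at h1
    exact ((Category.assoc _ _ _).symm.trans h1).trans (Category.assoc _ _ _)
  have hz : 𝒰.glueMorphisms g hcompat ≫ X.hom =
      Spec.map (CommRingCat.ofHom (algebraMap K R)) := by
    refine 𝒰.hom_ext _ _ fun i => ?_
    rw [← Category.assoc, Scheme.Cover.ι_glueMorphisms]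
    exact (Over.w (y i)).trans (Over.w ((algSpec (CommRingCat.of K)).map (toAway R (f i)).op)).symm
  refine ⟨Over.homMk (𝒰.glueMorphisms g hcompat) hz, fun i => Over.OverMorphism.ext ?_, ?_⟩
  · exact Scheme.Cover.ι_glueMorphisms 𝒰 g hcompat i
  · intro z hz
    have h1 : (z.left : Spec (CommRingCat.of R) ⟶ X.left) = 𝒰.glueMorphisms g hcompat := by
      refine Scheme.Cover.hom_ext 𝒰 _ _ fun i => ?_
      refine Eq.trans ?_ (Scheme.Cover.ι_glueMorphisms 𝒰 g hcompat i).symm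
      exact congrArg (fun z => z.left) (hz i)
    exact Over.OverMorphism.ext h1

lemma exists_away_lift {X U : Scheme.{u}} (j : U ⟶ X) [IsOpenImmersion j] {R : CommAlgCat.{u} K}
    (x : Spec (CommRingCat.of R) ⟶ X) (p : PrimeSpectrum R) (hp : x p ∈ Set.range j) :
    ∃ f : R, f ∉ p.asIdeal ∧ ∃ a : Spec (CommRingCat.of (away R f)) ⟶ U,
      a ≫ j = Spec.map (CommRingCat.ofHom (toAway R f).hom.toRingHom) ≫ x := by
  have hopen : IsOpen (x ⁻¹' Set.range j) := j.isOpenEmbedding.isOpen_range.preimage x.continuous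
  obtain ⟨_, ⟨f, rfl⟩, hpf, hf⟩ :=
    PrimeSpectrum.isTopologicalBasis_basic_opens.exists_subset_of_mem_open hp hopen
  refine ⟨f, hpf, IsOpenImmersion.lift j _ ?_, IsOpenImmersion.lift_fac _ _ _⟩
  rintro _ ⟨q, rfl⟩
  exact hf ((PrimeSpectrum.localization_away_comap_range (Localization.Away f) f).le ⟨q, rfl⟩)

lemma exists_away_lift_of_cover {X : Scheme.{u}} (𝒰 : X.AffineOpenCover) {R : CommAlgCat.{u} K}
    (x : Spec (CommRingCat.of R) ⟶ X) (p : PrimeSpectrum R) :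
    ∃ f : R, f ∉ p.asIdeal ∧ ∃ i, ∃ φ : 𝒰.X i ⟶ CommRingCat.of (away R f),
      Spec.map φ ≫ 𝒰.f i = Spec.map (CommRingCat.ofHom (toAway R f).hom.toRingHom) ≫ x := by
  obtain ⟨f, hf, a, ha⟩ := exists_away_lift (𝒰.f (𝒰.idx (x p))) x p (𝒰.covers (x p))
  exact ⟨f, hf, _, Spec.preimage a, by rw [Spec.map_preimage, ha]⟩

/-! ### Closed subfunctors of schemes -/

/-- The ideal sheaf cutting out a closed subfunctor. -/
theorem exists_idealSheafData {X : Sch K} {F : Subfunctor (points X)} (hF : IsClosedSubfunctor F) :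
    ∃ I : X.left.IdealSheafData, ∀ (U : X.left.affineOpens) (T : CommAlgCat.{u} K)
      (x : (points X).obj T) (φ : Γ(X.left, U) ⟶ CommRingCat.of T),
      Spec.map φ ≫ U.2.fromSpec = x.left →
        (x ∈ F.obj T ↔ I.ideal U ≤ RingHom.ker φ.hom) := by
  have hex : ∀ U : X.left.affineOpens, ∃ J : Ideal Γ(X.left, U), ∀ (T : CommAlgCat.{u} K)
      (x : (points X).obj T) (φ : Γ(X.left, U) ⟶ CommRingCat.of T),
      Spec.map φ ≫ U.2.fromSpec = x.left → (x ∈ F.obj T ↔ J ≤ RingHom.ker φ.hom) := by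
    intro U
    obtain ⟨J, hJ⟩ := hF _ (ptOf (X := X) U.2.fromSpec)
    refine ⟨J, fun T x φ h => ?_⟩
    obtain ⟨δ, hδ, rfl⟩ := exists_map_ptOf _ x φ h
    rw [hJ, hδ]
    exact Iff.rfl
  choose J hJ' using hex
  refine ⟨⟨J, fun U f => ?_, _, rfl⟩, hJ'⟩
  have hfac := U.2.map_fromSpec (X.left.affineBasicOpen f).2
    (homOfLE (X.left.basicOpen_le f)).op
  -- An ideal is determined by the ring maps that kill it. Both ideals decide whether the same point
  -- lies in `F`, so they are killed by the same maps out of the sections over the basic open;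
  -- quotient maps then give the two inclusions.
  have key : ∀ (T : CommRingCat.{u}) (φ : Γ(X.left, X.left.affineBasicOpen f) ⟶ T),
      J U ≤ RingHom.ker (X.left.presheaf.map (homOfLE (X.left.basicOpen_le f)).op ≫ φ).hom ↔
        J (X.left.affineBasicOpen f) ≤ RingHom.ker φ.hom := by
    intro T φ
    have h1 := hJ' U _ (ptOf (Spec.map φ ≫ (X.left.affineBasicOpen f).2.fromSpec))
      (X.left.presheaf.map (homOfLE (X.left.basicOpen_le f)).op ≫ φ) (by
        refine (congrArg (· ≫ U.2.fromSpec) (Spec.map_comp _ _)).trans ?_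
        exact (Category.assoc _ _ _).trans (congrArg (Spec.map φ ≫ ·) hfac))
    have h2 := hJ' (X.left.affineBasicOpen f) _
      (ptOf (Spec.map φ ≫ (X.left.affineBasicOpen f).2.fromSpec)) φ rfl
    exact h1.symm.trans h2
  apply le_antisymm
  · let J' : Ideal Γ(X.left, X.left.basicOpen f) := J (X.left.affineBasicOpen f)
    have h1 := (key _ (CommRingCat.ofHom (Ideal.Quotient.mk J'))).2 (Ideal.mk_ker (I := J')).ge
    exact Ideal.map_le_iff_le_comap.2 fun r hr => (Ideal.mk_ker (I := J')).le (h1 hr)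
  · have := (key _ (CommRingCat.ofHom (Ideal.Quotient.mk ((J U).map
      (X.left.presheaf.map (homOfLE (X.left.basicOpen_le f)).op).hom)))).1 (fun r hr =>
        Ideal.Quotient.eq_zero_iff_mem.2 (Ideal.mem_map_of_mem _ hr))
    intro r hr
    exact Ideal.Quotient.eq_zero_iff_mem.1 (this hr)

/-- Membership is the vanishing of an ideal of `R`, a local condition. -/
lemma IsClosedSubfunctor.mem_of_locally {F : CommAlgCat.{u} K ⥤ Type u} {G : Subfunctor F}
    (hG : IsClosedSubfunctor G) {R : CommAlgCat.{u} K} {x : F.obj R}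
    (h : ∀ p : PrimeSpectrum R, ∃ f : R, f ∉ p.asIdeal ∧ F.map (toAway R f) x ∈ G.obj _) :
    x ∈ G.obj R := by
  obtain ⟨I, hI⟩ := hG R x
  have h1 := hI R (𝟙 R)
  have h2 : F.map (𝟙 R) x = x := by rw [F.map_id]; rfl
  rw [h2] at h1
  refine h1.2 fun r hr => eq_zero_of_locally fun p => ?_
  obtain ⟨f, hf, hx⟩ := h p
  exact ⟨f, hf, (hI _ _).1 hx hr⟩

lemma pointsMap_app_injective {X Y : Sch K} (i : X ⟶ Y) [Mono i.left] (R : CommAlgCat.{u} K) :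
    Function.Injective ((pointsMap i).app R) := by
  intro x y hxy
  exact Over.OverMorphism.ext ((cancel_mono i.left).1 (congrArg (fun z => z.left) hxy))

/-- The scheme is the one cut out by the ideal sheaf. A point of it locally factors through some
`Spec (Γ(U) ⧸ I(U))`, hence lies in `F`. A point of `F` locally lies in an affine open `U` and kills
`I(U)`, hence lifts; lifts are unique because a closed immersion is a monomorphism, so they glue. -/
theorem exists_closed_subscheme {X : Sch K} {F : Subfunctor (points X)}
    (hF : IsClosedSubfunctor F) : ∃ (Z : Sch K) (i : Z ⟶ X), IsClosedImmersion i.left ∧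
      ∀ R, Set.range ((pointsMap i).app R) = F.obj R := by
  obtain ⟨I, hI⟩ := exists_idealSheafData hF
  let i : Over.mk (I.subschemeι ≫ X.hom) ⟶ X := Over.homMk I.subschemeι rfl
  have hi : IsClosedImmersion i.left := inferInstanceAs (IsClosedImmersion I.subschemeι)
  have hcov : ∀ U, I.subschemeCover.f U ≫ I.subschemeι =
      Spec.map (CommRingCat.ofHom (Ideal.Quotient.mk (I.ideal U))) ≫ U.2.fromSpec :=
    fun U => (I.subschemeCover_map_subschemeι U).trans (I.glueDataObjι_ι U)
  refine ⟨_, i, hi, fun R => Set.Subset.antisymm ?_ fun x hx => ?_⟩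
  · rintro _ ⟨z, rfl⟩
    refine hF.mem_of_locally fun p => ?_
    obtain ⟨f, hf, U, φ, hφ⟩ := exists_away_lift_of_cover I.subschemeCover
      (z.left : Spec (CommRingCat.of R) ⟶ I.subscheme) p
    refine ⟨f, hf, (hI U _ _ (CommRingCat.ofHom (Ideal.Quotient.mk (I.ideal U)) ≫ φ) ?_).2 ?_⟩
    · refine (congrArg (· ≫ _) (Spec.map_comp _ φ)).trans ?_
      refine (Category.assoc _ _ _).trans ?_
      refine (congrArg (Spec.map φ ≫ ·) (hcov U).symm).trans ?_
      refine (Category.assoc _ _ _).symm.trans ?_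
      exact (congrArg (· ≫ I.subschemeι) hφ).trans (Category.assoc _ _ _)
    · intro r hr
      have : Ideal.Quotient.mk (I.ideal U) r = 0 := Ideal.Quotient.eq_zero_iff_mem.2 hr
      exact (congrArg φ.hom this).trans (map_zero _)
  · refine mem_range_of_locally (pointsMap i) (isZariskiSheaf_points _) (isZariskiSheaf_points _)
      (pointsMap_app_injective i) x fun p => ?_
    let x' : Spec (CommRingCat.of R) ⟶ X.left := x.left
    obtain ⟨U, hU⟩ := TopologicalSpace.Opens.mem_iSup.1
      ((iSup_affineOpens_eq_top X.left).ge (TopologicalSpace.Opens.mem_top (x' p)))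
    have : IsOpenImmersion U.2.fromSpec := U.2.isOpenImmersion_fromSpec
    obtain ⟨f, hf, a, ha⟩ := exists_away_lift U.2.fromSpec x' p (by
      rw [U.2.range_fromSpec]; exact hU)
    obtain ⟨φ, rfl⟩ : ∃ φ, Spec.map φ = a := ⟨Spec.preimage a, Spec.map_preimage a⟩
    have hφ := (hI U _ ((points X).map (toAway R f) x) φ ha).1 (F.map _ hx)
    let ψ : CommRingCat.of (Γ(X.left, U) ⧸ I.ideal U) ⟶ CommRingCat.of (away R f) :=
      CommRingCat.ofHom (Ideal.Quotient.lift (I.ideal U) φ.hom hφ)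
    have hψ : CommRingCat.ofHom (Ideal.Quotient.mk (I.ideal U)) ≫ ψ = φ := by
      ext r; rfl
    have hfac : (Spec.map ψ ≫ I.subschemeCover.f U) ≫ I.subschemeι =
        ((points X).map (toAway R f) x).left := by
      refine (Category.assoc _ _ _).trans ((congrArg (Spec.map ψ ≫ ·) (hcov U)).trans ?_)
      refine (Category.assoc _ _ _).symm.trans ?_
      refine (congrArg (· ≫ U.2.fromSpec) ((Spec.map_comp _ ψ).symm.trans
        (congrArg Spec.map hψ))).trans ha
    refine ⟨f, hf, Over.homMk (Spec.map ψ ≫ I.subschemeCover.f U) ?_, Over.OverMorphism.ext hfac⟩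
    exact ((Category.assoc _ _ _).symm.trans (congrArg (· ≫ X.hom) hfac)).trans (Over.w _)

lemma exists_hom_of_range_le {F G H : CommAlgCat.{u} K ⥤ Type u} (φ : F ⟶ H) (ψ : G ⟶ H)
    (hψ : ∀ R, Function.Injective (ψ.app R))
    (h : ∀ R, Set.range (φ.app R) ⊆ Set.range (ψ.app R)) : ∃ η : F ⟶ G, η ≫ ψ = φ := by
  choose g hg using fun (R : CommAlgCat.{u} K) (x : F.obj R) => h R ⟨x, rfl⟩
  refine ⟨⟨fun R => ↾(g R), fun R T δ => ?_⟩, ?_⟩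
  · ext x
    apply hψ
    change ψ.app T (g T (F.map δ x)) = ψ.app T (G.map δ (g R x))
    rw [app_map_apply ψ, hg, hg, app_map_apply φ]
  · ext R x
    exact hg R x

lemma exists_iso_of_range_eq {F G H : CommAlgCat.{u} K ⥤ Type u} (φ : F ⟶ H) (ψ : G ⟶ H)
    (hφ : ∀ R, Function.Injective (φ.app R)) (hψ : ∀ R, Function.Injective (ψ.app R))
    (h : ∀ R, Set.range (φ.app R) = Set.range (ψ.app R)) : ∃ η : F ≅ G, η.hom ≫ ψ = φ := by
  obtain ⟨η, hη⟩ := exists_hom_of_range_le φ ψ hψ fun R => (h R).le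
  obtain ⟨θ, hθ⟩ := exists_hom_of_range_le ψ φ hφ fun R => (h R).ge
  have h1 := fun R x => ConcreteCategory.congr_hom (NatTrans.congr_app hη R) x
  have h2 := fun R x => ConcreteCategory.congr_hom (NatTrans.congr_app hθ R) x
  refine ⟨⟨η, θ, ?_, ?_⟩, hη⟩
  · ext R x
    exact hφ R ((h2 R _).trans (h1 R x))
  · ext R x
    exact hψ R ((h1 R _).trans (h2 R x))

/-- A morphism of `K`-schemes which is injective on points, with image a closed subfunctor, is a
closed immersion. -/
theorem isClosedImmersion_of_isClosedSubfunctor {X Y : Sch K} (f : X ⟶ Y)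
    (hinj : ∀ R, Function.Injective ((pointsMap f).app R))
    (hf : IsClosedSubfunctor (Subfunctor.range (pointsMap f))) : IsClosedImmersion f.left := by
  -- The closed subscheme given by the image has the same points over `Y` as `X`, so the two are
  -- isomorphic over `Y`.
  obtain ⟨Z, i, hi, hZ⟩ := exists_closed_subscheme hf
  obtain ⟨e, he⟩ : ∃ e : X ≅ Z, e.hom ≫ i = f := by
    obtain ⟨η, hη⟩ := exists_iso_of_range_eq (pointsMap f) (pointsMap i) hinj
      (pointsMap_app_injective i) fun R => (hZ R).symm
    obtain ⟨e, he⟩ := exists_iso_of_points η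
    refine ⟨e, hom_ext_of_points ?_⟩
    rw [pointsMap_comp, he, hη]
  have h1 : IsIso e.hom.left := inferInstanceAs (IsIso ((Over.forget _).map e.hom))
  rw [← he]
  exact inferInstanceAs (IsClosedImmersion (e.hom.left ≫ i.left))

end schemes

/-! ### Charts of the projectivization -/

section rankOne

variable {R M : Type*} [CommRing R] [AddCommGroup M] [Module R M]

/-- At `p` the module is free of rank one. The coordinates of the generators `e i` cannot all lie in
the maximal ideal, so some `e i` generates the stalk. Finitely many denominators are then multiplied
to give `f`. -/
lemma exists_smul_mem_span_singleton [Module.Finite R M] [Module.Projective R M]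
    (hM : ∀ p, Module.rankAtStalk (R := R) M p = 1) {σ : Type*} (e : σ → M)
    (he : Submodule.span R (Set.range e) = ⊤) (p : PrimeSpectrum R) :
    ∃ i, ∃ f ∉ p.asIdeal, ∀ x : M, f • x ∈ Submodule.span R {e i} := by
  let Rp := Localization.AtPrime p.asIdeal
  let Mp := LocalizedModule p.asIdeal.primeCompl M
  let g : M →ₗ[R] Mp := LocalizedModule.mkLinearMap p.asIdeal.primeCompl M
  have : Module.Finite Rp Mp := Module.Finite.of_isLocalizedModule p.asIdeal.primeCompl g
  have : Module.Projective Rp Mp :=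
    Module.projective_of_isLocalizedModule p.asIdeal.primeCompl g
  have : Module.Free Rp Mp := Module.free_of_flat_of_isLocalRing
  have hrank : Module.finrank Rp Mp = 1 := hM p
  let b : Module.Basis (Fin 1) Rp Mp := Module.finBasisOfFinrankEq Rp Mp hrank
  let ℓ : Mp →ₗ[Rp] Rp := b.coord 0
  have hb : ∀ x, ℓ x • b 0 = x := fun x => by
    exact (Fin.sum_univ_one _).symm.trans (b.sum_repr x)
  have hunit : ∃ i, IsUnit (ℓ (g (e i))) := by
    by_contra! hno
    have hle : ∀ x : M, ℓ (g x) ∈ IsLocalRing.maximalIdeal Rp := by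
      intro x
      have hx : x ∈ Submodule.span R (Set.range e) := by rw [he]; trivial
      induction hx using Submodule.span_induction with
      | mem x h =>
        obtain ⟨i, rfl⟩ := h
        exact (IsLocalRing.mem_maximalIdeal _).2 (hno i)
      | zero => simp
      | add x y _ _ hx hy => rw [map_add, map_add]; exact Ideal.add_mem _ hx hy
      | smul a x _ hx =>
        rw [map_smul, ← algebraMap_smul Rp a (g x), map_smul, smul_eq_mul]
        exact Ideal.mul_mem_left _ _ hx
    obtain ⟨⟨x, s⟩, hs⟩ := IsLocalizedModule.surj p.asIdeal.primeCompl g (b 0)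
    have h1 : ℓ (g x) = algebraMap R Rp s := by
      rw [← hs]
      change ℓ ((s : R) • b 0) = _
      rw [← algebraMap_smul Rp (s : R) (b 0), map_smul]
      simp [ℓ]
    have h2 := hle x
    rw [h1] at h2
    exact (IsLocalRing.mem_maximalIdeal _).1 h2 (IsLocalization.map_units Rp s)
  obtain ⟨i, hi⟩ := hunit
  obtain ⟨u, hu⟩ := hi
  have key : ∀ x : M, ∃ f ∉ p.asIdeal, f • x ∈ Submodule.span R {e i} := by
    intro x
    have h1 : g x = (ℓ (g x) * ↑u⁻¹) • g (e i) := by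
      conv_rhs => rw [← hb (g (e i)), ← hu]
      rw [smul_smul, mul_assoc, Units.inv_mul, mul_one, hb]
    obtain ⟨⟨r, s⟩, hs⟩ := IsLocalization.surj p.asIdeal.primeCompl (ℓ (g x) * ↑u⁻¹)
    have h2 : g ((s : R) • x) = g (r • e i) := by
      rw [map_smul, map_smul, h1, ← algebraMap_smul Rp (s : R), smul_smul,
        mul_comm (algebraMap R Rp s), hs, algebraMap_smul]
    obtain ⟨c, hc⟩ := (IsLocalizedModule.eq_iff_exists p.asIdeal.primeCompl g).1 h2
    refine ⟨c * s, (c * s).2, ?_⟩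
    rw [mul_smul]
    refine Submodule.mem_span_singleton.2 ⟨c * r, ?_⟩
    rw [mul_smul]
    exact hc.symm
  obtain ⟨T, hT⟩ := Module.Finite.fg_top (R := R) (M := M)
  choose f hf hfx using key
  refine ⟨i, ∏ t ∈ T, f t, ?_, fun x => ?_⟩
  · rw [Ideal.IsPrime.prod_mem_iff]
    push Not
    exact fun t _ => hf t
  · have hx : x ∈ Submodule.span R (T : Set M) := by rw [hT]; trivial
    induction hx using Submodule.span_induction with
    | mem x h =>
      obtain ⟨c, hc⟩ := Finset.dvd_prod_of_mem f h
      rw [hc, mul_comm, mul_smul]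
      exact Submodule.smul_mem _ _ (hfx x)
    | zero => simp
    | add x y _ _ hx hy => rw [smul_add]; exact Submodule.add_mem _ hx hy
    | smul a x _ hx => rw [smul_comm]; exact Submodule.smul_mem _ _ hx

/-- The point of the projectivization given by the kernel of a surjective linear form. -/
def kerPoint (φ : M →ₗ[R] R) (h : Function.Surjective φ) : Module.Grassmannian R M 1 where
  toSubmodule := LinearMap.ker φ
  finite_quotient := Module.Finite.equiv (φ.quotKerEquivOfSurjective h).symm
  projective_quotient := Module.Projective.of_equiv (φ.quotKerEquivOfSurjective h).symm
  rankAtStalk_eq p := by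
    have := p.nontrivial
    rw [Module.rankAtStalk_eq_of_equiv (φ.quotKerEquivOfSurjective h),
      Module.rankAtStalk_eq_finrank_of_free]
    simp

/-- The class of `e` generates the quotient. The resulting surjection from `R` is one of projective
modules of rank one, hence an isomorphism, and its inverse supplies `φ`. -/
lemma exists_eq_ker (H : Module.Grassmannian R M 1) (e : M)
    (he : ∀ x, ∃ r : R, x - r • e ∈ H.toSubmodule) :
    ∃ φ : M →ₗ[R] R, φ e = 1 ∧ H.toSubmodule = LinearMap.ker φ := by
  let ψ : R →ₗ[R] M ⧸ H.toSubmodule := LinearMap.toSpanSingleton R _ (H.toSubmodule.mkQ e)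
  have hψ : Function.Surjective ψ := by
    intro y
    obtain ⟨x, rfl⟩ := H.toSubmodule.mkQ_surjective y
    obtain ⟨r, hr⟩ := he x
    refine ⟨r, ?_⟩
    have h1 : H.toSubmodule.mkQ (x - r • e) = 0 := (Submodule.Quotient.mk_eq_zero _).2 hr
    rw [map_sub, sub_eq_zero, map_smul] at h1
    exact h1.symm
  have hb : Function.Bijective ψ :=
    Module.bijective_of_surjective_of_rankAtStalk_eq hψ fun m hm => by
      have : Nontrivial R := ⟨⟨0, 1, fun h => hm.ne_top ((Ideal.eq_top_iff_one m).2 (h ▸ m.zero_mem))⟩⟩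
      rw [H.rankAtStalk_eq, Module.rankAtStalk_eq_finrank_of_free]
      simp
  let E := LinearEquiv.ofBijective ψ hb
  refine ⟨E.symm.toLinearMap ∘ₗ H.toSubmodule.mkQ, ?_, ?_⟩
  · rw [LinearMap.comp_apply, LinearEquiv.coe_coe, LinearEquiv.symm_apply_eq]
    exact (one_smul R _).symm
  · rw [LinearEquiv.ker_comp, Submodule.ker_mkQ]

end rankOne

section charts

variable {K : Type u} [Field K] {V : Type u} [AddCommGroup V] [Module K V] {σ : Type}
  (b : Module.Basis σ K V)

/-- The linear form on `R ⊗ V` with the given values on a basis of `V`. -/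
def evalAt (R : Type*) [CommRing R] [Algebra K R] (a : σ → R) : R ⊗[K] V →ₗ[R] R :=
  (b.baseChange R).constr R a

lemma evalAt_basis (R : Type*) [CommRing R] [Algebra K R] (a : σ → R) (i : σ) :
    evalAt b R a (1 ⊗ₜ b i) = a i := by
  rw [evalAt, ← Module.Basis.baseChange_apply, Module.Basis.constr_basis]

lemma tensor_induction_basis {R : Type*} [CommRing R] [Algebra K R] {P : R ⊗[K] V → Prop}
    (h0 : P 0) (hadd : ∀ x y, P x → P y → P (x + y))
    (hb : ∀ (r : R) (i : σ), P (r • (1 ⊗ₜ b i))) (x : R ⊗[K] V) : P x := by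
  have hx : x ∈ Submodule.span R (Set.range (b.baseChange R)) := by
    rw [Module.Basis.span_eq]; trivial
  rw [← Set.image_univ] at hx
  obtain ⟨c, -, rfl⟩ := (Finsupp.mem_span_image_iff_linearCombination R).1 hx
  rw [Finsupp.linearCombination_apply, Finsupp.sum]
  refine Finset.sum_induction _ P hadd h0 fun i _ => ?_
  rw [Module.Basis.baseChange_apply]
  exact hb _ _

lemma evalAt_tmap {R T : CommAlgCat.{u} K} (ε : R ⟶ T) (a : σ → R) (x : R ⊗[K] V) :
    evalAt b T (fun i => ε.hom (a i)) (tmap V ε x) = ε.hom (evalAt b R a x) := by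
  induction x using tensor_induction_basis b with
  | h0 => simp
  | hadd x y hx hy => simp only [map_add, hx, hy]
  | hb r i =>
    rw [tmap_smul, map_smul, map_smul, smul_eq_mul, smul_eq_mul, map_mul, evalAt_basis]
    congr 1
    have : tmap V ε ((1 : R) ⊗ₜ b i) = (1 : T) ⊗ₜ b i := by simp
    rw [this, evalAt_basis]

lemma evalAt_surjective {R : Type*} [CommRing R] [Algebra K R] (a : σ → R) {i : σ} (h : a i = 1) :
    Function.Surjective (evalAt b R a) := fun r =>
  ⟨r • (1 ⊗ₜ b i), by rw [map_smul, evalAt_basis, h, smul_eq_mul, mul_one]⟩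

variable (K σ) in
/-- The functor of points of the disjoint union of the standard charts of projective space. -/
def charts : CommAlgCat.{u} K ⥤ Type u where
  obj R := {c : ULift.{u} σ × (σ → R) // c.2 c.1.down = 1}
  map δ := ↾(fun c => ⟨(c.1.1, fun i => δ.hom (c.1.2 i)), by simp [c.2]⟩)
  map_id _ := rfl
  map_comp _ _ := rfl

/-- The atlas of the projectivization given by a basis. -/
def chartMap : charts K σ ⟶ projectivization (K := K) V where
  app R := ↾(fun c => kerPoint (evalAt b R c.1.2) (evalAt_surjective b _ c.2))
  naturality R T δ := by
    ext c
    refine Eq.symm (Grassmannian.eq_of_le ?_)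
    refine (projectivization_map V δ _).trans_le ?_
    refine Submodule.span_le.2 ?_
    rintro _ ⟨x, hx, rfl⟩
    change evalAt b T (fun i => δ.hom (c.1.2 i)) (tmap V δ x) = 0
    rw [evalAt_tmap, show evalAt b R c.1.2 x = 0 from hx, map_zero]

/-- Normalised linear forms with the same kernel are proportional, and the factor is read off at the
coordinate where the second form equals `1`. This is the usual change of charts of projective space.
-/
lemma chartMap_eq_iff {R : CommAlgCat.{u} K} (c c' : (charts K σ).obj R) :
    (chartMap b).app R c = (chartMap b).app R c' ↔ ∀ k, c.1.2 k = c.1.2 c'.1.1.down * c'.1.2 k := by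
  obtain ⟨⟨⟨i⟩, a⟩, ha⟩ := c
  obtain ⟨⟨⟨j⟩, a'⟩, ha'⟩ := c'
  dsimp only at ha ha' ⊢
  constructor
  · intro h k
    have h1 : LinearMap.ker (evalAt b R a) = LinearMap.ker (evalAt b R a') :=
      congrArg (fun H : Module.Grassmannian R (R ⊗[K] V) 1 => H.toSubmodule) h
    have h2 : (1 : R) ⊗ₜ[K] b k - a' k • ((1 : R) ⊗ₜ[K] b j) ∈ LinearMap.ker (evalAt b R a') := by
      rw [LinearMap.mem_ker, map_sub, map_smul, evalAt_basis, evalAt_basis, ha', smul_eq_mul,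
        mul_one, sub_self]
    rw [← h1, LinearMap.mem_ker, map_sub, map_smul, evalAt_basis, evalAt_basis, smul_eq_mul,
      sub_eq_zero] at h2
    rw [h2, mul_comm]
  · intro h
    refine Eq.symm (Grassmannian.eq_of_le ?_)
    change LinearMap.ker (evalAt b R a') ≤ LinearMap.ker (evalAt b R a)
    have h1 : evalAt b R a = a j • evalAt b R a' := by
      refine (b.baseChange R).ext fun k => ?_
      rw [Module.Basis.baseChange_apply, LinearMap.smul_apply, evalAt_basis, evalAt_basis, h k,
        smul_eq_mul]
    intro x hx
    rw [h1, LinearMap.mem_ker, LinearMap.smul_apply, show evalAt b R a' x = 0 from hx, smul_zero]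

/-- Near any prime one basis vector generates the rank-one quotient. The quotient is then free with
that vector as its generator, which is a point of a standard chart. -/
lemma isLocallySurj_chartMap [Finite σ] : IsLocallySurj (chartMap b) := by
  intro R y p
  let H := Module.Grassmannian.toSubmodule y
  have hspan : Submodule.span R (Set.range fun i => H.mkQ (1 ⊗ₜ b i)) = ⊤ := by
    rw [← top_le_iff, ← H.range_mkQ, LinearMap.range_eq_map, ← (b.baseChange R).span_eq,
      Submodule.map_span, ← Set.range_comp]
    refine le_of_eq (congrArg _ (congrArg _ (funext fun i => ?_)))
    exact congrArg _ (b.baseChange_apply R i)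
  have := Module.Grassmannian.finite_quotient y
  have := Module.Grassmannian.projective_quotient y
  obtain ⟨i, f, hf, hi⟩ := exists_smul_mem_span_singleton
    (Module.Grassmannian.rankAtStalk_eq y) _ hspan p
  refine ⟨f, hf, ?_⟩
  let y' := (projectivization (K := K) V).map (toAway R f) y
  have hy' : ∀ x : (away R f) ⊗[K] V, ∃ r : away R f,
      x - r • (1 ⊗ₜ b i) ∈ Module.Grassmannian.toSubmodule y' := by
    intro x
    induction x using tensor_induction_basis (R := away R f) b with
    | h0 => exact ⟨0, by simp⟩
    | hadd x x' hx hx' =>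
      obtain ⟨r, hr⟩ := hx
      obtain ⟨r', hr'⟩ := hx'
      refine ⟨r + r', ?_⟩
      have := Submodule.add_mem _ hr hr'
      rwa [show x - r • (1 ⊗ₜ[K] b i) + (x' - r' • (1 ⊗ₜ[K] b i)) =
        x + x' - (r + r') • (1 ⊗ₜ[K] b i) by rw [add_smul]; abel] at this
    | hb s k =>
      obtain ⟨r, hr⟩ := Submodule.mem_span_singleton.1 (hi (H.mkQ (1 ⊗ₜ b k)))
      have h1 : f • ((1 : R) ⊗ₜ[K] b k) - r • ((1 : R) ⊗ₜ[K] b i) ∈ H := by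
        rw [← map_smul, ← map_smul, ← sub_eq_zero, ← map_sub] at hr
        rw [← neg_sub]
        exact H.neg_mem ((Submodule.Quotient.mk_eq_zero _).1 hr)
      have h2 := tmap_mem_projectivization_map V (toAway R f) y h1
      rw [map_sub, tmap_smul, tmap_smul] at h2
      have h3 : ∀ k, tmap V (toAway R f) ((1 : R) ⊗ₜ b k) = (1 : away R f) ⊗ₜ b k := by simp
      rw [h3, h3] at h2
      obtain ⟨w, hw⟩ := isUnit_toAway R f
      refine ⟨s * (↑w⁻¹ * (toAway R f).hom r), ?_⟩
      have h4 := Submodule.smul_mem _ (s * ↑w⁻¹) h2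
      rwa [smul_sub, smul_smul, ← hw, mul_assoc, Units.inv_mul, mul_one, smul_smul, mul_assoc] at h4
  obtain ⟨φ, hφ, hker⟩ := exists_eq_ker y' _ hy'
  refine ⟨⟨(⟨i⟩, fun k => φ (1 ⊗ₜ b k)), hφ⟩, Module.Grassmannian.ext ?_⟩
  have h5 : evalAt b (away R f) (fun k => φ (1 ⊗ₜ b k)) = φ := by
    refine (b.baseChange _).ext fun k => ?_
    rw [Module.Basis.baseChange_apply, evalAt_basis]
  refine Eq.trans ?_ hker.symm
  exact congrArg LinearMap.ker h5

end charts

/-! ### Points of projective space -/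

section proj

attribute [local instance] MvPolynomial.gradedAlgebra

open HomogeneousLocalization MvPolynomial

variable {K : Type u} [Field K] {σ : Type}

lemma X_mem (i : σ) : (X i : MvPolynomial σ K) ∈ homogeneousSubmodule σ K 1 :=
  isHomogeneous_X K i

section evaluation

variable {R : Type*} [CommRing R] [Algebra K R]

/-- Evaluation of homogeneous fractions with denominator a power of `f` at a point where `f` is
invertible. -/
def awayEval (a : σ → R) (f : MvPolynomial σ K) (hf : IsUnit (aeval a f)) :
    Away (homogeneousSubmodule σ K) f →+* R :=
  (Localization.awayLift (aeval a : MvPolynomial σ K →ₐ[K] R).toRingHom f hf).comp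
    (algebraMap (Away (homogeneousSubmodule σ K) f) (Localization.Away f))

lemma awayEval_mk_mul (a : σ → R) (f : MvPolynomial σ K) (hf : IsUnit (aeval a f)) {d : ℕ}
    (hd : f ∈ homogeneousSubmodule σ K d) (n : ℕ) (x : MvPolynomial σ K)
    (hx : x ∈ homogeneousSubmodule σ K (n • d)) :
    awayEval a f hf (Away.mk _ hd n x hx) * aeval a f ^ n = aeval a x := by
  obtain ⟨v, hv⟩ := isUnit_iff_exists_inv.1 hf
  have h1 : awayEval a f hf (Away.mk _ hd n x hx) = aeval a x * v ^ n :=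
    Localization.awayLift_mk (aeval a : MvPolynomial σ K →ₐ[K] R).toRingHom f x v hv n
  rw [h1, mul_assoc, ← mul_pow, mul_comm v, hv, one_pow, mul_one]

lemma awayEval_eq_iff (a : σ → R) (f : MvPolynomial σ K) (hf : IsUnit (aeval a f)) {d : ℕ}
    (hd : f ∈ homogeneousSubmodule σ K d) (φ : Away (homogeneousSubmodule σ K) f →+* R)
    (h : ∀ (n : ℕ) (x : MvPolynomial σ K) (hx : x ∈ homogeneousSubmodule σ K (n • d)),
      φ (Away.mk _ hd n x hx) * aeval a f ^ n = aeval a x) :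
    φ = awayEval a f hf := by
  ext z
  obtain ⟨n, x, hx, rfl⟩ := Away.mk_surjective _ hd z
  refine (hf.pow n).mul_right_cancel ?_
  rw [h, awayEval_mk_mul]

/-- The fraction `X_k / X_i`. -/
def ratio (i k : σ) : Away (homogeneousSubmodule σ K) (X i : MvPolynomial σ K) :=
  Away.mk _ (X_mem i) 1 (X k) (by rw [one_smul]; exact X_mem k)

/-- Constants as homogeneous fractions. -/
def awayC (f : MvPolynomial σ K) : K →+* Away (homogeneousSubmodule σ K) f :=
  (fromZeroRingHom _ _).comp (algebraMap K (homogeneousSubmodule σ K 0))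

lemma val_awayC (f : MvPolynomial σ K) (c : K) :
    (awayC f c).val = algebraMap (MvPolynomial σ K) (Localization.Away f) (C c : MvPolynomial σ K) := rfl

lemma val_ratio_mul (i k : σ) : (ratio (K := K) i k).val *
    algebraMap (MvPolynomial σ K) (Localization.Away (X i : MvPolynomial σ K)) (X i) =
      algebraMap (MvPolynomial σ K) (Localization.Away (X i : MvPolynomial σ K)) (X k) := by
  have h : (ratio (K := K) i k).val * algebraMap (MvPolynomial σ K)
      (Localization.Away (X i : MvPolynomial σ K)) (X i ^ 1) =
      algebraMap (MvPolynomial σ K) (Localization.Away (X i : MvPolynomial σ K)) (X k) := by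
    rw [ratio, Away.val_mk, Localization.mk_eq_mk']
    exact IsLocalization.mk'_spec (Localization.Away (X i : MvPolynomial σ K)) _ _
  rwa [pow_one] at h

/-- Dehomogenisation: dividing a form of degree `n` by `X_i ^ n` replaces each variable by its ratio
to `X_i`. Ring maps out of the chart are therefore determined by constants and ratios. -/
lemma mk_eq_eval₂ (i : σ) (n : ℕ) (x : MvPolynomial σ K)
    (hx : x ∈ homogeneousSubmodule σ K (n • 1)) :
    Away.mk _ (X_mem i) n x hx = eval₂Hom (awayC (X i)) (ratio i) x := by
  apply val_injective
  let L := Localization.Away (X i : MvPolynomial σ K)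
  have hu : IsUnit (algebraMap (MvPolynomial σ K) L (X i) ^ n) := (IsLocalization.Away.algebraMap_isUnit _).pow n
  refine hu.mul_right_cancel ?_
  have h1 : (Away.mk _ (X_mem i) n x hx).val * algebraMap (MvPolynomial σ K) L (X i) ^ n =
      algebraMap (MvPolynomial σ K) L x := by
    rw [Away.val_mk, Localization.mk_eq_mk', ← map_pow]
    exact IsLocalization.mk'_spec L x _
  rw [h1]
  have h2 : (eval₂Hom (awayC (X i)) (ratio i) x).val =
      eval₂Hom ((algebraMap (MvPolynomial σ K) L).comp C) (fun k => (ratio (K := K) i k).val) x := by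
    have : (algebraMap (Away (homogeneousSubmodule σ K) (X i : MvPolynomial σ K)) L).comp
        (eval₂Hom (awayC (X i)) (ratio i)) =
        eval₂Hom ((algebraMap (MvPolynomial σ K) L).comp C)
          (fun k => (ratio (K := K) i k).val) := by
      refine MvPolynomial.ringHom_ext (fun c => ?_) (fun k => ?_)
      · simp [val_awayC, L]
      · simp only [RingHom.comp_apply, coe_eval₂Hom, eval₂_X]
        rfl
    exact RingHom.congr_fun this x
  rw [h2]
  conv_lhs => rw [x.as_sum]
  conv_rhs => rw [x.as_sum]
  rw [map_sum, map_sum, Finset.sum_mul]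
  refine Finset.sum_congr rfl fun d hd => ?_
  -- Each monomial has total degree `n`, so the `n` factors `X_i` can be distributed, one to each
  -- variable.
  have hdeg : n = ∑ k ∈ d.support, d k := by
    have : x.IsHomogeneous n := by simpa using hx
    rw [← this.degree_eq_sum_deg_support hd]
  rw [coe_eval₂Hom, eval₂_monomial, hdeg, ← Finset.prod_pow_eq_pow_sum, Finsupp.prod, mul_assoc,
    ← Finset.prod_mul_distrib]
  have h3 : ∏ k ∈ d.support, ((ratio (K := K) i k).val ^ d k *
      algebraMap (MvPolynomial σ K) L (X i) ^ d k) =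
      ∏ k ∈ d.support, algebraMap (MvPolynomial σ K) L (X k) ^ d k :=
    Finset.prod_congr rfl fun k _ => by rw [← mul_pow, val_ratio_mul]
  rw [h3]
  rw [monomial_eq, map_mul, Finsupp.prod, map_prod]
  simp

lemma away_ringHom_ext {S : Type*} [CommRing S] {i : σ}
    {φ ψ : Away (homogeneousSubmodule σ K) (X i : MvPolynomial σ K) →+* S}
    (hC : φ.comp (awayC (X i)) = ψ.comp (awayC (X i))) (h : ∀ k, φ (ratio i k) = ψ (ratio i k)) :
    φ = ψ := by
  ext z
  obtain ⟨n, x, hx, rfl⟩ := Away.mk_surjective _ (X_mem i) z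
  rw [mk_eq_eval₂]
  have : φ.comp (eval₂Hom (awayC (X i)) (ratio i)) = ψ.comp (eval₂Hom (awayC (X i)) (ratio i)) := by
    refine MvPolynomial.ringHom_ext (fun c => ?_) (fun k => ?_)
    · simpa using RingHom.congr_fun hC c
    · simpa using h k
  exact RingHom.congr_fun this x

lemma awayEval_awayC (a : σ → R) (f : MvPolynomial σ K) (hf : IsUnit (aeval a f)) :
    (awayEval a f hf).comp (awayC f) = algebraMap K R := by
  ext c
  have : awayEval a f hf (awayC f c) = Localization.awayLift
    (aeval a : MvPolynomial σ K →ₐ[K] R).toRingHom f hf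
      (algebraMap (MvPolynomial σ K) (Localization.Away f) (C c : MvPolynomial σ K)) := rfl
  rw [RingHom.comp_apply, this]
  refine (IsLocalization.Away.lift_eq f hf _).trans ?_
  simp

lemma awayEval_ratio (a : σ → R) (i k : σ) (h : IsUnit (aeval a (X i : MvPolynomial σ K))) :
    awayEval a (X i : MvPolynomial σ K) h (ratio i k) * a i = a k := by
  have := awayEval_mk_mul a (X i : MvPolynomial σ K) h (X_mem i) 1 (X k)
    (by rw [one_smul]; exact X_mem k)
  rwa [pow_one, aeval_X, aeval_X] at this

lemma awayEval_awayMap (a : σ → R) {f g x : MvPolynomial σ K} {d e : ℕ}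
    (hd : f ∈ homogeneousSubmodule σ K d) (he : g ∈ homogeneousSubmodule σ K e)
    (hx : x = f * g) (hf : IsUnit (aeval a f)) (hu : IsUnit (aeval a x)) :
    (awayEval a x hu).comp (HomogeneousLocalization.awayMap (homogeneousSubmodule σ K) he hx) = awayEval a f hf := by
  refine awayEval_eq_iff a f hf hd _ fun n y hy => ?_
  rw [RingHom.comp_apply, HomogeneousLocalization.awayMap_mk]
  have hg : IsUnit (aeval a g) := by
    rw [hx, map_mul] at hu
    exact isUnit_of_mul_isUnit_right hu
  refine (hg.pow n).mul_right_cancel ?_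
  have h2 := awayEval_mk_mul a x hu (hx ▸ SetLike.mul_mem_graded hd he) n (y * g ^ n)
    (by rw [smul_add]; exact SetLike.mul_mem_graded hy (SetLike.pow_mem_graded n he))
  have h3 : aeval a f * aeval a g = aeval a x := by rw [← map_mul, ← hx]
  rw [mul_assoc, ← mul_pow, h3, h2, map_mul, map_pow]

lemma val_awayMap_ratio_mul (i k : σ) {g x : MvPolynomial σ K} {e : ℕ}
    (he : g ∈ homogeneousSubmodule σ K e) (hx : x = X i * g) :
    (HomogeneousLocalization.awayMap (homogeneousSubmodule σ K) he hx (ratio i k)).val *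
      algebraMap (MvPolynomial σ K) (Localization.Away x) (X i) =
      algebraMap (MvPolynomial σ K) (Localization.Away x) (X k) := by
  have hu : IsUnit (algebraMap (MvPolynomial σ K) (Localization.Away x) (X i)) :=
    isUnit_of_dvd_unit (map_dvd _ ⟨_, hx⟩) (IsLocalization.Away.algebraMap_isUnit x)
  have h := congrArg (Localization.awayLift (algebraMap (MvPolynomial σ K) (Localization.Away x))
    (X i) hu) (val_ratio_mul (K := K) i k)
  rw [map_mul] at h
  have hl : ∀ p : MvPolynomial σ K, Localization.awayLift
      (algebraMap (MvPolynomial σ K) (Localization.Away x)) (X i) hu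
        (algebraMap (MvPolynomial σ K) (Localization.Away (X i : MvPolynomial σ K)) p) =
      algebraMap (MvPolynomial σ K) (Localization.Away x) p := fun p =>
    IsLocalization.Away.lift_eq _ hu p
  rw [hl, hl] at h
  rw [val_awayMap]
  exact h

end evaluation

variable (K σ) in
/-- Projective space over `K` with homogeneous coordinates indexed by `σ`. -/
def projSpace : Sch K :=
  Over.mk (Y := Proj (homogeneousSubmodule σ K)) (Proj.toSpecZero (homogeneousSubmodule σ K) ≫
    Spec.map (CommRingCat.ofHom (algebraMap K (homogeneousSubmodule σ K 0))))

/-- The standard affine charts of projective space. -/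
abbrev chartι (i : σ) :
    Spec (CommRingCat.of (Away (homogeneousSubmodule σ K) (X i : MvPolynomial σ K))) ⟶
      (projSpace K σ).left :=
  Proj.awayι (homogeneousSubmodule σ K) (X i : MvPolynomial σ K) (X_mem i) one_pos

lemma chartι_hom (i : σ) :
    chartι i ≫ (projSpace K σ).hom = Spec.map (CommRingCat.ofHom (awayC (X i))) := by
  refine (Category.assoc _ _ _).symm.trans ?_
  refine (congrArg (· ≫ _) (Proj.awayι_toSpecZero _ _ _ _)).trans ?_
  exact (Spec.map_comp _ _).symm

lemma isUnit_aeval_X {R : Type*} [CommRing R] [Algebra K R] (a : σ → R) {i : σ} (h : a i = 1) :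
    IsUnit (aeval a (X i : MvPolynomial σ K)) := by
  rw [aeval_X, h]; exact isUnit_one

/-- The map `Spec R ⟶ ℙ` with given homogeneous coordinates, one of which is `1`. -/
def projPointHom (R : CommAlgCat.{u} K) (a : σ → R) (i : σ) (h : a i = 1) :
    Spec (CommRingCat.of R) ⟶ (projSpace K σ).left :=
  Spec.map (CommRingCat.ofHom (awayEval a (X i : MvPolynomial σ K) (isUnit_aeval_X a h))) ≫ chartι i

lemma projPointHom_hom (R : CommAlgCat.{u} K) (a : σ → R) (i : σ) (h : a i = 1) :
    projPointHom R a i h ≫ (projSpace K σ).hom = Spec.map (CommRingCat.ofHom (algebraMap K R)) := by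
  refine (Category.assoc _ _ _).trans ?_
  refine (congrArg (_ ≫ ·) (chartι_hom i)).trans ?_
  refine (Spec.map_comp _ _).symm.trans ?_
  exact congrArg (fun f => Spec.map (CommRingCat.ofHom f)) (awayEval_awayC _ _ _)

lemma comp_awayEval {R T : CommAlgCat.{u} K} (δ : R ⟶ T) (a : σ → R) (i : σ) (h : a i = 1)
    (h' : δ.hom (a i) = 1) :
    δ.hom.toRingHom.comp (awayEval a (X i : MvPolynomial σ K) (isUnit_aeval_X a h)) =
      awayEval (fun i => δ.hom (a i)) (X i : MvPolynomial σ K) (isUnit_aeval_X _ h') := by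
  refine away_ringHom_ext ?_ fun k => ?_
  · rw [RingHom.comp_assoc, awayEval_awayC, awayEval_awayC]
    exact δ.hom.comp_algebraMap
  · have h1 := awayEval_ratio (K := K) a i k (isUnit_aeval_X a h)
    have h2 := awayEval_ratio (K := K) (fun i => δ.hom (a i)) i k (isUnit_aeval_X _ h')
    rw [h, mul_one] at h1
    rw [h', mul_one] at h2
    exact (congrArg δ.hom h1).trans h2.symm

variable (K σ) in
/-- The standard atlas of projective space. -/
def projChartMap : charts K σ ⟶ points (projSpace K σ) where
  app R := ↾(fun c => Over.homMk (projPointHom R c.1.2 c.1.1.down c.2) (projPointHom_hom _ _ _ _))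
  naturality R T δ := by
    ext c
    refine Over.OverMorphism.ext ?_
    refine Eq.trans ?_ (Category.assoc _ _ _)
    refine congrArg (· ≫ chartι c.1.1.down) ?_
    refine Eq.trans ?_ (Spec.map_comp _ _)
    refine congrArg (fun f => Spec.map (CommRingCat.ofHom f)) ?_
    exact (comp_awayEval δ c.1.2 c.1.1.down c.2 (by rw [c.2, map_one])).symm

/-- Equal points lift to the intersection of the charts `i` and `j`, where `X_k / X_i = (X_j / X_i)
(X_k / X_j)`. Conversely, proportionality makes `X_j` invertible at `a`; the point can then be
computed in chart `j`, where `a` and `b` have the same ratios. -/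
lemma projPointHom_eq_iff (R : CommAlgCat.{u} K) (a b : σ → R) (i j : σ) (hi : a i = 1)
    (hj : b j = 1) :
    projPointHom R a i hi = projPointHom R b j hj ↔ ∀ k, a k = a j * b k := by
  constructor
  · intro h k
    let x := Limits.pullback.lift _ _ h ≫ (Proj.pullbackAwayιIso (homogeneousSubmodule σ K)
      (X_mem i) one_pos (X_mem j) one_pos rfl).hom
    obtain ⟨g, hg⟩ : ∃ g, Spec.map g = x := ⟨Spec.preimage x, Spec.map_preimage x⟩
    have h1 : Spec.map g ≫ Spec.map (CommRingCat.ofHom (HomogeneousLocalization.awayMap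
        (homogeneousSubmodule σ K) (X_mem j) rfl)) = Spec.map (CommRingCat.ofHom
          (awayEval a (X i : MvPolynomial σ K) (isUnit_aeval_X a hi))) := by
      rw [hg]
      refine (Category.assoc _ _ _).trans ?_
      refine (congrArg (_ ≫ ·) (Proj.pullbackAwayιIso_hom_SpecMap_awayMap_left
        _ _ _ _ _ _)).trans ?_
      exact Limits.pullback.lift_fst _ _ _
    have h2 : Spec.map g ≫ Spec.map (CommRingCat.ofHom (HomogeneousLocalization.awayMap
        (homogeneousSubmodule σ K) (X_mem i) (mul_comm _ _))) =
        Spec.map (CommRingCat.ofHom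
          (awayEval b (X j : MvPolynomial σ K) (isUnit_aeval_X b hj))) := by
      rw [hg]
      refine (Category.assoc _ _ _).trans ?_
      refine (congrArg (_ ≫ ·) (Proj.pullbackAwayιIso_hom_SpecMap_awayMap_right
        _ _ _ _ _ _)).trans ?_
      exact Limits.pullback.lift_snd _ _ _
    have h1' := fun k => congrArg (fun f => f.hom (ratio i k))
      (Spec.map_injective ((Spec.map_comp _ _).trans h1))
    have h2' := fun k => congrArg (fun f => f.hom (ratio j k))
      (Spec.map_injective ((Spec.map_comp _ _).trans h2))
    have hr : HomogeneousLocalization.awayMap (homogeneousSubmodule σ K) (X_mem j) rfl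
        (ratio i k) = HomogeneousLocalization.awayMap (homogeneousSubmodule σ K)
          (X_mem j) rfl (ratio i j) *
        HomogeneousLocalization.awayMap (homogeneousSubmodule σ K) (X_mem i)
          (mul_comm _ _) (ratio j k) := by
      apply val_injective
      rw [val_mul]
      have hu := IsLocalization.Away.algebraMap_isUnit
        (S := Localization.Away (X i * X j : MvPolynomial σ K)) (X i * X j : MvPolynomial σ K)
      refine hu.mul_right_cancel ?_
      rw [map_mul, ← mul_assoc, val_awayMap_ratio_mul, mul_mul_mul_comm, val_awayMap_ratio_mul,
        val_awayMap_ratio_mul]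
      exact mul_comm _ _
    have e1 : ∀ k, awayEval a (X i : MvPolynomial σ K) (isUnit_aeval_X a hi) (ratio i k) = a k :=
      fun k => by
        have := awayEval_ratio (K := K) a i k (isUnit_aeval_X a hi)
        rwa [hi, mul_one] at this
    have e2 : ∀ k, awayEval b (X j : MvPolynomial σ K) (isUnit_aeval_X b hj) (ratio j k) = b k :=
      fun k => by
        have := awayEval_ratio (K := K) b j k (isUnit_aeval_X b hj)
        rwa [hj, mul_one] at this
    rw [← e1 k, ← e1 j, ← e2 k]
    refine (h1' k).symm.trans (Eq.trans ?_ (congrArg₂ (· * ·) (h1' j) (h2' k)))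
    exact (congrArg g.hom hr).trans (map_mul _ _ _)
  · intro h
    have haj : a j * b i = 1 := by rw [← h, hi]
    have hu : IsUnit (aeval a (X i * X j : MvPolynomial σ K)) := by
      rw [map_mul, aeval_X, aeval_X, hi, one_mul]
      exact IsUnit.of_mul_eq_one _ haj
    have huj : IsUnit (aeval a (X j : MvPolynomial σ K)) := by
      rw [aeval_X]
      exact IsUnit.of_mul_eq_one _ haj
    have h1 := awayEval_awayMap a (X_mem i) (X_mem j) rfl
      (isUnit_aeval_X a hi) hu
    have h2 := awayEval_awayMap a (X_mem j) (X_mem i) (mul_comm _ _) huj hu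
    have h3 : awayEval a (X j : MvPolynomial σ K) huj =
        awayEval b (X j : MvPolynomial σ K) (isUnit_aeval_X b hj) := by
      refine away_ringHom_ext (by rw [awayEval_awayC, awayEval_awayC]) fun k => ?_
      have e1 := awayEval_ratio (K := K) a j k huj
      have e2 := awayEval_ratio (K := K) b j k (isUnit_aeval_X b hj)
      rw [hj, mul_one] at e2
      rw [aeval_X] at huj
      refine huj.mul_right_cancel ?_
      rw [e1, e2, h k, mul_comm]
    have key : ∀ {f x g : MvPolynomial σ K} {d e : ℕ} (hd : f ∈ homogeneousSubmodule σ K d)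
        (he : g ∈ homogeneousSubmodule σ K e) (hd0 : 0 < d) (hx : x = f * g)
        (hf : IsUnit (aeval a f)) (hu : IsUnit (aeval a x)),
        Spec.map (CommRingCat.ofHom (awayEval a f hf)) ≫
          Proj.awayι (homogeneousSubmodule σ K) f hd hd0 =
        Spec.map (CommRingCat.ofHom (awayEval a x hu)) ≫
          Proj.awayι (homogeneousSubmodule σ K) x (hx ▸ SetLike.mul_mem_graded hd he)
            (hd0.trans_le (d.le_add_right e)) := by
      intro f x g d e hd he hd0 hx hf hu
      rw [← Proj.SpecMap_awayMap_awayι _ hd hd0 he hx, ← Category.assoc, ← Spec.map_comp,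
        ← CommRingCat.ofHom_comp, awayEval_awayMap a hd he hx hf hu]
    refine (key (X_mem i) (X_mem j) one_pos rfl
      (isUnit_aeval_X a hi) hu).trans ?_
    refine (key (X_mem j) (X_mem i) one_pos (mul_comm _ _) huj hu).symm.trans ?_
    rw [h3]
    rfl

lemma adjoin_X_eq_top : Algebra.adjoin (homogeneousSubmodule σ K 0)
    (Set.range (X : σ → MvPolynomial σ K)) = ⊤ := by
  rw [← top_le_iff]
  intro x _
  induction x using MvPolynomial.induction_on with
  | C c => exact Subalgebra.algebraMap_mem _ (⟨C c, isHomogeneous_C σ c⟩ : homogeneousSubmodule σ K 0)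
  | add p q hp hq => exact add_mem (hp trivial) (hq trivial)
  | mul_X p i hp => exact mul_mem (hp trivial) (Algebra.subset_adjoin ⟨i, rfl⟩)

lemma isLocallySurj_projChartMap : IsLocallySurj (projChartMap K σ) := by
  intro R y p
  let y' : Spec (CommRingCat.of R) ⟶ (projSpace K σ).left := y.left
  obtain ⟨i, hi⟩ := TopologicalSpace.Opens.mem_iSup.1
    ((Proj.iSup_basicOpen_eq_top' (homogeneousSubmodule σ K) X
      (fun i => ⟨1, X_mem i⟩) adjoin_X_eq_top).ge
      (TopologicalSpace.Opens.mem_top (y' p)))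
  have : IsOpenImmersion (chartι (K := K) i) :=
    inferInstanceAs (IsOpenImmersion (Proj.awayι (homogeneousSubmodule σ K) _ (X_mem i) one_pos))
  obtain ⟨f, hf, x, hx⟩ := exists_away_lift (chartι i) y' p (by
    rw [← Proj.opensRange_awayι _ _ (X_mem i) one_pos] at hi
    exact hi)
  obtain ⟨φ, rfl⟩ : ∃ φ, Spec.map φ = x := ⟨Spec.preimage x, Spec.map_preimage x⟩
  have hii : φ.hom (ratio i i) = 1 := by
    have : ratio (K := K) i i = 1 := by
      apply val_injective
      refine (IsLocalization.Away.algebraMap_isUnit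
        (S := Localization.Away (X i : MvPolynomial σ K)) (X i : MvPolynomial σ K)).mul_right_cancel ?_
      rw [val_ratio_mul, val_one, one_mul]
    exact (congrArg φ.hom this).trans (map_one _)
  refine ⟨f, hf, ⟨(⟨i⟩, fun k => φ.hom (ratio i k)), hii⟩, Over.OverMorphism.ext ?_⟩
  refine Eq.trans ?_ hx
  refine congrArg (· ≫ chartι i) ?_
  have hK : CommRingCat.ofHom (awayC (X i : MvPolynomial σ K)) ≫ φ =
      CommRingCat.ofHom (algebraMap K (away R f)) := by
    apply Spec.map_injective
    refine (Spec.map_comp _ _).trans ?_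
    refine (congrArg (Spec.map φ ≫ ·) (chartι_hom i)).symm.trans ?_
    refine (Category.assoc _ _ _).symm.trans ?_
    refine (congrArg (· ≫ (projSpace K σ).hom) hx).trans ?_
    exact Over.w ((points (projSpace K σ)).map (toAway R f) y)
  have : awayEval (fun k => φ.hom (ratio i k)) (X i : MvPolynomial σ K) (isUnit_aeval_X _ hii) =
      φ.hom := by
    refine away_ringHom_ext ?_ fun k => ?_
    · rw [awayEval_awayC]
      exact (congrArg CommRingCat.Hom.hom hK).symm
    · have e := awayEval_ratio (K := K) (R := away R f) (fun k => φ.hom (ratio i k)) i k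
        (isUnit_aeval_X _ hii)
      rwa [hii, mul_one] at e
  exact congrArg (fun f => Spec.map (CommRingCat.ofHom f)) this

/-- The functor of points of projective space is the projectivization of a vector space with a
basis given by the coordinates. -/
theorem nonempty_iso_projSpace {V : Type u} [AddCommGroup V] [Module K V] [Finite σ]
    (b : Module.Basis σ K V) :
    Nonempty (points (projSpace K σ) ≅ projectivization (K := K) V) := by
  have : Module.Finite K V := Module.Finite.of_basis b
  refine exists_iso_of_atlas (projChartMap K σ) (chartMap b) (isZariskiSheaf_points _)
    (isZariskiSheaf_projectivization V) isLocallySurj_projChartMap (isLocallySurj_chartMap b)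
    fun R c c' => ?_
  -- In both atlases two chart points are glued exactly when `a_k = a_j * a'_k` for all `k`.
  rw [chartMap_eq_iff, ← projPointHom_eq_iff R c.1.2 c'.1.2 c.1.1.down c'.1.1.down c.2 c'.2]
  exact ⟨fun h => congrArg (fun z => z.left) h, fun h => Over.OverMorphism.ext h⟩

end proj

/-! ### Minors -/

section minors

variable {R : Type*} [CommRing R] {m n : ℕ}

/-- Expanding `det (Y * P) = 1` by multilinearity writes `1` as a combination of maximal minors of
`Y`. Column choices with repetitions contribute zero and need not be excluded. -/
lemma exists_minor_notMem (Y : Matrix (Fin m) (Fin n) R) (P : Matrix (Fin n) (Fin m) R)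
    (h : Y * P = 1) (p : Ideal R) (hp : p ≠ ⊤) :
    ∃ c : Fin m → Fin n, (Y.submatrix id c).det ∉ p := by
  by_contra! hno
  refine hp ((Ideal.eq_top_iff_one p).2 ?_)
  have h1 : (Y * P).det = ∑ c : Fin m → Fin n, (∏ j, P (c j) j) * (Y.submatrix id c).det := by
    rw [← Matrix.det_transpose]
    have h2 : (Y * P).transpose = fun j => ∑ k, P k j • Y.transpose k := by
      ext j i
      simp [Matrix.mul_apply, Finset.sum_apply, mul_comm]
    rw [h2]
    refine ((Matrix.detRowAlternating (n := Fin m) (R := R)).toMultilinearMap.map_sum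
      (fun j k => P k j • Y.transpose k)).trans ?_
    refine Finset.sum_congr rfl fun c _ => ?_
    refine ((Matrix.detRowAlternating (n := Fin m) (R := R)).toMultilinearMap.map_smul_univ
      (fun j => P (c j) j) (fun j => Y.transpose (c j))).trans ?_
    rw [smul_eq_mul, ← Matrix.det_transpose (Y.submatrix id c)]
    rfl
  rw [h, Matrix.det_one] at h1
  rw [h1]
  exact Ideal.sum_mem _ fun c _ => Ideal.mul_mem_left _ _ (hno c)

/-- Replacing one column of an identity matrix gives a determinant equal to a single entry of the
new column. The entries of a normalised matrix are thus among its Plücker coordinates. -/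
lemma det_submatrix_update (X : Matrix (Fin m) (Fin n) R) (c : Fin m → Fin n)
    (h : X.submatrix id c = 1) (i : Fin m) (k : Fin n) :
    (X.submatrix id (Function.update c i k)).det = X i k := by
  have h1 : X.submatrix id (Function.update c i k) =
      (1 : Matrix (Fin m) (Fin m) R).updateCol i (fun l => X l k) := by
    rw [← h]
    ext a b
    by_cases hb : b = i
    · subst hb; simp
    · simp [Matrix.updateCol_ne hb, Function.update_of_ne hb]
  rw [h1, ← Matrix.cramer_apply, Matrix.cramer_one]
  rfl

lemma span_range_mul_le (A : Matrix (Fin m) (Fin m) R) (Y : Matrix (Fin m) (Fin n) R) :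
    Submodule.span R (Set.range (A * Y : Matrix (Fin m) (Fin n) R)) ≤
      Submodule.span R (Set.range Y) := by
  refine Submodule.span_le.2 ?_
  rintro _ ⟨i, rfl⟩
  have : (A * Y : Matrix (Fin m) (Fin n) R) i = ∑ j, A i j • Y j := by
    ext k; simp [Matrix.mul_apply, Finset.sum_apply]
  rw [this]
  exact Submodule.sum_mem _ fun j _ => Submodule.smul_mem _ _ (Submodule.subset_span ⟨j, rfl⟩)

lemma span_range_mul {A : Matrix (Fin m) (Fin m) R} (hA : IsUnit A.det)
    (Y : Matrix (Fin m) (Fin n) R) :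
    Submodule.span R (Set.range (A * Y : Matrix (Fin m) (Fin n) R)) =
      Submodule.span R (Set.range Y) := by
  refine le_antisymm (span_range_mul_le A Y) ?_
  have h := span_range_mul_le A⁻¹ (A * Y)
  rwa [← Matrix.mul_assoc, Matrix.nonsing_inv_mul _ hA, Matrix.one_mul] at h

end minors

/-! ### Exterior products and the Plücker pairing -/

section pairing

variable {K : Type u} [Field K] {m n : ℕ}

variable (K) in
/-- The minor with columns `c`, as a linear form on the exterior power. -/
def minor (c : Fin m → Fin n) : Module.Dual K (⋀[K]^m (Fin n → K)) :=
  exteriorPower.pairingDual K (Fin n → K) m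
    (exteriorPower.ιMulti K m fun j => LinearMap.proj (c j))

lemma minor_ιMulti (c : Fin m → Fin n) (v : Fin m → Fin n → K) :
    minor K c (exteriorPower.ιMulti K m v) = (Matrix.submatrix (Matrix.of v) id c).det := by
  rw [minor, exteriorPower.pairingDual_ιMulti_ιMulti]
  rfl

variable (K m n) in
/-- The basis of the dual of the exterior power given by the maximal minors. -/
def minorBasis : Module.Basis (Set.powersetCard (Fin n) m) K (Module.Dual K (⋀[K]^m (Fin n → K))) :=
  ((Pi.basisFun K (Fin n)).exteriorPower m).dualBasis

lemma minorBasis_apply (s : Set.powersetCard (Fin n) m) :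
    minorBasis K m n s = minor K (Set.powersetCard.ofFinEmbEquiv.symm s) := by
  rw [minorBasis, Module.Basis.coe_dualBasis, exteriorPower.basis_coord]
  rw [exteriorPower.ιMultiDual, exteriorPower.ιMulti_family, minor]
  congr 2

variable (R : Type*) [CommRing R] [Algebra K R]

variable (K m n) in
/-- The pairing between `R ⊗ (⋀^m K^n)^*` and `R ⊗ ⋀^m K^n`. -/
def pairing : R ⊗[K] Module.Dual K (⋀[K]^m (Fin n → K)) →ₗ[R]
    Module.Dual R (R ⊗[K] (⋀[K]^m (Fin n → K))) :=
  (Module.Dual.baseChange R).liftBaseChange R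

lemma pairing_tmul (r s : R) (ξ : Module.Dual K (⋀[K]^m (Fin n → K)))
    (v : ⋀[K]^m (Fin n → K)) :
    pairing K m n R (r ⊗ₜ ξ) (s ⊗ₜ v) = r * (s * algebraMap K R (ξ v)) := by
  rw [pairing, LinearMap.liftBaseChange_tmul, LinearMap.smul_apply,
    Module.Dual.baseChange_apply_tmul, smul_eq_mul, Algebra.smul_def, mul_comm s]

variable {R}

lemma eq_of_pairing_minor {w w' : R ⊗[K] (⋀[K]^m (Fin n → K))}
    (h : ∀ c : Fin m → Fin n, pairing K m n R (1 ⊗ₜ minor K c) w =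
      pairing K m n R (1 ⊗ₜ minor K c) w') : w = w' := by
  let b := (Pi.basisFun K (Fin n)).exteriorPower m
  have key : ∀ (s : Set.powersetCard (Fin n) m) (w : R ⊗[K] (⋀[K]^m (Fin n → K))),
      (b.baseChange R).repr w s =
        pairing K m n R (1 ⊗ₜ minor K (Set.powersetCard.ofFinEmbEquiv.symm s)) w := by
    intro s w
    rw [← minorBasis_apply]
    induction w using TensorProduct.induction_on with
    | zero => simp
    | add x y hx hy => rw [map_add, map_add, Finsupp.add_apply, hx, hy]
    | tmul r v =>
      rw [pairing_tmul, one_mul, Module.Basis.baseChange_repr_tmul, minorBasis,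
        Module.Basis.dualBasis_apply, Algebra.smul_def, mul_comm]
  exact (b.baseChange R).ext_elem fun s => by rw [key, key, h]

variable (K) in
/-- The exterior product of the rows of a matrix, in `R ⊗ ⋀^m K^n`. -/
def wedgeVec (x : Matrix (Fin m) (Fin n) R) : R ⊗[K] (⋀[K]^m (Fin n → K)) :=
  wedgeEquiv m n R (exteriorPower.ιMulti R m x)

/-- Both sides are alternating in the rows of `x`, so it is enough to compare them on standard basis
vectors, which come from `K`. -/
lemma pairing_minor_wedgeVec (c : Fin m → Fin n) (x : Matrix (Fin m) (Fin n) R) :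
    pairing K m n R (1 ⊗ₜ minor K c) (wedgeVec K x) = (x.submatrix id c).det := by
  let F : (Fin n → R) [⋀^Fin m]→ₗ[R] R :=
    ((pairing K m n R (1 ⊗ₜ minor K c)) ∘ₗ (wedgeEquiv m n R).toLinearMap).compAlternatingMap
      (exteriorPower.ιMulti R m)
  let G : (Fin n → R) [⋀^Fin m]→ₗ[R] R :=
    (Matrix.detRowAlternating (n := Fin m) (R := R)).compLinearMap (LinearMap.funLeft R R c)
  have hFG : F = G := by
    refine Module.Basis.ext_alternating (Pi.basisFun R (Fin n)) fun s _ => ?_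
    have h1 : F (fun j => Pi.basisFun R (Fin n) (s j)) =
        pairing K m n R (1 ⊗ₜ minor K c) (wedgeEquiv m n R (exteriorPower.ιMulti R m
          (fun j i => algebraMap K R (Pi.basisFun K (Fin n) (s j) i)))) := by
      change pairing K m n R (1 ⊗ₜ minor K c) (wedgeEquiv m n R (exteriorPower.ιMulti R m _)) = _
      congr 3
      ext j i
      simp [Pi.single_apply, apply_ite (algebraMap K R)]
    rw [h1, wedgeEquiv_ιMulti, pairing_tmul, one_mul, one_mul, minor_ιMulti, RingHom.map_det]
    refine congrArg Matrix.det ?_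
    ext i j
    simp [Pi.single_apply, apply_ite (algebraMap K R), LinearMap.funLeft]
  exact congrArg (fun f : (Fin n → R) [⋀^Fin m]→ₗ[R] R => f x) hFG

lemma wedgeVec_mul (A : Matrix (Fin m) (Fin m) R) (x : Matrix (Fin m) (Fin n) R) :
    wedgeVec K (A * x) = A.det • wedgeVec K x := by
  refine eq_of_pairing_minor fun c => ?_
  rw [map_smul, pairing_minor_wedgeVec, pairing_minor_wedgeVec, smul_eq_mul, ← Matrix.det_mul]
  refine congrArg Matrix.det ?_
  ext i j
  simp [Matrix.mul_apply]

lemma range_wedgeMap_span (x : Matrix (Fin m) (Fin n) R) :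
    LinearMap.range (wedgeMap m K (Submodule.span R (Set.range x))) =
      Submodule.span R {wedgeVec K x} := by
  rw [range_wedgeMap]
  apply le_antisymm
  · refine Submodule.span_le.2 ?_
    rintro _ ⟨y, hy, rfl⟩
    choose τ hτ using hy
    -- A tuple of rows of `x`, repetitions allowed, is a selection matrix times `x`; its exterior
    -- product is the determinant of that matrix times the one of `x`.
    have h1 : y = ((Matrix.of fun i j => if τ i = j then (1 : R) else 0) * x :
        Matrix (Fin m) (Fin n) R) := by
      ext i k
      rw [← hτ]
      simp [Matrix.mul_apply]
    have h2 : wedgeEquiv m n R (exteriorPower.ιMulti R m y) = wedgeVec K (Matrix.of y) := rfl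
    change wedgeEquiv m n R (exteriorPower.ιMulti R m y) ∈ _
    rw [h2, show Matrix.of y = _ from h1, wedgeVec_mul]
    exact Submodule.smul_mem _ _ (Submodule.mem_span_singleton_self _)
  · rw [Submodule.span_singleton_le_iff_mem]
    exact Submodule.subset_span ⟨x, fun j => ⟨j, rfl⟩, rfl⟩

lemma mem_ker_pluckerMap (M : Submodule R (Fin n → R))
    (z : R ⊗[K] Module.Dual K (⋀[K]^m (Fin n → K))) :
    z ∈ LinearMap.ker (pluckerMap m K M) ↔
      ∀ w ∈ LinearMap.range (wedgeMap m K M), pairing K m n R z w = 0 := by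
  rw [LinearMap.mem_ker]
  constructor
  · rintro h _ ⟨ω, rfl⟩
    exact LinearMap.congr_fun h ω
  · intro h
    ext1
    ext ω
    exact h _ ⟨_, rfl⟩

variable (K) in
/-- The linear form on `R ⊗ (⋀^m K^n)^*` given by the exterior product of the rows of `x`. -/
def pluckerForm (x : Matrix (Fin m) (Fin n) R) :
    R ⊗[K] Module.Dual K (⋀[K]^m (Fin n → K)) →ₗ[R] R :=
  (pairing K m n R).flip (wedgeVec K x)

lemma pluckerForm_minor (c : Fin m → Fin n) (x : Matrix (Fin m) (Fin n) R) :
    pluckerForm K x (1 ⊗ₜ minor K c) = (x.submatrix id c).det :=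
  pairing_minor_wedgeVec c x

lemma pluckerForm_mul (A : Matrix (Fin m) (Fin m) R) (x : Matrix (Fin m) (Fin n) R) :
    pluckerForm K (A * x) = A.det • pluckerForm K x := by
  rw [pluckerForm, wedgeVec_mul, map_smul]
  rfl

lemma ker_pluckerMap_span (x : Matrix (Fin m) (Fin n) R) :
    LinearMap.ker (pluckerMap m K (Submodule.span R (Set.range x))) =
      LinearMap.ker (pluckerForm K x) := by
  ext z
  rw [mem_ker_pluckerMap, range_wedgeMap_span]
  constructor
  · intro h
    exact h _ (Submodule.mem_span_singleton_self _)
  · intro h w hw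
    obtain ⟨r, rfl⟩ := Submodule.mem_span_singleton.1 hw
    rw [map_smul, show pairing K m n R z (wedgeVec K x) = 0 from h, smul_zero]

/-- A linear form with the same kernel as a Plücker form is the Plücker form of a matrix whose
entries are determined by the linear form. -/
lemma eq_pluckerForm (φ : R ⊗[K] Module.Dual K (⋀[K]^m (Fin n → K)) →ₗ[R] R)
    (c c' : Fin m → Fin n) (hc : φ (1 ⊗ₜ minor K c) = 1) (y : Matrix (Fin m) (Fin n) R)
    (hy : y.submatrix id c' = 1) (hker : LinearMap.ker φ = LinearMap.ker (pluckerForm K y)) :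
    let x : Matrix (Fin m) (Fin n) R :=
      Matrix.of fun i k => φ (1 ⊗ₜ minor K (Function.update c i k))
    φ = pluckerForm K x ∧ Submodule.span R (Set.range y) = Submodule.span R (Set.range x) := by
  intro x
  have hy' : pluckerForm K y (1 ⊗ₜ minor K c') = 1 := by
    rw [pluckerForm_minor, hy, Matrix.det_one]
  -- Forms with the same kernel, the second taking the value `1`, are proportional. Evaluating at
  -- the minor `c` shows that the factor is inverse to `det A`, so passing to `A⁻¹ * y` absorbs it.
  have h1 : ∀ z, φ z = φ (1 ⊗ₜ minor K c') * pluckerForm K y z := by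
    intro z
    have : z - pluckerForm K y z • ((1 : R) ⊗ₜ[K] minor K c') ∈ LinearMap.ker φ := by
      rw [hker, LinearMap.mem_ker, map_sub, map_smul, hy', smul_eq_mul, mul_one, sub_self]
    rw [LinearMap.mem_ker, map_sub, map_smul, sub_eq_zero, smul_eq_mul, mul_comm] at this
    exact this
  let A := y.submatrix id c
  have h2 : φ (1 ⊗ₜ minor K c') * A.det = 1 := by
    rw [← pluckerForm_minor (K := K), ← h1, hc]
  have hA : IsUnit A.det := IsUnit.of_mul_eq_one_right _ h2
  have h3 : φ = pluckerForm K (A⁻¹ * y) := by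
    ext1
    ext ξ
    change φ (1 ⊗ₜ ξ) = pluckerForm K (A⁻¹ * y) (1 ⊗ₜ ξ)
    rw [pluckerForm_mul, h1]
    congr 1
    rw [Matrix.det_nonsing_inv]
    refine hA.mul_right_cancel ?_
    rw [h2, Ring.inverse_mul_cancel _ hA]
  have h4 : (A⁻¹ * y).submatrix id c = 1 := by
    rw [← Matrix.nonsing_inv_mul A hA]
    ext i j
    simp [Matrix.mul_apply, A]
  have h5 : A⁻¹ * y = x := by
    ext i k
    change _ = φ (1 ⊗ₜ minor K (Function.update c i k))
    rw [h3, pluckerForm_minor, det_submatrix_update _ _ h4]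
  refine ⟨by rw [← h5, ← h3], ?_⟩
  rw [← h5, span_range_mul]
  exact (Matrix.isUnit_nonsing_inv_det_iff).2 hA

end pairing

section

variable {K : Type u} [Field K] {m n : ℕ}

/-! ### Charts of the Grassmannian -/

/-- Two successive localizations can be replaced by one: if `d` is `r` divided by a power of `a`,
then `a` and `d` both become invertible in `R_{ar}`. -/
lemma IsLocallySurj.of_locally {C F : CommAlgCat.{u} K ⥤ Type u} {φ : C ⟶ F}
    (h : ∀ (R : CommAlgCat.{u} K) (y : F.obj R) (p : PrimeSpectrum R), ∃ a : R, a ∉ p.asIdeal ∧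
      ∀ q : PrimeSpectrum (away R a), ∃ d : away R a, d ∉ q.asIdeal ∧
        ∃ c : C.obj (away (away R a) d),
          φ.app _ c = F.map (toAway (away R a) d) (F.map (toAway R a) y)) :
    IsLocallySurj φ := by
  intro R y p
  obtain ⟨a, ha, h⟩ := h R y p
  obtain ⟨q, rfl⟩ := exists_comap_eq p ha
  obtain ⟨d, hd, c, hc⟩ := h q
  obtain ⟨⟨r, s⟩, hr⟩ := IsLocalization.surj (Submonoid.powers a) d
  dsimp only at hr
  have hau : IsUnit ((toAway R (a * r)).hom a) := by
    have := isUnit_toAway R (a * r)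
    rw [map_mul] at this
    exact isUnit_of_mul_isUnit_left this
  have hru : IsUnit ((toAway R (a * r)).hom r) := by
    have := isUnit_toAway R (a * r)
    rw [map_mul] at this
    exact isUnit_of_mul_isUnit_right this
  have hcomp : ∀ t : R, (awayDesc (toAway R (a * r)) a hau).hom (algebraMap R (Localization.Away a) t) =
      (toAway R (a * r)).hom t := fun t =>
    congrArg (fun g : R ⟶ away R (a * r) => g.hom t) (toAway_awayDesc (toAway R (a * r)) a hau)
  have hdu : IsUnit ((awayDesc (toAway R (a * r)) a hau).hom d) := by
    have h1 := congrArg (awayDesc (toAway R (a * r)) a hau).hom hr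
    rw [map_mul, hcomp, hcomp] at h1
    exact isUnit_of_mul_isUnit_left (h1 ▸ hru)
  refine ⟨a * r, ?_, C.map (awayDesc (awayDesc (toAway R (a * r)) a hau) d hdu) c, ?_⟩
  · refine fun hmem => (q.comap (algebraMap R (Localization.Away a))).isPrime.mem_or_mem hmem |>.elim
      ha fun hr' => ?_
    have h1 : algebraMap R (Localization.Away a) r ∈ q.asIdeal := hr'
    rw [← hr] at h1
    refine (q.isPrime.mem_or_mem h1).elim hd fun h2 => ?_
    exact q.isPrime.ne_top (Ideal.eq_top_of_isUnit_mem _ h2 (IsLocalization.map_units _ s))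
  · rw [app_map_apply, hc, map_map_apply, map_map_apply, toAway_awayDesc, toAway_awayDesc]

/-- Two sections with the same image are replaced by chart points one after the other, each after
localising. -/
lemma injective_of_atlas {C F F' : CommAlgCat.{u} K ⥤ Type u} {φ : C ⟶ F} (hφ : IsLocallySurj φ)
    (hF : IsZariskiSheaf F) (η : F ⟶ F')
    (h : ∀ (R : CommAlgCat.{u} K) (c c' : C.obj R),
      η.app R (φ.app R c) = η.app R (φ.app R c') → φ.app R c = φ.app R c')
    (R : CommAlgCat.{u} K) : Function.Injective (η.app R) := by
  have key : ∀ (R : CommAlgCat.{u} K) (c : C.obj R) (y : F.obj R),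
      η.app R (φ.app R c) = η.app R y → φ.app R c = y := by
    intro R c y hy
    refine hF.eq_of_locally fun p => ?_
    obtain ⟨f, hf, c', hc'⟩ := hφ R y p
    refine ⟨f, hf, ?_⟩
    rw [← hc', ← app_map_apply]
    refine h _ _ _ ?_
    rw [hc', app_map_apply, app_map_apply, app_map_apply, hy]
  intro x y hxy
  refine hF.eq_of_locally fun p => ?_
  obtain ⟨f, hf, c, hc⟩ := hφ R x p
  refine ⟨f, hf, ?_⟩
  rw [← hc]
  refine key _ _ _ ?_
  rw [hc, app_map_apply, app_map_apply, hxy]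

/-- The summand spanned by the rows of a matrix with an identity minor. -/
def spanSummand {R : Type u} [CommRing R] (x : Matrix (Fin m) (Fin n) R)
    (hx : ∃ c : Fin m → Fin n, x.submatrix id c = 1) : Summand m n R where
  carrier := Submodule.span R (Set.range x)
  isComplemented := by
    obtain ⟨c, hc⟩ := hx
    refine ⟨_, LinearMap.isCompl_of_proj
      (f := ((Fintype.linearCombination R x) ∘ₗ LinearMap.funLeft R R c).codRestrict _ fun v => ?_)
      ?_⟩
    · exact (Fintype.range_linearCombination (α := Fin m) R (x : Fin m → Fin n → R)).le ⟨_, rfl⟩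
    · rintro ⟨v, hv⟩
      obtain ⟨a, rfl⟩ := (Fintype.range_linearCombination (α := Fin m) R
        (x : Fin m → Fin n → R)).ge hv
      ext1
      change Fintype.linearCombination R x _ = Fintype.linearCombination R x a
      congr 1
      ext j
      have : ∀ i, x i (c j) = (1 : Matrix (Fin m) (Fin m) R) i j := fun i => by rw [← hc]; rfl
      change (∑ i, a i • (x i : Fin n → R)) (c j) = a j
      simp [Finset.sum_apply, this, Matrix.one_apply]
  rank_eq p := by
    have := p.nontrivial
    obtain ⟨c, hc⟩ := hx
    have hli : LinearIndependent R x := by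
      refine Fintype.linearIndependent_iff.2 fun g hg j => ?_
      have h1 := congrFun hg (c j)
      have : ∀ i, x i (c j) = (1 : Matrix (Fin m) (Fin m) R) i j := fun i => by rw [← hc]; rfl
      simpa [this, Matrix.one_apply] using h1
    have e := (Module.Basis.span hli).equivFun
    rw [Module.rankAtStalk_eq_of_equiv e, Module.rankAtStalk_eq_finrank_of_free]
    simp

/-- The matrix `P` records a projection onto `M` in coordinates. It serves to show, through
`exists_minor_notMem`, that the maximal minors of `y` generate the unit ideal. -/
lemma exists_matrix_of_basis {R : Type*} [CommRing R] {M : Submodule R (Fin n → R)}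
    (hM : IsComplemented M) (b : Module.Basis (Fin m) R M) :
    ∃ (y : Matrix (Fin m) (Fin n) R) (P : Matrix (Fin n) (Fin m) R), y * P = 1 ∧
      Submodule.span R (Set.range y) = M := by
  obtain ⟨N, h⟩ := hM
  refine ⟨Matrix.of fun i => (b i).1,
    Matrix.of fun k j => b.repr (M.projectionOnto N h (Pi.single k 1)) j, ?_, ?_⟩
  · ext i j
    have h1 : M.projectionOnto N h (b i).1 = b i := by simp
    have h2 : (b i).1 = ∑ k, (b i).1 k • (Pi.single k 1 : Fin n → R) := by
      ext l; simp [Finset.sum_apply, Pi.single_apply]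
    have h3 := congrArg (fun z => b.repr z j) h1
    rw [h2] at h3
    simp only [map_sum, map_smul, Finsupp.finsetSum_apply, Finsupp.smul_apply, smul_eq_mul,
      Module.Basis.repr_self] at h3
    rw [Matrix.mul_apply, Matrix.one_apply]
    refine Eq.trans ?_ (h3.trans (Finsupp.single_apply))
    rfl
  · have h1 : Set.range (Matrix.of fun i => (b i).1 : Matrix (Fin m) (Fin n) R) =
        M.subtype '' Set.range b := by
      rw [← Set.range_comp]; rfl
    rw [h1, ← Submodule.map_span, b.span_eq, Submodule.map_top, Submodule.range_subtype]

lemma exists_matrix_of_free {R : Type u} [CommRing R] (M : Summand m n R)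
    (hM : Module.Free R M.carrier) :
    ∃ (y : Matrix (Fin m) (Fin n) R) (P : Matrix (Fin n) (Fin m) R), y * P = 1 ∧
      Submodule.span R (Set.range y) = M.carrier := by
  -- Over the zero ring the spectrum is empty and the rank condition carries no information, but any
  -- matrices will do.
  rcases subsingleton_or_nontrivial R with hR | hR
  · exact ⟨0, 0, Subsingleton.elim _ _, SetLike.ext fun x => by
      rw [Subsingleton.elim x 0]; simp⟩
  · obtain ⟨p⟩ : Nonempty (PrimeSpectrum R) := inferInstance
    obtain ⟨N, h⟩ := M.isComplemented
    have := finite_of_isCompl h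
    have hrank := M.rank_eq p
    rw [Module.rankAtStalk_eq_finrank_of_free] at hrank
    exact exists_matrix_of_basis M.isComplemented (Module.finBasisOfFinrankEq R M.carrier hrank)

lemma exists_free_away {R : Type u} [CommRing R] (M : Summand m n R) (p : PrimeSpectrum R) :
    ∃ a ∉ p.asIdeal, Module.Free (Localization.Away a)
      (push (algebraMap R (Localization.Away a)) M.carrier) := by
  obtain ⟨N, h⟩ := M.isComplemented
  have := finite_of_isCompl h
  have := projective_of_isCompl h
  obtain ⟨a, ha, hfree⟩ := Module.Free.away_of_finite_of_flat_of_rankAtStalk_constant M.carrier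
    p.asIdeal fun q _ => by rw [M.rank_eq, M.rank_eq]
  refine ⟨a, ha, ?_⟩
  have e := (IsLocalizedModule.isBaseChange (Submonoid.powers a) (Localization.Away a)
    (LocalizedModule.mkLinearMap (Submonoid.powers a) M.carrier)).equiv
  exact Module.Free.of_equiv (e.symm.trans (pushEquiv h))

lemma push_span_range {R T : Type*} [CommRing R] [CommRing T] (δ : R →+* T)
    (x : Matrix (Fin m) (Fin n) R) :
    push δ (Submodule.span R (Set.range x)) = Submodule.span T (Set.range (x.map δ)) := by
  apply le_antisymm
  · refine Submodule.span_le.2 ?_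
    rintro _ ⟨v, hv, rfl⟩
    change (fun i => δ (v i)) ∈ _
    induction hv using Submodule.span_induction with
    | mem v h =>
      obtain ⟨i, rfl⟩ := h
      exact Submodule.subset_span ⟨i, rfl⟩
    | zero => simp only [Pi.zero_apply, map_zero]; exact Submodule.zero_mem _
    | add v w _ _ hv hw => simpa using! Submodule.add_mem _ hv hw
    | smul a v _ hv => simpa using! Submodule.smul_mem _ (δ a) hv
  · refine Submodule.span_le.2 ?_
    rintro _ ⟨i, rfl⟩
    exact Submodule.subset_span ⟨x i, Submodule.subset_span ⟨i, rfl⟩, rfl⟩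

lemma exists_submatrix_map {R T : Type*} [CommRing R] [CommRing T] (δ : R →+* T)
    {x : Matrix (Fin m) (Fin n) R} (hx : ∃ c : Fin m → Fin n, x.submatrix id c = 1) :
    ∃ c : Fin m → Fin n, (x.map δ).submatrix id c = 1 := by
  obtain ⟨c, hc⟩ := hx
  refine ⟨c, ?_⟩
  rw [Matrix.submatrix_map, hc, Matrix.map_one _ (map_zero δ) (map_one δ)]

variable (K m n) in
/-- The functor of points of the disjoint union of the standard charts of the Grassmannian. -/
def spanCharts : CommAlgCat.{u} K ⥤ Type u where
  obj R := {x : Matrix (Fin m) (Fin n) R // ∃ c : Fin m → Fin n, x.submatrix id c = 1}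
  map δ := ↾(fun x => ⟨x.1.map δ.hom, exists_submatrix_map δ.hom.toRingHom x.2⟩)
  map_id _ := rfl
  map_comp _ _ := rfl

variable (K m n) in
/-- The atlas of the Grassmannian. -/
def spanMap : spanCharts K m n ⟶ grassmannian K m n where
  app R := ↾(fun x => spanSummand x.1 x.2)
  naturality R T δ := by
    ext x
    refine Summand.ext ?_
    exact (push_span_range δ.hom.toRingHom x.1).symm

/-- After localising, the summand has a basis; after localising again, a maximal minor of the basis
matrix is invertible, and multiplying by its inverse normalises the matrix without changing the row
span. -/
lemma isLocallySurj_spanMap : IsLocallySurj (spanMap K m n) := by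
  refine IsLocallySurj.of_locally fun R M p => ?_
  obtain ⟨a, ha, hfree⟩ := exists_free_away M p
  refine ⟨a, ha, fun q => ?_⟩
  obtain ⟨y, P, hyP, hy⟩ := exists_matrix_of_free ((grassmannian K m n).map (toAway R a) M) hfree
  obtain ⟨c, hc⟩ := exists_minor_notMem y P hyP q.asIdeal q.isPrime.ne_top
  refine ⟨_, hc, ?_⟩
  let δ := toAway (away R a) (y.submatrix id c).det
  let A := (y.map δ.hom).submatrix id c
  have hA : IsUnit A.det := by
    have h1 : A.det = δ.hom (y.submatrix id c).det := by
      refine ((RingHom.map_det δ.hom.toRingHom _).trans ?_).symm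
      rfl
    rw [h1]
    exact isUnit_toAway _ _
  have hx : (A⁻¹ * y.map δ.hom).submatrix id c = 1 := by
    rw [← Matrix.nonsing_inv_mul A hA]
    ext i j
    simp [Matrix.mul_apply, A]
  refine ⟨⟨_, c, hx⟩, Summand.ext ?_⟩
  change Submodule.span _ (Set.range (A⁻¹ * y.map δ.hom)) = push δ.hom.toRingHom _
  rw [span_range_mul (Matrix.isUnit_nonsing_inv_det_iff.2 hA), ← hy]
  exact (push_span_range δ.hom.toRingHom y).symm

end

section

variable {K : Type u} [Field K] {m n : ℕ}

/-! ### The Plücker transformation -/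

variable (K m n) in
/-- The dual of the exterior power `⋀^m K^n`. -/
abbrev DualWedge : Type u := Module.Dual K (⋀[K]^m (Fin n → K))

lemma pluckerForm_tmap {R T : CommAlgCat.{u} K} (ε : R ⟶ T) (x : Matrix (Fin m) (Fin n) R)
    (z : R ⊗[K] DualWedge K m n) :
    pluckerForm K (x.map ε.hom) (tmap _ ε z) = ε.hom (pluckerForm K x z) := by
  induction z using tensor_induction_basis (minorBasis K m n) with
  | h0 => simp
  | hadd x y hx hy => simp only [map_add, hx, hy]
  | hb r s =>
    rw [tmap_smul, map_smul, map_smul, smul_eq_mul, smul_eq_mul, map_mul]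
    congr 1
    have : tmap (DualWedge K m n) ε ((1 : R) ⊗ₜ minorBasis K m n s) =
      (1 : T) ⊗ₜ minorBasis K m n s := by simp
    rw [this, minorBasis_apply, pluckerForm_minor, pluckerForm_minor]
    exact (RingHom.map_det ε.hom.toRingHom _).symm

lemma pluckerForm_surjective {R : Type*} [CommRing R] [Algebra K R] {x : Matrix (Fin m) (Fin n) R}
    (hx : ∃ c : Fin m → Fin n, x.submatrix id c = 1) : Function.Surjective (pluckerForm K x) := by
  obtain ⟨c, hc⟩ := hx
  refine fun r => ⟨r • (1 ⊗ₜ minor K c), ?_⟩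
  rw [map_smul, pluckerForm_minor, hc, Matrix.det_one, smul_eq_mul, mul_one]

variable (K m n) in
/-- The Plücker morphism on the charts of the Grassmannian. -/
def pluckerChart : spanCharts K m n ⟶ projectivization (K := K) (DualWedge K m n) where
  app R := ↾(fun x => kerPoint (pluckerForm K x.1) (pluckerForm_surjective x.2))
  naturality R T δ := by
    ext x
    refine Eq.symm (Grassmannian.eq_of_le ?_)
    refine (projectivization_map _ δ _).trans_le ?_
    refine Submodule.span_le.2 ?_
    rintro _ ⟨z, hz, rfl⟩
    change pluckerForm K (x.1.map δ.hom) (tmap _ δ z) = 0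
    rw [pluckerForm_tmap, show pluckerForm K x.1 z = 0 from hz, map_zero]

lemma ker_pluckerForm_eq_of_span_eq {R : Type*} [CommRing R] [Algebra K R]
    {x y : Matrix (Fin m) (Fin n) R}
    (h : Submodule.span R (Set.range x) = Submodule.span R (Set.range y)) :
    LinearMap.ker (pluckerForm K x) = LinearMap.ker (pluckerForm K y) := by
  rw [← ker_pluckerMap_span, h, ker_pluckerMap_span]

-- The Plücker form of a matrix defines the map on charts. It descends because its kernel depends
-- only on the row span, by `ker_pluckerMap_span`.
variable (K m n) in
lemma exists_pluckerHom : ∃ η : grassmannian K m n ⟶ projectivization (K := K) (DualWedge K m n),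
    spanMap K m n ≫ η = pluckerChart K m n := by
  refine exists_desc_of_isLocallySurj _ _ isLocallySurj_spanMap
    (isZariskiSheaf_projectivization _) fun R x y h => ?_
  refine Module.Grassmannian.ext ?_
  exact ker_pluckerForm_eq_of_span_eq (congrArg Summand.carrier h)

variable (K m n) in
/-- The Plücker transformation. -/
def pluckerHom : grassmannian K m n ⟶ projectivization (K := K) (DualWedge K m n) :=
  (exists_pluckerHom K m n).choose

lemma pluckerHom_spanMap {R : CommAlgCat.{u} K} (x : (spanCharts K m n).obj R) :
    (pluckerHom K m n).app R ((spanMap K m n).app R x) = (pluckerChart K m n).app R x :=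
  congrArg (fun η : spanCharts K m n ⟶ projectivization (K := K) (DualWedge K m n) => η.app R x)
    (exists_pluckerHom K m n).choose_spec

lemma range_wedgeMap_push {R T : CommAlgCat.{u} K} (ε : R ⟶ T) (M : Submodule R (Fin n → R)) :
    LinearMap.range (wedgeMap m K (push ε.hom.toRingHom M)) =
      Submodule.span T (tmap (⋀[K]^m (Fin n → K)) ε ''
        (LinearMap.range (wedgeMap m K M) : Set (R ⊗[K] (⋀[K]^m (Fin n → K))))) := by
  have hM : LinearMap.range (wedgeMap m K M) =
      Submodule.span R ((fun x : Fin m → Fin n → R => wedgeEquiv m n R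
        (exteriorPower.ιMulti R m x)) '' {x | ∀ j, x j ∈ (M : Set (Fin n → R))}) := by
    have := range_wedgeMap K m (M : Set (Fin n → R))
    rwa [Submodule.span_eq] at this
  have hb : ∀ x : Fin m → Fin n → R,
      wedgeEquiv (K := K) m n T (exteriorPower.ιMulti T m (fun j i => ε.hom (x j i))) =
        tmap _ ε (wedgeEquiv m n R (exteriorPower.ιMulti R m x)) := fun x =>
    wedgeEquiv_baseChange m ε.hom x
  rw [push, range_wedgeMap, hM]
  apply le_antisymm
  · refine Submodule.span_le.2 ?_
    rintro _ ⟨x, hx, rfl⟩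
    choose y hy hyx using hx
    obtain rfl : (fun j i => ε.hom (y j i)) = x := funext hyx
    refine Submodule.subset_span ⟨_, Submodule.subset_span ⟨y, hy, rfl⟩, (hb y).symm⟩
  · refine Submodule.span_le.2 ?_
    rintro _ ⟨w, hw, rfl⟩
    induction hw using Submodule.span_induction with
    | mem z hz =>
      obtain ⟨y, hy, rfl⟩ := hz
      exact Submodule.subset_span ⟨fun j i => ε.hom (y j i), fun j => ⟨y j, hy j, rfl⟩, hb y⟩
    | zero => rw [map_zero]; exact Submodule.zero_mem _
    | add x y _ _ hx hy => rw [map_add]; exact Submodule.add_mem _ hx hy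
    | smul a x _ hx =>
      change tmap _ ε (a • x) ∈ _
      rw [tmap_smul]
      exact Submodule.smul_mem _ _ hx

lemma pairing_tmap {R T : CommAlgCat.{u} K} (ε : R ⟶ T) (z : R ⊗[K] DualWedge K m n)
    (w : R ⊗[K] (⋀[K]^m (Fin n → K))) :
    pairing K m n T (tmap _ ε z) (tmap _ ε w) = ε.hom (pairing K m n R z w) := by
  induction z using TensorProduct.induction_on with
  | zero => simp
  | add x y hx hy => simp only [map_add, LinearMap.add_apply, hx, hy]
  | tmul r ξ =>
    induction w using TensorProduct.induction_on with
    | zero => simp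
    | add x y hx hy => simp only [map_add, hx, hy]
    | tmul s v =>
      rw [LinearMap.rTensor_tmul, LinearMap.rTensor_tmul, pairing_tmul, pairing_tmul]
      simp

lemma mem_ker_pluckerMap_of_locally {R : CommAlgCat.{u} K} {M : Submodule R (Fin n → R)}
    {z : R ⊗[K] DualWedge K m n}
    (h : ∀ p : PrimeSpectrum R, ∃ f : R, f ∉ p.asIdeal ∧ tmap _ (toAway R f) z ∈
      LinearMap.ker (pluckerMap m K (push (toAway R f).hom.toRingHom M))) :
    z ∈ LinearMap.ker (pluckerMap m K M) := by
  rw [mem_ker_pluckerMap]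
  intro w hw
  refine eq_zero_of_locally fun p => ?_
  obtain ⟨f, hf, hz⟩ := h p
  refine ⟨f, hf, ?_⟩
  rw [mem_ker_pluckerMap] at hz
  rw [← toAway_apply, ← pairing_tmap]
  refine hz _ ?_
  rw [range_wedgeMap_push]
  exact Submodule.subset_span ⟨w, hw, rfl⟩

lemma tmap_mem_ker_pluckerMap {R T : CommAlgCat.{u} K} (ε : R ⟶ T) {M : Submodule R (Fin n → R)}
    {z : R ⊗[K] DualWedge K m n} (hz : z ∈ LinearMap.ker (pluckerMap m K M)) :
    tmap _ ε z ∈ LinearMap.ker (pluckerMap m K (push ε.hom.toRingHom M)) := by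
  rw [mem_ker_pluckerMap] at hz ⊢
  intro w hw
  rw [range_wedgeMap_push] at hw
  induction hw using Submodule.span_induction with
  | mem w hw =>
    obtain ⟨w, hw, rfl⟩ := hw
    rw [pairing_tmap, hz w hw, map_zero]
  | zero => rw [map_zero]
  | add x y _ _ hx hy => rw [map_add, hx, hy, add_zero]
  | smul a x _ hx => rw [map_smul, hx, smul_zero]

lemma mem_projectivization_of_locally {V : Type u} [AddCommGroup V] [Module K V]
    {R : CommAlgCat.{u} K} {y : (projectivization (K := K) V).obj R} {z : R ⊗[K] V}
    (h : ∀ p : PrimeSpectrum R, ∃ f : R, f ∉ p.asIdeal ∧ tmap _ (toAway R f) z ∈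
      Module.Grassmannian.toSubmodule ((projectivization (K := K) V).map (toAway R f) y)) :
    z ∈ Module.Grassmannian.toSubmodule y := by
  obtain ⟨ι, _, f, hf, h⟩ := exists_finite_cover h
  refine Submodule.mem_of_span_eq_top_of_smul_pow_mem _ (Set.range f) hf z ?_
  rintro ⟨_, i, rfl⟩
  refine exists_pow_smul_mem_of_tmap_mem V _ ?_
  have := h i
  rwa [projectivization_map] at this

/-- The transformation is defined by gluing, whereas `pluckerMap` is global. Both submodules are
detected locally, and on a chart both are the kernel of the Plücker form of a matrix. -/
lemma pluckerHom_toSubmodule {R : CommAlgCat.{u} K} (M : (grassmannian K m n).obj R) :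
    Module.Grassmannian.toSubmodule ((pluckerHom K m n).app R M) =
      LinearMap.ker (pluckerMap m K (Summand.carrier M)) := by
  have hloc : ∀ p : PrimeSpectrum R, ∃ f : R, f ∉ p.asIdeal ∧
      Module.Grassmannian.toSubmodule ((projectivization (K := K) (DualWedge K m n)).map
        (toAway R f) ((pluckerHom K m n).app R M)) =
      LinearMap.ker (pluckerMap m K (push (toAway R f).hom.toRingHom (Summand.carrier M))) := by
    intro p
    obtain ⟨f, hf, x, hx⟩ := isLocallySurj_spanMap R M p
    refine ⟨f, hf, ?_⟩
    rw [← app_map_apply, ← hx, pluckerHom_spanMap]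
    have h1 : push (toAway R f).hom.toRingHom (Summand.carrier M) =
        Submodule.span (away R f) (Set.range x.1) := (congrArg Summand.carrier hx).symm
    rw [h1, ker_pluckerMap_span]
    rfl
  ext z
  constructor
  · intro hz
    refine mem_ker_pluckerMap_of_locally fun p => ?_
    obtain ⟨f, hf, h⟩ := hloc p
    refine ⟨f, hf, ?_⟩
    rw [← h]
    exact tmap_mem_projectivization_map _ _ _ hz
  · intro hz
    refine mem_projectivization_of_locally fun p => ?_
    obtain ⟨f, hf, h⟩ := hloc p
    refine ⟨f, hf, ?_⟩
    rw [h]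
    exact tmap_mem_ker_pluckerMap _ hz

lemma baseChange_dual_surjective (V : Type*) [AddCommGroup V] [Module K V] [Module.Finite K V]
    (R : Type*) [CommRing R] [Algebra K R] :
    Function.Surjective ((Module.Dual.baseChange (R := K) (V := V) R).liftBaseChange R) := by
  intro φ
  let b := Module.finBasis K V
  refine ⟨∑ i, φ (1 ⊗ₜ b i) ⊗ₜ b.coord i, (b.baseChange R).ext fun j => ?_⟩
  rw [Module.Basis.baseChange_apply, map_sum, LinearMap.sum_apply]
  simp [Finsupp.single_apply]

/-- A projection onto `M` extends every linear form from `⋀^m M` to `⋀^m R^n`. -/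
lemma pluckerMap_surjective {R : Type*} [CommRing R] [Algebra K R] {M : Submodule R (Fin n → R)}
    (hM : IsComplemented M) : Function.Surjective (pluckerMap m K M) := by
  refine Function.Surjective.comp (g := (wedgeMap m K M).dualMap) ?_ (baseChange_dual_surjective _ R)
  obtain ⟨N, h⟩ := hM
  intro g
  refine ⟨g ∘ₗ exteriorPower.map m (M.projectionOnto N h) ∘ₗ (wedgeEquiv m n R).symm.toLinearMap, ?_⟩
  ext1
  ext ω
  simp only [wedgeMap, LinearMap.compAlternatingMap_apply, LinearMap.dualMap_apply,
    LinearMap.comp_apply, LinearEquiv.coe_coe, LinearEquiv.symm_apply_apply,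
    exteriorPower.map_apply_ιMulti]
  congr 2
  ext i
  simp

end

section

variable {K : Type u} [Field K] {m n : ℕ}

/-! ### The Plücker transformation is a closed immersion -/

lemma minor_eq_zero {c : Fin m → Fin n} {i j : Fin m} (hij : i ≠ j) (h : c i = c j) :
    minor K c = 0 := by
  ext1
  ext v
  rw [LinearMap.compAlternatingMap_apply, minor_ιMulti]
  exact Matrix.det_zero_of_column_eq hij fun k => by simp [h]

/-- The matrix whose entries are the values of a linear form on the minors differing from the minor
with columns `c` in one column. -/
def adjacentMinors {R : Type*} [CommRing R] [Algebra K R] (c : Fin m → Fin n)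
    (φ : R ⊗[K] DualWedge K m n →ₗ[R] R) : Matrix (Fin m) (Fin n) R :=
  Matrix.of fun i k => φ (1 ⊗ₜ minor K (Function.update c i k))

/-- Off the diagonal the new column repeats another one and the minor vanishes; on the diagonal
nothing is replaced. -/
lemma adjacentMinors_submatrix {R : Type*} [CommRing R] [Algebra K R] {c : Fin m → Fin n}
    {φ : R ⊗[K] DualWedge K m n →ₗ[R] R} (hφ : φ (1 ⊗ₜ minor K c) = 1) :
    (adjacentMinors c φ).submatrix id c = 1 := by
  ext i j
  change φ (1 ⊗ₜ minor K (Function.update c i (c j))) = _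
  by_cases hij : i = j
  · subst hij
    rw [Function.update_eq_self, hφ, Matrix.one_apply_eq]
  · rw [minor_eq_zero hij (by simp [Function.update_of_ne (Ne.symm hij)]), TensorProduct.tmul_zero,
      map_zero, Matrix.one_apply_ne hij]

lemma adjacentMinors_evalAt {R T : CommAlgCat.{u} K} (ε : R ⟶ T) (c : Fin m → Fin n)
    (a : Set.powersetCard (Fin n) m → R) :
    adjacentMinors c (evalAt (minorBasis K m n) T fun s => ε.hom (a s)) =
      (adjacentMinors c (evalAt (minorBasis K m n) R a)).map ε.hom := by
  ext i k
  refine Eq.trans ?_ (evalAt_tmap (minorBasis K m n) ε a _)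
  change evalAt (minorBasis K m n) T _ (1 ⊗ₜ _) = _
  rw [LinearMap.rTensor_tmul]
  congr 2
  exact (map_one ε.hom).symm

/-- On charts, `eq_pluckerForm` recovers the row span from the Plücker form up to a factor: both
matrices span the rows of the same matrix of adjacent minors. -/
lemma pluckerHom_injective (R : CommAlgCat.{u} K) :
    Function.Injective ((pluckerHom K m n).app R) := by
  refine injective_of_atlas isLocallySurj_spanMap isZariskiSheaf_grassmannian _ ?_ R
  intro R x y h
  rw [pluckerHom_spanMap, pluckerHom_spanMap] at h
  have hker : LinearMap.ker (pluckerForm K x.1) = LinearMap.ker (pluckerForm K y.1) :=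
    congrArg (fun H : Module.Grassmannian R (R ⊗[K] DualWedge K m n) 1 => H.toSubmodule) h
  obtain ⟨c, hc⟩ := x.2
  obtain ⟨c', hc'⟩ := y.2
  have h1 : pluckerForm K x.1 (1 ⊗ₜ minor K c) = 1 := by
    rw [pluckerForm_minor, hc, Matrix.det_one]
  refine Summand.ext ?_
  exact (eq_pluckerForm _ c c h1 x.1 hc rfl).2.trans (eq_pluckerForm _ c c' h1 y.1 hc' hker).2.symm

lemma eq_zero_of_locally_evalAt {V : Type u} [AddCommGroup V] [Module K V] {σ : Type}
    (b : Module.Basis σ K V) {R : CommAlgCat.{u} K} {φ ψ : R ⊗[K] V →ₗ[R] R}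
    (h : ∀ p : PrimeSpectrum R, ∃ f : R, f ∉ p.asIdeal ∧ ∀ i,
      (toAway R f).hom (φ (1 ⊗ₜ b i)) = (toAway R f).hom (ψ (1 ⊗ₜ b i))) : φ = ψ := by
  refine (b.baseChange R).ext fun i => ?_
  rw [Module.Basis.baseChange_apply, ← sub_eq_zero]
  refine eq_zero_of_locally fun p => ?_
  obtain ⟨f, hf, h⟩ := h p
  refine ⟨f, hf, ?_⟩
  rw [← toAway_apply, map_sub, h i, sub_self]

/-- These are the Plücker relations on the chart where coordinate `c` is `1`. A preimage can only be
the row span of the adjacent minors. Necessity is checked locally, where a preimage is given by a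
matrix. -/
lemma kerPoint_mem_range_pluckerHom {R : CommAlgCat.{u} K} (c : Fin m → Fin n)
    (a : Set.powersetCard (Fin n) m → R)
    (hsurj : Function.Surjective (evalAt (minorBasis K m n) R a))
    (hc : evalAt (minorBasis K m n) R a (1 ⊗ₜ minor K c) = 1) :
    kerPoint (evalAt (minorBasis K m n) R a) hsurj ∈ Set.range ((pluckerHom K m n).app R) ↔
      evalAt (minorBasis K m n) R a =
        pluckerForm K (adjacentMinors c (evalAt (minorBasis K m n) R a)) := by
  constructor
  · rintro ⟨M, hM⟩
    refine eq_zero_of_locally_evalAt (minorBasis K m n) fun p => ?_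
    obtain ⟨f, hf, x, hx⟩ := isLocallySurj_spanMap R M p
    refine ⟨f, hf, ?_⟩
    let δ := toAway R f
    have hc1 : evalAt (minorBasis K m n) (away R f) (fun s => δ.hom (a s)) (1 ⊗ₜ minor K c) = 1 := by
      have := evalAt_tmap (minorBasis K m n) δ a (1 ⊗ₜ minor K c)
      rw [hc, map_one, LinearMap.rTensor_tmul] at this
      refine Eq.trans ?_ this
      congr 2
      exact (map_one δ.hom).symm
    have hs : Function.Surjective
        (evalAt (minorBasis K m n) (away R f) (fun s => δ.hom (a s))) := fun r =>
      ⟨r • (1 ⊗ₜ minor K c), by rw [map_smul, hc1, smul_eq_mul, mul_one]⟩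
    have hle : (projectivization (K := K) (DualWedge K m n)).map δ
        (kerPoint (evalAt (minorBasis K m n) R a) hsurj) =
        kerPoint (evalAt (minorBasis K m n) (away R f) (fun s => δ.hom (a s))) hs := by
      refine Grassmannian.eq_of_le ?_
      refine (projectivization_map _ δ _).trans_le ?_
      refine Submodule.span_le.2 ?_
      rintro _ ⟨z, hz, rfl⟩
      change evalAt (minorBasis K m n) (away R f) (fun s => δ.hom (a s)) (tmap _ δ z) = 0
      rw [evalAt_tmap, show evalAt (minorBasis K m n) R a z = 0 from hz, map_zero]
    have h1 : (pluckerChart K m n).app _ x =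
        kerPoint (evalAt (minorBasis K m n) (away R f) (fun s => δ.hom (a s))) hs := by
      rw [← pluckerHom_spanMap, hx, app_map_apply, hM, hle]
    have hker : LinearMap.ker (pluckerForm K x.1) =
        LinearMap.ker (evalAt (minorBasis K m n) (away R f) (fun s => δ.hom (a s))) :=
      congrArg (fun H : Module.Grassmannian _ ((away R f) ⊗[K] DualWedge K m n) 1 =>
        H.toSubmodule) h1
    obtain ⟨c', hc'⟩ := x.2
    have h2 : evalAt (minorBasis K m n) (away R f) (fun s => δ.hom (a s)) =
        pluckerForm K (adjacentMinors c
          (evalAt (minorBasis K m n) (away R f) (fun s => δ.hom (a s)))) :=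
      (eq_pluckerForm _ c c' hc1 x.1 hc' hker.symm).1
    intro s
    have ht : (1 : away R f) ⊗ₜ[K] minorBasis K m n s = tmap _ δ ((1 : R) ⊗ₜ minorBasis K m n s) := by
      simp
    change δ.hom _ = δ.hom _
    rw [← evalAt_tmap, ← pluckerForm_tmap, ← adjacentMinors_evalAt, ← ht]
    exact LinearMap.congr_fun h2 _
  · intro h
    refine ⟨(spanMap K m n).app R ⟨_, c, adjacentMinors_submatrix hc⟩, ?_⟩
    refine (pluckerHom_spanMap _).trans (Module.Grassmannian.ext ?_)
    exact congrArg LinearMap.ker h.symm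

lemma isClosedSubfunctor_range_pluckerHom :
    IsClosedSubfunctor (Subfunctor.range (pluckerHom K m n)) := by
  refine isClosedSubfunctor_range _ isZariskiSheaf_grassmannian (isZariskiSheaf_projectivization _)
    pluckerHom_injective fun R y p => ?_
  let b := minorBasis K m n
  obtain ⟨f, hf, ⟨⟨⟨s⟩, a⟩, ha⟩, hy⟩ := isLocallySurj_chartMap b R y p
  let c : Fin m → Fin n := Set.powersetCard.ofFinEmbEquiv.symm s
  let φ := evalAt b (away R f) a
  -- The equations compare the two linear forms on the basis of minors; both forms commute with base
  -- change, so the same ideal decides the question over every algebra.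
  refine ⟨f, hf, Ideal.span (Set.range fun t =>
    φ (1 ⊗ₜ b t) - pluckerForm K (adjacentMinors c φ) (1 ⊗ₜ b t)), fun T ε => ?_⟩
  have ha' : ε.hom (a s) = 1 := by rw [show a s = 1 from ha, map_one]
  have hs := evalAt_surjective b (fun t => ε.hom (a t)) ha'
  have h1 : (projectivization (K := K) (DualWedge K m n)).map ε
      ((projectivization (K := K) (DualWedge K m n)).map (toAway R f) y) =
      kerPoint (evalAt b T fun t => ε.hom (a t)) hs := by
    rw [← hy]
    exact (app_map_apply (chartMap b) ε _).symm
  have hc : evalAt b T (fun t => ε.hom (a t)) (1 ⊗ₜ minor K c) = 1 := by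
    rw [← minorBasis_apply, evalAt_basis, ha']
  rw [h1]
  refine (kerPoint_mem_range_pluckerHom c _ hs hc).trans ?_
  rw [adjacentMinors_evalAt, Ideal.span_le]
  have ht : ∀ t, (1 : T) ⊗ₜ[K] b t = tmap _ ε ((1 : away R f) ⊗ₜ b t) := fun t => by simp
  constructor
  · rintro h _ ⟨t, rfl⟩
    change ε.hom _ = 0
    have := LinearMap.congr_fun h (1 ⊗ₜ b t)
    rw [ht, evalAt_tmap, pluckerForm_tmap] at this
    rw [map_sub, sub_eq_zero]
    exact this
  · intro h
    refine (b.baseChange T).ext fun t => ?_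
    rw [Module.Basis.baseChange_apply, ht, evalAt_tmap, pluckerForm_tmap, ← sub_eq_zero, ← map_sub]
    exact h ⟨t, rfl⟩

end

section quotient

variable {K : Type u} [Field K] {V W : Type u} [AddCommGroup V] [Module K V] [AddCommGroup W]
  [Module K W] (ρ : V →ₗ[K] W) (hρ : Function.Surjective ρ)

/-! ### Projectivizations of quotients -/

include hρ in
lemma surjective_baseChange (R : Type*) [CommRing R] [Algebra K R] :
    Function.Surjective (ρ.baseChange R) :=
  LinearMap.lTensor_surjective R hρ

lemma baseChange_tmap {R T : CommAlgCat.{u} K} (ε : R ⟶ T)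
    (z : R ⊗[K] V) :
    ρ.baseChange T (tmap _ ε z) = tmap _ ε (ρ.baseChange R z) := by
  induction z using TensorProduct.induction_on with
  | zero => simp
  | add x y hx hy => simp only [map_add, hx, hy]
  | tmul r ξ => rfl

lemma exists_lTensor_subtype_ker_eq {S M M' : Type*} (T : Type*) [CommRing S] [AddCommGroup M]
    [Module S M] [AddCommGroup M'] [Module S M'] [AddCommGroup T] [Module S T] (f : M →ₗ[S] M')
    (hf : Function.Surjective f) (x : T ⊗[S] M) (hx : LinearMap.lTensor T f x = 0) :
    ∃ z, LinearMap.lTensor T (LinearMap.ker f).subtype z = x :=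
  (lTensor_exact T (LinearMap.exact_subtype_ker_map f) hf x).1 hx

/-- The isomorphism `M / ρ⁻¹(H) ≅ M' / H` for a surjective linear map `ρ`. -/
def quotientComapEquiv {R M M' : Type*} [CommRing R] [AddCommGroup M] [Module R M]
    [AddCommGroup M'] [Module R M'] (ρ : M →ₗ[R] M') (hρ : Function.Surjective ρ)
    (H : Submodule R M') : (M ⧸ H.comap ρ) ≃ₗ[R] M' ⧸ H :=
  (Submodule.quotEquivOfEq _ _ (by rw [LinearMap.ker_comp, Submodule.ker_mkQ])).trans
    ((H.mkQ ∘ₗ ρ).quotKerEquivOfSurjective (H.mkQ_surjective.comp hρ))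

/-- The transform of a point of the Grassmannian under a surjective linear map. -/
def comapPoint {R M M' : Type*} [CommRing R] [AddCommGroup M] [Module R M] [AddCommGroup M']
    [Module R M'] {d : ℕ} (ρ : M →ₗ[R] M') (hρ : Function.Surjective ρ)
    (H : Module.Grassmannian R M' d) : Module.Grassmannian R M d where
  toSubmodule := H.toSubmodule.comap ρ
  finite_quotient :=
    have := H.finite_quotient
    Module.Finite.equiv (quotientComapEquiv ρ hρ H.toSubmodule).symm
  projective_quotient :=
    have := H.projective_quotient
    Module.Projective.of_equiv (quotientComapEquiv ρ hρ H.toSubmodule).symm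
  rankAtStalk_eq p := by
    rw [Module.rankAtStalk_eq_of_equiv (quotientComapEquiv ρ hρ H.toSubmodule), H.rankAtStalk_eq]

/-- The transformation `ℙ(W) → ℙ(V)` induced by a surjection `V → W`. -/
def quotientHom : projectivization (K := K) W ⟶
    projectivization (K := K) V where
  app R := ↾(fun y => comapPoint (ρ.baseChange R)
    (surjective_baseChange ρ hρ R) y)
  naturality R T δ := by
    ext y
    refine Eq.symm (Grassmannian.eq_of_le ?_)
    refine (projectivization_map _ δ _).trans_le ?_
    refine Submodule.span_le.2 ?_
    rintro _ ⟨z, hz, rfl⟩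
    change ρ.baseChange T (tmap _ δ z) ∈ Module.Grassmannian.toSubmodule
      ((projectivization (K := K) W).map δ y)
    rw [baseChange_tmap]
    exact tmap_mem_projectivization_map _ δ y hz

lemma quotientHom_injective (R : CommAlgCat.{u} K) :
    Function.Injective ((quotientHom ρ hρ).app R) := by
  intro y y' h
  refine Module.Grassmannian.ext ?_
  exact Submodule.comap_injective_of_surjective (surjective_baseChange ρ hρ R)
    (congrArg (fun H : Module.Grassmannian R (R ⊗[K] V) 1 => H.toSubmodule) h)

/-- By right exactness the kernel of the base change of `ρ` is generated by the elements `1 ⊗ ξ`. A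
submodule that contains this kernel is the preimage of its image. -/
lemma mem_range_quotientHom {R : CommAlgCat.{u} K}
    (y : (projectivization (K := K) V).obj R) :
    y ∈ Set.range ((quotientHom ρ hρ).app R) ↔
      ∀ ξ ∈ LinearMap.ker ρ,
        (1 : R) ⊗ₜ[K] ξ ∈ Module.Grassmannian.toSubmodule y := by
  let ρR := ρ.baseChange R
  have hρR : Function.Surjective ρR := surjective_baseChange ρ hρ R
  constructor
  · rintro ⟨y, rfl⟩ ξ hξ
    change ρR (1 ⊗ₜ ξ) ∈ Module.Grassmannian.toSubmodule y
    rw [LinearMap.baseChange_tmul, LinearMap.mem_ker.1 hξ, TensorProduct.tmul_zero]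
    exact Submodule.zero_mem _
  · intro h
    have hker : LinearMap.ker ρR ≤ Module.Grassmannian.toSubmodule y := by
      intro z hz
      obtain ⟨w, rfl⟩ := exists_lTensor_subtype_ker_eq R ρ hρ z hz
      clear hz
      induction w using TensorProduct.induction_on with
      | zero => rw [map_zero]; exact Submodule.zero_mem _
      | add x y hx hy => rw [map_add]; exact Submodule.add_mem _ hx hy
      | tmul r ξ =>
        have h1 : LinearMap.lTensor R (LinearMap.ker ρ).subtype (r ⊗ₜ ξ) =
            r • ((1 : R) ⊗ₜ[K] ξ.1) := by
          rw [LinearMap.lTensor_tmul, TensorProduct.smul_tmul', smul_eq_mul, mul_one]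
          rfl
        rw [h1]
        exact Submodule.smul_mem _ _ (h _ ξ.2)
    have hcm : ((Module.Grassmannian.toSubmodule y).map ρR).comap ρR =
        Module.Grassmannian.toSubmodule y := Submodule.comap_map_eq_self hker
    have e := (Submodule.quotEquivOfEq _ _ hcm).symm.trans
      (quotientComapEquiv ρR hρR ((Module.Grassmannian.toSubmodule y).map ρR))
    have := Module.Grassmannian.finite_quotient y
    have := Module.Grassmannian.projective_quotient y
    let H : Module.Grassmannian R (R ⊗[K] W) 1 :=
      { toSubmodule := (Module.Grassmannian.toSubmodule y).map ρR
        finite_quotient := Module.Finite.equiv e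
        projective_quotient := Module.Projective.of_equiv e
        rankAtStalk_eq := fun p => by
          rw [← Module.rankAtStalk_eq_of_equiv e]
          exact Module.Grassmannian.rankAtStalk_eq y p }
    exact ⟨H, Module.Grassmannian.ext hcm⟩

lemma isClosedSubfunctor_range_quotientHom [Module.Finite K V] [Module.Finite K W] :
    IsClosedSubfunctor (Subfunctor.range (quotientHom ρ hρ)) := by
  refine isClosedSubfunctor_range _ (isZariskiSheaf_projectivization _)
    (isZariskiSheaf_projectivization _) (quotientHom_injective ρ hρ) fun R y p => ?_
  let b := Module.finBasis K V
  obtain ⟨f, hf, ⟨⟨⟨s⟩, a⟩, ha⟩, hy⟩ := isLocallySurj_chartMap b R y p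
  -- On a chart the condition is that a linear form vanishes on `ker ρ`, so its values there
  -- generate the ideal.
  refine ⟨f, hf, Ideal.span ((fun ξ => evalAt b (away R f) a (1 ⊗ₜ ξ)) ''
    (LinearMap.ker ρ : Set V)), fun T ε => ?_⟩
  have ha' : ε.hom (a s) = 1 := by rw [show a s = 1 from ha, map_one]
  have hs := evalAt_surjective b (fun t => ε.hom (a t)) ha'
  have h1 : Module.Grassmannian.toSubmodule ((projectivization (K := K) V).map ε
      ((projectivization (K := K) V).map (toAway R f) y)) =
      LinearMap.ker (evalAt b T fun t => ε.hom (a t)) := by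
    rw [← hy]
    exact congrArg (fun H : Module.Grassmannian T (T ⊗[K] V) 1 => H.toSubmodule)
      (app_map_apply (chartMap b) ε _).symm
  have h2 : ∀ ξ : V, evalAt b T (fun t => ε.hom (a t)) (1 ⊗ₜ ξ) =
      ε.hom (evalAt b (away R f) a (1 ⊗ₜ ξ)) := by
    intro ξ
    rw [← evalAt_tmap]
    congr 1
    simp
  rw [mem_range_quotientHom, h1, Ideal.span_le]
  constructor
  · rintro h _ ⟨ξ, hξ, rfl⟩
    exact (h2 ξ).symm.trans (h ξ hξ)
  · intro h ξ hξ
    exact (h2 ξ).trans (h ⟨ξ, hξ, rfl⟩)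

end quotient

/-! ### The map of projectivizations induced by a subspace. -/

section inclusion

variable {K : Type u} [Field K] {V : Type u} [AddCommGroup V] [Module K V] (U : Submodule K V)

lemma dualMap_subtype_surjective : Function.Surjective U.subtype.dualMap :=
  LinearMap.dualMap_surjective_of_injective U.injective_subtype

/-- The transformation `ℙ(U^*) → ℙ(V^*)` induced by an inclusion `U ⊆ V`. -/
def inclHom : projectivization (K := K) (Module.Dual K U) ⟶
    projectivization (K := K) (Module.Dual K V) :=
  quotientHom U.subtype.dualMap (dualMap_subtype_surjective U)

end inclusion

section invariants

/-! ### Summands generated by invariants -/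

variable {K : Type u} [Field K] {m n : ℕ}

/-- The forms vanishing on `U` include the coordinates of the quotient by `U`, which remain
coordinates after base change. Right exactness then puts an element killed by all of them in the
base change of `U`. -/
lemma mem_baseChange_iff_pairing (U : Submodule K (⋀[K]^m (Fin n → K))) {R : Type*} [CommRing R]
    [Algebra K R] (w : R ⊗[K] (⋀[K]^m (Fin n → K))) :
    w ∈ U.baseChange R ↔
      ∀ ξ ∈ LinearMap.ker U.subtype.dualMap, pairing K m n R (1 ⊗ₜ ξ) w = 0 := by
  constructor
  · intro hw ξ hξ
    rw [Submodule.baseChange_eq_span] at hw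
    induction hw using Submodule.span_induction with
    | mem w hw =>
      obtain ⟨u, hu, rfl⟩ := hw
      have : ξ u = 0 := LinearMap.congr_fun (LinearMap.mem_ker.1 hξ) ⟨u, hu⟩
      change pairing K m n R (1 ⊗ₜ ξ) (1 ⊗ₜ u) = 0
      rw [pairing_tmul, this, map_zero, mul_zero, mul_zero]
    | zero => rw [map_zero]
    | add x y _ _ hx hy => rw [map_add, hx, hy, add_zero]
    | smul a x _ hx => rw [map_smul, hx, smul_zero]
  · intro h
    let b := Module.finBasis K ((⋀[K]^m (Fin n → K)) ⧸ U)
    have h0 : U.mkQ.baseChange R w = 0 := by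
      refine (b.baseChange R).ext_elem fun i => ?_
      have hξ : b.coord i ∘ₗ U.mkQ ∈ LinearMap.ker U.subtype.dualMap := by
        refine LinearMap.mem_ker.2 (LinearMap.ext fun u => ?_)
        have : U.mkQ u.1 = 0 := (Submodule.Quotient.mk_eq_zero _).2 u.2
        change b.coord i (U.mkQ u.1) = 0
        rw [this, map_zero]
      have key : ∀ w : R ⊗[K] (⋀[K]^m (Fin n → K)),
          (b.baseChange R).repr (U.mkQ.baseChange R w) i =
            pairing K m n R (1 ⊗ₜ (b.coord i ∘ₗ U.mkQ)) w := by
        intro w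
        induction w using TensorProduct.induction_on with
        | zero => simp
        | add x y hx hy => simp only [map_add, Finsupp.add_apply, hx, hy]
        | tmul r v =>
          rw [pairing_tmul, one_mul, LinearMap.baseChange_tmul, Module.Basis.baseChange_repr_tmul,
            Algebra.smul_def, mul_comm]
          rfl
      rw [key, h _ hξ, map_zero, Finsupp.zero_apply]
    obtain ⟨z, rfl⟩ := exists_lTensor_subtype_eq R U w h0
    clear h h0
    induction z using TensorProduct.induction_on with
    | zero => rw [map_zero]; exact Submodule.zero_mem _
    | add x y hx hy => rw [map_add]; exact Submodule.add_mem _ hx hy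
    | tmul r u =>
      rw [LinearMap.lTensor_tmul]
      exact Submodule.tmul_mem_baseChange_of_mem r u.2

variable {k : Type v} [Field k] [Algebra k K] (A : Subalgebra k (Matrix (Fin n) (Fin n) K))

lemma exists_sum_of_mem_baseChange {R : Type*} [CommRing R] [Algebra K R]
    {w : R ⊗[K] (⋀[K]^m (Fin n → K))} (hw : w ∈ (invariantWedge A m).baseChange R) :
    ∃ (N : ℕ) (r : Fin N → R) (v : Fin N → Fin m → Fin n → K),
      (∀ i, IsInvariantBasis A (v i)) ∧
      w = ∑ i, r i ⊗ₜ[K] exteriorPower.ιMulti K m (v i) := by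
  rw [invariantWedge, Submodule.baseChange_span] at hw
  obtain ⟨N, r, g, rfl⟩ := Submodule.mem_span_set'.1 hw
  have hg : ∀ i, ∃ v : Fin m → Fin n → K, IsInvariantBasis A v ∧
      (g i).1 = (1 : R) ⊗ₜ[K] exteriorPower.ιMulti K m v := by
    intro i
    obtain ⟨_, ⟨v, hv, rfl⟩, h⟩ := (g i).2
    exact ⟨v, hv, h.symm⟩
  choose v hv hgv using hg
  refine ⟨N, r, v, hv, Finset.sum_congr rfl fun i _ => ?_⟩
  rw [hgv, TensorProduct.smul_tmul', smul_eq_mul, mul_one]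

lemma sum_mem_baseChange {R : Type*} [CommRing R] [Algebra K R] {N : ℕ} (r : Fin N → R)
    {v : Fin N → Fin m → Fin n → K} (hv : ∀ i, IsInvariantBasis A (v i)) :
    ∑ i, r i ⊗ₜ[K] exteriorPower.ιMulti K m (v i) ∈ (invariantWedge A m).baseChange R :=
  Submodule.sum_mem _ fun i _ =>
    Submodule.tmul_mem_baseChange_of_mem _ (Submodule.subset_span ⟨v i, hv i, rfl⟩)

/-- The exterior product of a basis of `M` generates the Plücker module. Once it lies in the base
change of `invariantWedge A m`, it is itself a sum of the required form. -/
lemma isGeneratedByInvariants_iff {R : Type u} [CommRing R] [Algebra K R] (M : Summand m n R)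
    (hM : Module.Free R M.carrier) :
    IsGeneratedByInvariants A m M.carrier ↔
      LinearMap.range (wedgeMap m K M.carrier) ≤ (invariantWedge A m).baseChange R := by
  constructor
  · rintro ⟨N, r, v, hv, h⟩
    rw [h, Submodule.span_singleton_le_iff_mem]
    exact sum_mem_baseChange A r hv
  · obtain ⟨y, -, -, hy⟩ := exists_matrix_of_free M hM
    rw [← hy, range_wedgeMap_span, Submodule.span_singleton_le_iff_mem]
    intro h
    obtain ⟨N, r, v, hv, h⟩ := exists_sum_of_mem_baseChange A h
    exact ⟨N, r, v, hv, by rw [range_wedgeMap_span, h]⟩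

lemma tmap_mem_baseChange {V : Type u} [AddCommGroup V] [Module K V] {U : Submodule K V}
    {R T : CommAlgCat.{u} K} (ε : R ⟶ T) {w : R ⊗[K] V} (hw : w ∈ U.baseChange R) :
    tmap V ε w ∈ U.baseChange T := by
  rw [Submodule.baseChange_eq_span] at hw
  induction hw using Submodule.span_induction with
  | mem w hw =>
    obtain ⟨u, hu, rfl⟩ := hw
    change tmap V ε (1 ⊗ₜ u) ∈ _
    rw [LinearMap.rTensor_tmul]
    exact Submodule.tmul_mem_baseChange_of_mem _ hu
  | zero => rw [map_zero]; exact Submodule.zero_mem _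
  | add x y _ _ hx hy => rw [map_add]; exact Submodule.add_mem _ hx hy
  | smul a x _ hx => rw [tmap_smul]; exact Submodule.smul_mem _ _ hx

/-- The containment can be tested by the vanishing of elements of `R`, hence locally, and locally
`M` is free. -/
lemma mem_grassmannianOfInvariants_iff {R : CommAlgCat.{u} K} (M : (grassmannian K m n).obj R) :
    M ∈ (grassmannianOfInvariants m A).obj R ↔
      LinearMap.range (wedgeMap m K (Summand.carrier M)) ≤ (invariantWedge A m).baseChange R := by
  constructor
  · intro h w hw
    rw [mem_baseChange_iff_pairing]
    intro ξ hξ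
    refine eq_zero_of_locally fun p => ?_
    obtain ⟨f, hf, hfree, hgen⟩ := h p
    refine ⟨f, hf, ?_⟩
    rw [← toAway_apply, ← pairing_tmap]
    have h1 := (isGeneratedByInvariants_iff A ((grassmannian K m n).map (toAway R f) M) hfree).1 hgen
    have h2 : tmap _ (toAway R f) w ∈ LinearMap.range (wedgeMap m K
        (Summand.carrier ((grassmannian K m n).map (toAway R f) M))) := by
      refine (range_wedgeMap_push (toAway R f) (Summand.carrier M)).ge ?_
      exact Submodule.subset_span ⟨w, hw, rfl⟩
    have h3 := (mem_baseChange_iff_pairing _ _).1 (h1 h2) ξ hξ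
    rw [← h3]
    congr 2
    simp
  · intro h p
    obtain ⟨a, ha, hfree⟩ := exists_free_away M p
    refine ⟨a, ha, hfree, ?_⟩
    refine (isGeneratedByInvariants_iff A ((grassmannian K m n).map (toAway R a) M) hfree).2 ?_
    refine (range_wedgeMap_push (toAway R a) (Summand.carrier M)).trans_le (Submodule.span_le.2 ?_)
    rintro _ ⟨w, hw, rfl⟩
    exact tmap_mem_baseChange _ (h hw)

/-- Both sides say that every form vanishing on `invariantWedge A m` vanishes on the Plücker module
of `M`. -/
lemma pluckerHom_mem_range_inclHom_iff {R : CommAlgCat.{u} K} (M : (grassmannian K m n).obj R) :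
    (pluckerHom K m n).app R M ∈ Set.range ((inclHom (invariantWedge A m)).app R) ↔
      M ∈ (grassmannianOfInvariants m A).obj R := by
  rw [inclHom, mem_range_quotientHom, pluckerHom_toSubmodule, mem_grassmannianOfInvariants_iff]
  constructor
  · intro h w hw
    rw [mem_baseChange_iff_pairing]
    exact fun ξ hξ => (mem_ker_pluckerMap _ _).1 (h ξ hξ) w hw
  · intro h ξ hξ
    rw [mem_ker_pluckerMap]
    exact fun w hw => (mem_baseChange_iff_pairing _ _).1 (h hw) ξ hξ

end invariants

section

variable {K : Type u} [Field K]

/-! ### Representing schemes and morphisms between them -/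

lemma IsClosedSubfunctor.of_iff {F F' : CommAlgCat.{u} K ⥤ Type u} (θ : F ⟶ F')
    {G : Subfunctor F'} (hG : IsClosedSubfunctor G) {H : Subfunctor F}
    (h : ∀ (R : CommAlgCat.{u} K) (x : F.obj R), x ∈ H.obj R ↔ θ.app R x ∈ G.obj R) :
    IsClosedSubfunctor H := by
  intro R x
  obtain ⟨I, hI⟩ := hG R (θ.app R x)
  refine ⟨I, fun T δ => ?_⟩
  rw [h, app_map_apply]
  exact hI T δ

lemma hom_inv_app_apply {F G : CommAlgCat.{u} K ⥤ Type u} (e : F ≅ G) {R : CommAlgCat.{u} K}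
    (y : G.obj R) : e.hom.app R (e.inv.app R y) = y :=
  congrArg (fun η : G ⟶ G => η.app R y) e.inv_hom_id

lemma inv_hom_app_apply {F G : CommAlgCat.{u} K ⥤ Type u} (e : F ≅ G) {R : CommAlgCat.{u} K}
    (x : F.obj R) : e.inv.app R (e.hom.app R x) = x :=
  congrArg (fun η : F ⟶ F => η.app R x) e.hom_inv_id

lemma hom_app_injective {F G : CommAlgCat.{u} K ⥤ Type u} (e : F ≅ G) (R : CommAlgCat.{u} K) :
    Function.Injective (e.hom.app R) :=
  Function.LeftInverse.injective (g := e.inv.app R) (inv_hom_app_apply e)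

lemma exists_representing_projectivization (V : Type u) [AddCommGroup V] [Module K V]
    [Module.Finite K V] : ∃ P : Sch K, Nonempty (points P ≅ projectivization (K := K) V) :=
  ⟨_, nonempty_iso_projSpace (Module.finBasis K V)⟩

section hom

variable {X Y : Sch K} {F F' : CommAlgCat.{u} K ⥤ Type u} (α : points X ≅ F) (β : points Y ≅ F')
  (η : F ⟶ F')

/-- `f` is the morphism of schemes corresponding to the transformation `η` of the functors they
represent. -/
def Represents (f : X ⟶ Y) : Prop :=
  ∀ (R : CommAlgCat.{u} K) (x : (points X).obj R),
    β.hom.app R ((pointsMap f).app R x) = η.app R (α.hom.app R x)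

/-- Full faithfulness of the functor of points. -/
lemma existsUnique_represents : ∃! f : X ⟶ Y, Represents α β η f := by
  obtain ⟨f, hf⟩ := exists_pointsMap_eq (α.hom ≫ η ≫ β.inv)
  refine ⟨f, fun R x => ?_, fun g hg => hom_ext_of_points ?_⟩
  · rw [hf]
    exact hom_inv_app_apply β _
  · rw [hf]
    ext R x
    refine hom_app_injective β R ?_
    exact (hg R x).trans (hom_inv_app_apply β _).symm

variable {α β η}

lemma Represents.injective {f : X ⟶ Y} (hf : Represents α β η f)
    (hη : ∀ R, Function.Injective (η.app R)) (R : CommAlgCat.{u} K) :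
    Function.Injective ((pointsMap f).app R) := fun x y h =>
  hom_app_injective α R (hη R (by rw [← hf, ← hf, h]))

lemma Represents.mem_range {f : X ⟶ Y} (hf : Represents α β η f) {R : CommAlgCat.{u} K}
    (y : (points Y).obj R) :
    y ∈ Set.range ((pointsMap f).app R) ↔ β.hom.app R y ∈ Set.range (η.app R) := by
  constructor
  · rintro ⟨x, rfl⟩
    exact ⟨_, (hf R x).symm⟩
  · rintro ⟨z, hz⟩
    refine ⟨α.inv.app R z, hom_app_injective β R ?_⟩
    rw [hf, hom_inv_app_apply, hz]

lemma Represents.isClosedImmersion {f : X ⟶ Y} (hf : Represents α β η f)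
    (hη : ∀ R, Function.Injective (η.app R)) (hc : IsClosedSubfunctor (Subfunctor.range η)) :
    IsClosedImmersion f.left :=
  isClosedImmersion_of_isClosedSubfunctor f (hf.injective hη)
    (IsClosedSubfunctor.of_iff β.hom hc fun _ y => hf.mem_range y)

end hom

/-- A functor with a closed immersion into a representable functor is representable. -/
lemma exists_representing_of_closed {F F' : CommAlgCat.{u} K ⥤ Type u} {P : Sch K}
    (β : points P ≅ F') (η : F ⟶ F') (hη : ∀ R, Function.Injective (η.app R))
    (hc : IsClosedSubfunctor (Subfunctor.range η)) :
    ∃ G : Sch K, Nonempty (points G ≅ F) := by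
  have hmem : ∀ (R : CommAlgCat.{u} K) (x : (points P).obj R),
      x ∈ Set.range ((η ≫ β.inv).app R) ↔ β.hom.app R x ∈ Set.range (η.app R) := by
    intro R x
    constructor
    · rintro ⟨z, rfl⟩
      exact ⟨z, (hom_inv_app_apply β _).symm⟩
    · rintro ⟨z, hz⟩
      refine ⟨z, hom_app_injective β R ?_⟩
      exact (hom_inv_app_apply β _).trans hz
  have hF : IsClosedSubfunctor (Subfunctor.range (η ≫ β.inv)) := IsClosedSubfunctor.of_iff β.hom hc hmem
  obtain ⟨G, i, hi, hr⟩ := exists_closed_subscheme hF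
  have : Mono i.left := inferInstance
  obtain ⟨e, -⟩ := exists_iso_of_range_eq (pointsMap i) (η ≫ β.inv) (pointsMap_app_injective i)
    (fun R => (Function.LeftInverse.injective (g := β.hom.app R)
      (hom_inv_app_apply β)).comp (hη R)) hr
  exact ⟨G, ⟨e⟩⟩

lemma isProjectiveScheme_of_isClosedImmersion {V : Type u} [AddCommGroup V] [Module K V]
    [Module.Finite K V] {X P : Sch K} (β : points P ≅ projectivization (K := K) V) (f : X ⟶ P)
    [IsClosedImmersion f.left] : IsProjectiveScheme X := by
  let b := Module.finBasis K V
  let N := Module.finrank K V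
  -- Using `N = dim V` instead of `dim V - 1` avoids a separate case for `V = 0`; the extra
  -- coordinate is mapped to zero.
  let ρ : (Fin (N + 1) → K) →ₗ[K] V :=
    b.equivFun.symm.toLinearMap ∘ₗ LinearMap.funLeft K K Fin.castSucc
  have hρ : Function.Surjective ρ := b.equivFun.symm.surjective.comp
    (LinearMap.funLeft_surjective_of_injective K K _ (Fin.castSucc_injective N))
  obtain ⟨γ⟩ := nonempty_iso_projSpace (Pi.basisFun K (Fin (N + 1)))
  obtain ⟨g, hg, -⟩ := existsUnique_represents β γ (quotientHom ρ hρ)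
  have hgc : IsClosedImmersion g.left := hg.isClosedImmersion (quotientHom_injective ρ hρ)
    (isClosedSubfunctor_range_quotientHom ρ hρ)
  refine ⟨N, (f.left ≫ g.left :), ?_, ?_⟩
  · exact (inferInstance : IsClosedImmersion (f.left ≫ g.left))
  · exact (Over.w (f ≫ g))

lemma pullback_hom_ext_of_fst {C : Type*} [Category* C] {T X Y Z : C} {f : X ⟶ Z} {g : Y ⟶ Z}
    [Limits.HasPullback f g] {x y : T ⟶ Limits.pullback f g}
    (hg : Function.Injective fun h : T ⟶ Y => h ≫ g)
    (h : x ≫ Limits.pullback.fst f g = y ≫ Limits.pullback.fst f g) : x = y := by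
  refine Limits.pullback.hom_ext h (hg ?_)
  simp only [Category.assoc, ← Limits.pullback.condition]
  rw [← Category.assoc, h, Category.assoc]

lemma exists_comp_pullback_fst_iff {C : Type*} [Category* C] {T X Y Z : C} (f : X ⟶ Z) (g : Y ⟶ Z)
    [Limits.HasPullback f g] (x : T ⟶ X) :
    (∃ t : T ⟶ Limits.pullback f g, t ≫ Limits.pullback.fst f g = x) ↔
      ∃ y : T ⟶ Y, y ≫ g = x ≫ f := by
  constructor
  · rintro ⟨t, rfl⟩
    exact ⟨t ≫ Limits.pullback.snd f g, by simp [Limits.pullback.condition]⟩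
  · rintro ⟨y, hy⟩
    exact ⟨Limits.pullback.lift x y hy.symm, Limits.pullback.lift_fst _ _ _⟩

lemma pullback_fst_injective {X Y Z : Sch K} (f : X ⟶ Z) (g : Y ⟶ Z)
    (hg : ∀ R, Function.Injective ((pointsMap g).app R)) (R : CommAlgCat.{u} K) :
    Function.Injective ((pointsMap (Limits.pullback.fst f g)).app R) := fun _ _ h =>
  pullback_hom_ext_of_fst (hg R) h

lemma mem_range_pullback_fst {X Y Z : Sch K} (f : X ⟶ Z) (g : Y ⟶ Z) {R : CommAlgCat.{u} K}
    (x : (points X).obj R) :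
    x ∈ Set.range ((pointsMap (Limits.pullback.fst f g)).app R) ↔
      (pointsMap f).app R x ∈ Set.range ((pointsMap g).app R) :=
  exists_comp_pullback_fst_iff f g _

end

/-! ### The arrows of the diagram as represented transformations. -/

section

variable {K : Type u} [Field K] {m n : ℕ}

lemma isPlucker_iff {G P : Sch K} (α : points G ≅ grassmannian K m n)
    (β : points P ≅ projectivization (DualWedge K m n)) (ι : G ⟶ P) :
    IsPlucker α β ι ↔ Represents α β (pluckerHom K m n) ι := by
  constructor
  · intro h R x
    refine Module.Grassmannian.ext ?_
    exact (h R x).2.trans (pluckerHom_toSubmodule _).symm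
  · intro h R x
    refine ⟨pluckerMap_surjective (Summand.isComplemented _), ?_⟩
    rw [h, pluckerHom_toSubmodule]

lemma isInducedByInclusion_iff {V : Type u} [AddCommGroup V] [Module K V] {U : Submodule K V}
    {Q P : Sch K} (γ : points Q ≅ projectivization (Module.Dual K U))
    (β : points P ≅ projectivization (Module.Dual K V)) (j : Q ⟶ P) :
    IsInducedByInclusion γ β j ↔ Represents γ β (inclHom U) j := by
  constructor
  · intro h R x
    exact Module.Grassmannian.ext (h R x)
  · intro h R x
    rw [h]
    rfl

end

end InvariantGrassmannian

end

theorem theorem3 {k : Type v} {K : Type u} [Field k] [Field K] [Algebra k K] (m n : ℕ)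
    (A : Subalgebra k (Matrix (Fin n) (Fin n) K)) :
    -- the three functors are represented by schemes over `K`
    (∃ G : Sch K, Nonempty (points G ≅ grassmannian K m n)) ∧
    (∃ P : Sch K, Nonempty (points P ≅ projectivization (Module.Dual K (⋀[K]^m (Fin n → K))))) ∧
    (∃ Q : Sch K, Nonempty (points Q ≅ projectivization (Module.Dual K (invariantWedge A m)))) ∧
    -- for any choice of these schemes:
    (∀ (G P Q : Sch K) (α : points G ≅ grassmannian K m n)
        (β : points P ≅ projectivization (Module.Dual K (⋀[K]^m (Fin n → K))))
        (γ : points Q ≅ projectivization (Module.Dual K (invariantWedge A m))),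
      -- the two arrows of the diagram exist, are unique, and are closed immersions
      (∃! ι : G ⟶ P, IsPlucker α β ι) ∧
      (∃! j : Q ⟶ P, IsInducedByInclusion γ β j) ∧
      ∀ (ι : G ⟶ P) (j : Q ⟶ P), IsPlucker α β ι → IsInducedByInclusion γ β j →
        IsClosedImmersion ι.left ∧ IsClosedImmersion j.left ∧
        -- the pullback represents `G_A(m,n)`, compatibly with the inclusion in `G(m,n)`
        (∃ θ : points (Limits.pullback ι j) ≅ (grassmannianOfInvariants m A).toFunctor,
          θ.hom ≫ (grassmannianOfInvariants m A).ι =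
            pointsMap (Limits.pullback.fst ι j) ≫ α.hom) ∧
        -- and is a projective closed subscheme of the Grassmannian
        IsClosedImmersion (Limits.pullback.fst ι j).left ∧
        IsProjectiveScheme (Limits.pullback ι j)) ∧
    -- a free summand belongs to `G_A(m,n)(R)` iff it is generated by `A`-invariants over `R`
    (∀ (R : CommAlgCat.{u} K) (M : (grassmannian K m n).obj R),
      Module.Free R (Summand.carrier M) →
        (M ∈ (grassmannianOfInvariants m A).obj R ↔
          IsGeneratedByInvariants A m (Summand.carrier M))) := by
  obtain ⟨P₀, ⟨β₀⟩⟩ := exists_representing_projectivization (K := K) (DualWedge K m n)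
  refine ⟨exists_representing_of_closed β₀ (pluckerHom K m n) pluckerHom_injective
    isClosedSubfunctor_range_pluckerHom, ⟨P₀, ⟨β₀⟩⟩, exists_representing_projectivization _,
    fun G P Q α β γ => ⟨?_, ?_, ?_⟩, fun R M hM => ?_⟩
  · simp only [isPlucker_iff]
    exact existsUnique_represents α β _
  · simp only [isInducedByInclusion_iff]
    exact existsUnique_represents γ β _
  · intro ι j hι hj
    rw [isPlucker_iff] at hι
    rw [isInducedByInclusion_iff] at hj
    have hUinj := quotientHom_injective _ (dualMap_subtype_surjective (invariantWedge A m))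
    have hUcl := isClosedSubfunctor_range_quotientHom _
      (dualMap_subtype_surjective (invariantWedge A m))
    have hιc : IsClosedImmersion ι.left :=
      hι.isClosedImmersion pluckerHom_injective isClosedSubfunctor_range_pluckerHom
    have hjc : IsClosedImmersion j.left := hj.isClosedImmersion hUinj hUcl
    have hinj := pullback_fst_injective ι j (hj.injective hUinj)
    -- A point of the Grassmannian lifts to the pullback exactly when its Plücker point comes from
    -- the smaller projective space. This condition is a preimage of a closed subfunctor, hence
    -- closed.
    have hmem : ∀ (R : CommAlgCat.{u} K) (x : (points G).obj R),
        x ∈ Set.range ((pointsMap (Limits.pullback.fst ι j)).app R) ↔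
          (pluckerHom K m n).app R (α.hom.app R x) ∈
            Set.range ((inclHom (invariantWedge A m)).app R) := fun R x => by
      rw [mem_range_pullback_fst, hj.mem_range, hι]
    have hfst : IsClosedImmersion (Limits.pullback.fst ι j).left :=
      isClosedImmersion_of_isClosedSubfunctor _ hinj
        (IsClosedSubfunctor.of_iff (α.hom ≫ pluckerHom K m n) hUcl hmem)
    refine ⟨hιc, hjc, ?_, hfst, ?_⟩
    · refine exists_iso_of_range_eq _ _ (fun R => (hom_app_injective α R).comp (hinj R))
        (fun R => Subtype.val_injective) fun R => Set.ext fun M => ?_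
      have hM : M ∈ Set.range ((pointsMap (Limits.pullback.fst ι j) ≫ α.hom).app R) ↔
          α.inv.app R M ∈ Set.range ((pointsMap (Limits.pullback.fst ι j)).app R) := by
        constructor
        · rintro ⟨x, rfl⟩
          exact ⟨x, (inv_hom_app_apply α _).symm⟩
        · rintro ⟨x, hx⟩
          refine ⟨x, ?_⟩
          exact (congrArg (α.hom.app R) hx).trans (hom_inv_app_apply α M)
      rw [hM, hmem, hom_inv_app_apply, pluckerHom_mem_range_inclHom_iff]
      exact ⟨fun h => ⟨⟨M, h⟩, rfl⟩, by rintro ⟨x, rfl⟩; exact x.2⟩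
    · have : IsClosedImmersion (Limits.pullback.fst ι j ≫ ι).left := by
        rw [Over.comp_left]
        infer_instance
      exact isProjectiveScheme_of_isClosedImmersion β (Limits.pullback.fst ι j ≫ ι)
  -- For free `M` both conditions are the same containment of the Plücker module.
  · rw [mem_grassmannianOfInvariants_iff, isGeneratedByInvariants_iff A M hM]
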